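/- **Theorem (polynomial realisation of a graded Lie superalgebra).** Let $\mathbb K\in\{\mathbb R,\mathbb C\}$ and let $\mathfrak g=\bigoplus_{i\in\mathbb Z}\mathfrak g_i$ be a $\mathbb Z$-graded finite-dimensional Lie superalgebra over $\mathbb K$ (each $\mathfrak g_i$ a super subspace, $[\mathfrak g_i,\mathfrak g_j]\subset\mathfrak g_{i+j}$). Put $\mathfrak g_\pm=\bigoplus_{\pm i>0}\mathfrak g_i$ and $\mathfrak k=\mathfrak g_0\oplus\mathfrak g_+$. Let $\lambda:\mathfrak g_0\to\mathbb K$ be a character (an even Lie superalgebra morphism), extended to $\mathfrak k$ by $\lambda(\mathfrak g_+)=0$, and let $\mathbb K_\lambda$ be the corresponding one-dimensional $\mathfrak k$-module. For a super vector space $V$, let $S(V)$ be its supersymmetric algebra. For an associative superalgebra $A$, let $\sigma:S(A)\to A$ be the symmetrisation map, $\sigma(a_1\bullet\cdots\bullet a_n)=\frac1{n!}\sum_{\tau\in S_n}(-1)^{|\tau|}a_{\tau(1)}\cdots a_{\tau(n)}$ for homogeneous $a_i$, where $\bullet$ is the product of $S(A)$ and $|\tau|$ is the number of pairs of odd elements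 $a_i,a_j$ whose order is reversed; the same letter denotes its restriction $S(\mathfrak g_-)\to U(\mathfrak g)$. Let $X_1,\dots,X_{r+s}$ be a basis of $\mathfrak g_-$ with $X_i$ even for $i\le r$ and odd for $i>r$, and let $\partial^i$ be the super derivation of $S(\mathfrak g_-)$, of the parity of $X_i$, with $\partial^iX_j=\delta_{ij}$. For $K\in\mathbb N^{r|s}=\mathbb N^r\times\{0,1\}^s$ put $|K|=\sum_i k_i$, $K!=\prod_i k_i!$, $\partial^K=(\partial^1)^{k_1}\cdots(\partial^{r+s})^{k_{r+s}}$, write $K>0$ for $K\ne0$, and put $$s^K(X)=\sigma\big(\widetilde{\rm ad}_{X_1}^{\bullet k_1}\bullet\cdots\bullet\widetilde{\rm ad}_{X_{r+s}}^{\bullet k_{r+s}}\big)X,\qquad \widetilde{\rm ad}_Z(Y)=[Y,Z],\qquad X\in\mathfrak g,$$ with $\sigma$ taken for $A=\mathrm{End}_{\mathbb K}(\mathfrak g)$. Let $B_n$ be the Bernoulli numbers with $B_1=-\frac12$, and let $C_1=B_1$, $C_n=-B_n$ for $n\ge2$. For $X\in\mathfrak k$ define $W_{i,K_1,\dots,K_j}(X)\in\mathfrak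 g_-$ and $H_{i,K_1,\dots,K_j}(X)\in\mathfrak k$, where $1\le i\le r+s$, $j\ge 0$ and all $K_a>0$, recursively by $$W_i(X)+H_i(X)=[X,X_i],\qquad W_{i,K_1,\dots,K_j}(X)+H_{i,K_1,\dots,K_j}(X)=\frac{(-1)^{|K_j|}C_{|K_j|}}{K_j!}\,s^{K_j}\big(H_{i,K_1,\dots,K_{j-1}}(X)\big).$$ Then $\Phi:S(\mathfrak g_-)\to U(\mathfrak g)\otimes_{U(\mathfrak k)}\mathbb K_\lambda$, $Y\mapsto\sigma(Y)\otimes1$, is a linear isomorphism, and the action $\pi(X)Y=\Phi^{-1}(X\,\Phi(Y))$ of $\mathfrak g$ on $S(\mathfrak g_-)$ is given by the following operators, in which elements of $\mathfrak g_-$ act on $S(\mathfrak g_-)$ by multiplication. * For $X\in\mathfrak g_-$: $s^K(X)\in\mathfrak g_-$ for all $K>0$, only finitely many $s^K(X)$ are non-zero, and $$\pi(X)=X+\sum_{K>0}\frac{(-1)^{|K|}B_{|K|}}{K!}\,s^K(X)\,\partial^K.$$ * For $X\in\mathfrak g_0$: $\ [X,X_i]\in\mathfrak g_-$ for all $i$,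 and $\ \pi(X)=\lambda(X)+\sum_{i=1}^{r+s}[X,X_i]\,\partial^i$. * For $X\in\mathfrak g_+$: only finitely many of the elements $W_{i,K_1,\dots,K_j}(X)+H_{i,K_1,\dots,K_j}(X)$, over all $i$, $j$ and $K_1,\dots,K_j>0$, are non-zero; there is an $l\in\mathbb N$ such that $H_{i,K_1,\dots,K_l}(X)=0$ for all $i$ and all $K_1,\dots,K_l>0$; and for each such $l$ $$\pi(X)=\sum_{i=1}^{r+s}\sum_{j=0}^{l}\ \sum_{K_1,\dots,K_j>0}W_{i,K_1,\dots,K_j}(X)\,\partial^{K_j}\cdots\partial^{K_1}\partial^i+\sum_{i=1}^{r+s}\sum_{j=0}^{l-1}\ \sum_{K_1,\dots,K_j>0}\lambda\big(H_{i,K_1,\dots,K_j}(X)\big)\,\partial^{K_j}\cdots\partial^{K_1}\partial^i .$$ If $\mathfrak g$ is 3-graded, that is, $\mathfrak g_+=\mathfrak g_1$ and $\mathfrak g_-=\mathfrak g_{-1}$, then $\pi(X)=X$ for $X\in\mathfrak g_{-1}$, $\ \pi(X)=\lambda(X)+\sum_i[X,X_i]\partial^i$ for $X\in\mathfrak g_0$,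 and for $X\in\mathfrak g_1$ all $[[X,X_i],X_j]$ lie in $\mathfrak g_{-1}$ and $$\pi(X)=\sum_{i=1}^{r+s}\lambda([X,X_i])\,\partial^i+\frac12\sum_{i,j=1}^{r+s}[[X,X_i],X_j]\,\partial^j\partial^i .$$ -/

import Mathlib

open scoped TensorProduct DirectSum

noncomputable section

universe u v w

/-! ### Super vector spaces and the supersymmetric algebra -/

/-- The Koszul sign `(-1)^(a b)` for parities `a`, `b`. -/
def koszul (a b : ZMod 2) : ℤ := if a = 1 ∧ b = 1 then -1 else 1

theorem koszul_comm (a b : ZMod 2) : koszul a b = koszul b a := by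
  simp only [koszul, and_comm]

theorem koszul_zero_right (a : ZMod 2) : koszul a 0 = 1 := by
  simp [koszul]

theorem koszul_mul_self (a b : ZMod 2) : koszul a b * koszul a b = 1 := by
  unfold koszul; split_ifs <;> norm_num

/-- A super vector space structure on `V`: a decomposition into an even part `par 0` and
an odd part `par 1`. -/
structure SuperSpace (𝕜 : Type u) (V : Type v) [Field 𝕜] [AddCommGroup V] [Module 𝕜 V] where
  par : ZMod 2 → Submodule 𝕜 V
  isCompl : IsCompl (par 0) (par 1)

namespace SuperSpace

variable {𝕜 : Type u} {V : Type v} [Field 𝕜] [AddCommGroup V] [Module 𝕜 V]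
variable (P : SuperSpace 𝕜 V)

/-- The projection of `V` onto its part of parity `a`. -/
def proj (a : ZMod 2) : V →ₗ[𝕜] V :=
  if a = 0 then (P.par 0).projection (P.par 1) P.isCompl
  else (P.par 1).projection (P.par 0) P.isCompl.symm

theorem zmod_two_cases (a : ZMod 2) : a = 0 ∨ a = 1 := by
  revert a; decide

theorem proj_mem (a : ZMod 2) (x : V) : P.proj a x ∈ P.par a := by
  rcases zmod_two_cases a with rfl | rfl
  · simp [proj]
  · simp [proj]

theorem proj_of_mem {a : ZMod 2} {x : V} (hx : x ∈ P.par a) : P.proj a x = x := by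
  rcases zmod_two_cases a with rfl | rfl
  · simpa [proj] using Submodule.projection_apply_left P.isCompl ⟨x, hx⟩
  · simpa [proj] using Submodule.projection_apply_left P.isCompl.symm ⟨x, hx⟩

theorem proj_of_mem_ne {a b : ZMod 2} {x : V} (hx : x ∈ P.par a) (h : b ≠ a) :
    P.proj b x = 0 := by
  rcases zmod_two_cases a with rfl | rfl <;> rcases zmod_two_cases b with rfl | rfl
  · exact absurd rfl h
  · simpa [proj] using Submodule.projection_apply_right P.isCompl.symm ⟨x, hx⟩
  · simpa [proj] using Submodule.projection_apply_right P.isCompl ⟨x, hx⟩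
  · exact absurd rfl h

theorem proj_zero_add_proj_one (x : V) : P.proj 0 x + P.proj 1 x = x := by
  simpa [proj] using Submodule.projection_add_projection_eq_self P.isCompl x

/-- The induced super vector space structure on a super subspace `W`, that is, on a subspace
that contains the homogeneous parts of its elements. -/
def restrict (W : Submodule 𝕜 V) (hW : ∀ a, ∀ x ∈ W, P.proj a x ∈ W) : SuperSpace 𝕜 W where
  par a := (P.par a).comap W.subtype
  isCompl := by
    constructor
    · rw [Submodule.disjoint_def]
      intro x h0 h1
      exact Subtype.ext ((Submodule.disjoint_def.mp P.isCompl.disjoint) x h0 h1)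
    · rw [codisjoint_iff, Submodule.eq_top_iff']
      intro x
      refine Submodule.mem_sup.mpr ⟨⟨P.proj 0 x, hW 0 x x.2⟩, P.proj_mem 0 x,
        ⟨P.proj 1 x, hW 1 x x.2⟩, P.proj_mem 1 x, ?_⟩
      exact Subtype.ext (P.proj_zero_add_proj_one x)

/-- The relations `x y = (-1)^(|x| |y|) y x` for homogeneous `x`, `y` in `V`. -/
inductive SymRel : TensorAlgebra 𝕜 V → TensorAlgebra 𝕜 V → Prop
  | swap {a b : ZMod 2} {x y : V} (hx : x ∈ P.par a) (hy : y ∈ P.par b) :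
      SymRel (TensorAlgebra.ι 𝕜 x * TensorAlgebra.ι 𝕜 y)
        (koszul a b • (TensorAlgebra.ι 𝕜 y * TensorAlgebra.ι 𝕜 x))

/-- The supersymmetric algebra `S(V)`. -/
def Sym : Type (max u v) := RingQuot P.SymRel

instance : Ring P.Sym := inferInstanceAs (Ring (RingQuot P.SymRel))

instance : Algebra 𝕜 P.Sym := inferInstanceAs (Algebra 𝕜 (RingQuot P.SymRel))

/-- The quotient map from the tensor algebra to `S(V)`. -/
def symMk : TensorAlgebra 𝕜 V →ₐ[𝕜] P.Sym := RingQuot.mkAlgHom 𝕜 P.SymRel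

/-- The inclusion of `V` in `S(V)`. -/
def ι : V →ₗ[𝕜] P.Sym :=
  P.symMk.toLinearMap ∘ₗ TensorAlgebra.ι 𝕜

/-- Algebra morphisms out of `S(V)`. -/
def symLift {A : Type w} [Ring A] [Algebra 𝕜 A] (f : V →ₗ[𝕜] A)
    (hf : ∀ ⦃a b : ZMod 2⦄ ⦃x y : V⦄, x ∈ P.par a → y ∈ P.par b →
      f x * f y = koszul a b • (f y * f x)) : P.Sym →ₐ[𝕜] A :=
  RingQuot.liftAlgHom 𝕜 ⟨TensorAlgebra.lift 𝕜 f, by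
    rintro _ _ ⟨hx, hy⟩
    simpa using hf hx hy⟩

theorem symLift_ι {A : Type w} [Ring A] [Algebra 𝕜 A] (f : V →ₗ[𝕜] A)
    (hf : ∀ ⦃a b : ZMod 2⦄ ⦃x y : V⦄, x ∈ P.par a → y ∈ P.par b →
      f x * f y = koszul a b • (f y * f x)) (x : V) : P.symLift f hf (P.ι x) = f x := by
  have h := RingQuot.liftAlgHom_mkAlgHom_apply 𝕜 (TensorAlgebra.lift 𝕜 f)
    (s := P.SymRel) (by rintro _ _ ⟨hx, hy⟩; simpa using hf hx hy) (TensorAlgebra.ι 𝕜 x)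
  rw [TensorAlgebra.lift_ι_apply] at h
  exact h

theorem ι_mul_ι {a b : ZMod 2} {x y : V} (hx : x ∈ P.par a) (hy : y ∈ P.par b) :
    P.ι x * P.ι y = koszul a b • (P.ι y * P.ι x) := by
  have h : P.symMk _ = P.symMk _ := RingQuot.mkAlgHom_rel 𝕜 (SymRel.swap (P := P) hx hy)
  simpa [ι] using h

theorem symHom_ext {A : Type w} [Ring A] [Algebra 𝕜 A] {f g : P.Sym →ₐ[𝕜] A}
    (h : ∀ x, f (P.ι x) = g (P.ι x)) : f = g := by
  refine RingQuot.ringQuot_ext' 𝕜 f g ?_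
  apply TensorAlgebra.hom_ext
  ext x
  exact h x

/-! ### Symmetrisation -/

/-- The sign of the reordering of `a_0, …, a_{n-1}`, of parities `ε`, into
`a_{τ 0}, …, a_{τ (n-1)}`: a factor `-1` for each pair of odd elements whose order changes. -/
def koszulSign {n : ℕ} (ε : Fin n → ZMod 2) (τ : Equiv.Perm (Fin n)) : ℤ :=
  ∏ p : Fin n × Fin n,
    if p.1 < p.2 ∧ τ.symm p.2 < τ.symm p.1 then koszul (ε p.1) (ε p.2) else 1

variable {A : Type w} [Ring A] [Algebra 𝕜 A]

/-- The multilinear map which on homogeneous elements `a_i` of parities `ε i` is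
`(1/n!) ∑ τ, ± f a_{τ 0} ⋯ f a_{τ (n-1)}`, see `symMulti_apply`. -/
def symMulti (f : V →ₗ[𝕜] A) (n : ℕ) : MultilinearMap 𝕜 (fun _ : Fin n => V) A :=
  ((n.factorial : 𝕜)⁻¹) • ∑ ε : Fin n → ZMod 2, ∑ τ : Equiv.Perm (Fin n),
    koszulSign ε τ • ((MultilinearMap.mkPiAlgebraFin 𝕜 n A).domDomCongr τ).compLinearMap
      (fun i => f ∘ₗ P.proj (ε i))

theorem symMulti_eq (f : V →ₗ[𝕜] A) (n : ℕ) (x : Fin n → V) :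
    P.symMulti f n x = ((n.factorial : 𝕜)⁻¹) • ∑ ε : Fin n → ZMod 2, ∑ τ : Equiv.Perm (Fin n),
      koszulSign ε τ • (List.ofFn fun i => f (P.proj (ε (τ i)) (x (τ i)))).prod := by
  simp [symMulti]

theorem prod_proj_eq_zero (f : V →ₗ[𝕜] A) {n : ℕ} (x : Fin n → V) (ε : Fin n → ZMod 2)
    (τ : Equiv.Perm (Fin n)) (j : Fin n) (h : P.proj (ε j) (x j) = 0) :
    (List.ofFn fun i => f (P.proj (ε (τ i)) (x (τ i)))).prod = 0 := by
  have hm : (0 : A) ∈ List.ofFn fun i => f (P.proj (ε (τ i)) (x (τ i))) := by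
    rw [List.mem_ofFn]
    exact ⟨τ.symm j, by simp [h]⟩
  obtain ⟨s, t, hst⟩ := List.append_of_mem hm
  rw [hst]; simp

theorem symMulti_apply (f : V →ₗ[𝕜] A) (n : ℕ) (x : Fin n → V) (ε : Fin n → ZMod 2)
    (hx : ∀ i, x i ∈ P.par (ε i)) :
    P.symMulti f n x = ((n.factorial : 𝕜)⁻¹) • ∑ τ : Equiv.Perm (Fin n),
      koszulSign ε τ • (List.ofFn fun i => f (x (τ i))).prod := by
  rw [symMulti_eq]
  congr 1
  rw [Finset.sum_eq_single ε]
  · refine Finset.sum_congr rfl fun τ _ => ?_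
    simp only [P.proj_of_mem (hx _)]
  · intro δ _ hδ
    obtain ⟨j, hj⟩ := Function.ne_iff.mp hδ
    refine Finset.sum_eq_zero fun τ _ => ?_
    rw [P.prod_proj_eq_zero f x δ τ j (P.proj_of_mem_ne (hx j) hj), smul_zero]
  · intro h; exact absurd (Finset.mem_univ _) h

theorem koszulSign_swap {n : ℕ} (ε : Fin n → ZMod 2) (τ : Equiv.Perm (Fin n)) (k l : Fin n)
    (hkl : (l : ℕ) = k + 1) :
    koszulSign (fun i => ε (Equiv.swap k l i)) (Equiv.swap k l * τ) =
      koszul (ε k) (ε l) * koszulSign ε τ := by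
  have hne : k ≠ l := by intro h; subst h; omega
  set s := Equiv.swap k l with hs
  have hss : ∀ i, s (s i) = i := fun i => Equiv.swap_apply_self k l i
  have hre : koszulSign (fun i => ε (s i)) (s * τ) = ∏ p : Fin n × Fin n,
      if s p.1 < s p.2 ∧ τ.symm p.2 < τ.symm p.1 then koszul (ε p.1) (ε p.2) else 1 := by
    unfold koszulSign
    refine Fintype.prod_equiv (Equiv.prodCongr s s) _ _ fun p => ?_
    have h1 : ∀ i, (s * τ).symm i = τ.symm (s i) := fun i => by
      rw [Equiv.symm_apply_eq]; simp [hss]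
    simp [h1, hss]
  have hD : (∏ p : Fin n × Fin n,
      ((if p = (k, l) then (if τ.symm l < τ.symm k then koszul (ε k) (ε l) else 1) else 1) *
       (if p = (l, k) then (if τ.symm l < τ.symm k then 1 else koszul (ε k) (ε l)) else 1))) =
      koszul (ε k) (ε l) := by
    rw [Finset.prod_mul_distrib, Finset.prod_ite_eq' , Finset.prod_ite_eq']
    simp only [Finset.mem_univ, if_true]
    split_ifs <;> simp
  rw [hre, ← hD, koszulSign, ← Finset.prod_mul_distrib]
  refine Finset.prod_congr rfl fun p _ => ?_
  obtain ⟨i, j⟩ := p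
  have hsk : s k = l := Equiv.swap_apply_left k l
  have hsl : s l = k := Equiv.swap_apply_right k l
  have hkl' : k < l := by rw [Fin.lt_def]; omega
  have hnlk : ¬ l < k := not_lt.mpr hkl'.le
  have hτ : τ.symm k ≠ τ.symm l := fun h => hne (τ.symm.injective h)
  by_cases h1 : (i, j) = (k, l)
  · obtain ⟨rfl, rfl⟩ := Prod.mk.inj h1
    simp only [hsk, hsl, hnlk, hkl', if_true, false_and, true_and, if_false]
    have : ¬ (i, j) = (j, i) := fun h => hne (Prod.mk.inj h).1
    simp only [this, if_false, mul_one]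
    split_ifs <;> simp [koszul_mul_self]
  by_cases h2 : (i, j) = (l, k)
  · obtain ⟨rfl, rfl⟩ := Prod.mk.inj h2
    simp only [hsk, hsl, hnlk, hkl', if_true, false_and, true_and, if_false, h1, one_mul, mul_one]
    rcases lt_or_gt_of_ne hτ with h | h
    · simp [h, not_lt.mpr h.le, koszul_comm]
    · simp [h, not_lt.mpr h.le]
  simp only [h1, h2, if_false, one_mul]
  have hiff : s i < s j ↔ i < j := by
    simp only [Prod.mk.injEq, not_and] at h1 h2
    simp only [hs, Equiv.swap_apply_def, Fin.lt_def, Fin.ext_iff] at *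
    split_ifs <;> omega
  simp only [hiff]

theorem symMulti_swap (f : V →ₗ[𝕜] A) {n : ℕ} (x : Fin n → V) (k l : Fin n)
    (hkl : (l : ℕ) = k + 1) {a b : ZMod 2} (hk : x k ∈ P.par a) (hl : x l ∈ P.par b) :
    P.symMulti f n x = koszul a b • P.symMulti f n (fun i => x (Equiv.swap k l i)) := by
  rw [symMulti_eq, symMulti_eq, smul_comm]
  congr 1
  rw [Finset.smul_sum]
  refine Fintype.sum_equiv (Equiv.arrowCongr (Equiv.swap k l) (Equiv.refl _)) _ _ fun ε => ?_
  rw [Finset.smul_sum]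
  refine Fintype.sum_equiv (Equiv.mulLeft (Equiv.swap k l)) _ _ fun τ => ?_
  have hε : (Equiv.arrowCongr (Equiv.swap k l) (Equiv.refl (ZMod 2))) ε =
      fun i => ε (Equiv.swap k l i) := by
    ext i; simp [Equiv.arrowCongr]
  rw [hε, Equiv.coe_mulLeft, koszulSign_swap ε τ k l hkl]
  by_cases ha : ε k = a
  · by_cases hb : ε l = b
    · subst ha hb
      rw [smul_smul, ← mul_assoc, koszul_mul_self, one_mul]
      simp
    · rw [P.prod_proj_eq_zero f x ε τ l (P.proj_of_mem_ne hl hb), smul_zero]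
      have := P.prod_proj_eq_zero f x ε τ l (P.proj_of_mem_ne hl hb)
      simp [this]
  · rw [P.prod_proj_eq_zero f x ε τ k (P.proj_of_mem_ne hk ha), smul_zero]
    have := P.prod_proj_eq_zero f x ε τ k (P.proj_of_mem_ne hk ha)
    simp [this]

/-- Symmetrisation on the tensor algebra. -/
def symTensor (f : V →ₗ[𝕜] A) : TensorAlgebra 𝕜 V →ₗ[𝕜] A :=
  (DirectSum.toModule 𝕜 ℕ A fun n => PiTensorProduct.lift (P.symMulti f n)) ∘ₗ
    (TensorAlgebra.toDirectSum (R := 𝕜) (M := V)).toLinearMap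

theorem symTensor_ofFn (f : V →ₗ[𝕜] A) {n : ℕ} (x : Fin n → V) :
    P.symTensor f (List.ofFn fun i => TensorAlgebra.ι 𝕜 (x i)).prod = P.symMulti f n x := by
  rw [← TensorAlgebra.tprod_apply, symTensor, LinearMap.comp_apply, AlgHom.toLinearMap_apply,
    TensorAlgebra.toDirectSum_tensorPower_tprod]
  erw [DirectSum.toModule_lof]
  simp

theorem symTensor_list (f : V →ₗ[𝕜] A) (L : List V) :
    P.symTensor f (L.map (TensorAlgebra.ι 𝕜)).prod = P.symMulti f L.length L.get := by
  rw [← symTensor_ofFn]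
  congr 2
  apply List.ext_getElem <;> simp

theorem symTensor_swap_list (f : V →ₗ[𝕜] A) (L M : List V) {a b : ZMod 2} {x y : V}
    (hx : x ∈ P.par a) (hy : y ∈ P.par b) :
    P.symTensor f ((L ++ x :: y :: M).map (TensorAlgebra.ι 𝕜)).prod =
      koszul a b • P.symTensor f ((L ++ y :: x :: M).map (TensorAlgebra.ι 𝕜)).prod := by
  set N := L ++ x :: y :: M with hN
  have hlen : N.length = L.length + M.length + 2 := by simp [hN]; omega
  set k : Fin N.length := ⟨L.length, by omega⟩
  set l : Fin N.length := ⟨L.length + 1, by omega⟩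
  have hk : N.get k = x := by simp [k, hN]
  have hl : N.get l = y := by simp [l, hN]
  rw [symTensor_list, P.symMulti_swap f N.get k l rfl (a := a) (b := b)
    (by rw [hk]; exact hx) (by rw [hl]; exact hy), ← symTensor_ofFn]
  congr 3
  apply List.ext_getElem
  · simp [hlen]; omega
  intro i h1 h2
  simp only [List.getElem_ofFn, List.getElem_map]
  congr 1
  by_cases hik : i = L.length
  · have : (⟨i, by simpa using h1⟩ : Fin N.length) = k := Fin.ext hik
    rw [this, Equiv.swap_apply_left, hl]
    simp [hik]
  by_cases hil : i = L.length + 1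
  · have : (⟨i, by simpa using h1⟩ : Fin N.length) = l := Fin.ext hil
    rw [this, Equiv.swap_apply_right, hk]
    simp [hil]
  rw [Equiv.swap_apply_of_ne_of_ne (fun h => hik (congrArg Fin.val h))
    (fun h => hil (congrArg Fin.val h))]
  simp only [List.get_eq_getElem, hN]
  rcases lt_or_ge i L.length with hi | hi
  · simp [List.getElem_append_left hi]
  · rw [List.getElem_append_right hi, List.getElem_append_right hi]
    obtain ⟨m, hm⟩ : ∃ m, i - L.length = m + 2 := ⟨i - L.length - 2, by omega⟩
    simp [hm]

theorem tensor_span :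
    Submodule.span 𝕜 (Set.range fun L : List V => (L.map (TensorAlgebra.ι 𝕜)).prod) = ⊤ := by
  rw [Submodule.eq_top_iff']
  intro t
  induction t using TensorAlgebra.induction with
  | algebraMap r =>
    rw [Algebra.algebraMap_eq_smul_one]
    exact Submodule.smul_mem _ _ (Submodule.subset_span ⟨[], by simp⟩)
  | ι x => exact Submodule.subset_span ⟨[x], by simp⟩
  | mul s t hs ht =>
    have h := Submodule.mul_mem_mul hs ht
    rw [Submodule.span_mul_span] at h
    refine Submodule.span_mono ?_ h
    rintro _ ⟨_, ⟨L, rfl⟩, _, ⟨M, rfl⟩, rfl⟩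
    exact ⟨L ++ M, by simp⟩
  | add s t hs ht => exact Submodule.add_mem _ hs ht

theorem symTensor_swap (f : V →ₗ[𝕜] A) (s t : TensorAlgebra 𝕜 V) {a b : ZMod 2} {x y : V}
    (hx : x ∈ P.par a) (hy : y ∈ P.par b) :
    P.symTensor f (s * (TensorAlgebra.ι 𝕜 x * TensorAlgebra.ι 𝕜 y) * t) =
      P.symTensor f (s * (koszul a b • (TensorAlgebra.ι 𝕜 y * TensorAlgebra.ι 𝕜 x)) * t) := by
  have hs : s ∈ Submodule.span 𝕜
      (Set.range fun L : List V => (L.map (TensorAlgebra.ι 𝕜)).prod) := by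
    rw [tensor_span]; trivial
  have ht : t ∈ Submodule.span 𝕜
      (Set.range fun L : List V => (L.map (TensorAlgebra.ι 𝕜)).prod) := by
    rw [tensor_span]; trivial
  induction hs using Submodule.span_induction with
  | mem s hs =>
    obtain ⟨L, rfl⟩ := hs
    induction ht using Submodule.span_induction with
    | mem t ht =>
      obtain ⟨M, rfl⟩ := ht
      have h := P.symTensor_swap_list f L M hx hy
      simp only [List.map_append, List.map_cons, List.prod_append, List.prod_cons] at h
      rw [mul_smul_comm, smul_mul_assoc, map_zsmul]
      simpa only [mul_assoc] using h
    | zero => simp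
    | add t t' _ _ h h' => simp only [mul_add, map_add, h, h']
    | smul c t _ h => simp only [mul_smul_comm, map_smul] at h ⊢; rw [h]
  | zero => simp
  | add s s' _ _ h h' => simp only [add_mul, map_add, h, h']
  | smul c s _ h => simp only [smul_mul_assoc, map_smul] at h ⊢; rw [h]

theorem symTensor_rel (f : V →ₗ[𝕜] A) {p q : TensorAlgebra 𝕜 V}
    (h : RingQuot.Rel P.SymRel p q) :
    ∀ s t, P.symTensor f (s * p * t) = P.symTensor f (s * q * t) := by
  induction h with
  | of h => obtain ⟨hx, hy⟩ := h; exact fun s t => P.symTensor_swap f s t hx hy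
  | add_left _ ih => intro s t; simp only [mul_add, add_mul, map_add, ih]
  | mul_left _ ih => intro s t; simpa only [mul_assoc] using ih s (_ * t)
  | mul_right _ ih => intro s t; simpa only [mul_assoc] using ih (s * _) t

/-- The function on `S(V)` induced by `symTensor`. -/
def symFun (f : V →ₗ[𝕜] A) (x : RingQuot P.SymRel) : A :=
  Quot.lift (P.symTensor f) (fun p q h => by simpa using P.symTensor_rel f h 1 1) x.toQuot

/-- The symmetrisation map. For a parity preserving linear map `f` from `V` to an associative
superalgebra `A` it is the composition of `S(f) : S(V) → S(A)` and the symmetrisation map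
`S(A) → A`: it sends the product of homogeneous `a_1, …, a_n` to
`(1/n!) ∑ τ, ± f a_{τ 1} ⋯ f a_{τ n}`, see `symmetrise_apply`. -/
def symmetrise (f : V →ₗ[𝕜] A) : P.Sym →ₗ[𝕜] A where
  toFun := P.symFun f
  map_add' := by
    rintro ⟨⟨x⟩⟩ ⟨⟨y⟩⟩
    exact (congrArg (P.symFun f) (RingQuot.add_quot P.SymRel)).trans
      (map_add (P.symTensor f) x y)
  map_smul' := by
    rintro c ⟨⟨x⟩⟩
    exact (congrArg (P.symFun f) (RingQuot.smul_quot P.SymRel)).trans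
      (map_smul (P.symTensor f) c x)

theorem symmetrise_mk (f : V →ₗ[𝕜] A) (t : TensorAlgebra 𝕜 V) :
    P.symmetrise f (P.symMk t) = P.symTensor f t := by
  have : P.symMk t = (⟨Quot.mk _ t⟩ : RingQuot P.SymRel) := by
    have h := RingHom.congr_fun (RingQuot.mkAlgHom_coe 𝕜 P.SymRel) t
    rw [RingQuot.mkRingHom_def] at h
    exact h
  rw [this]; rfl

theorem symmetrise_apply (f : V →ₗ[𝕜] A) {n : ℕ} (x : Fin n → V) (ε : Fin n → ZMod 2)
    (hx : ∀ i, x i ∈ P.par (ε i)) :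
    P.symmetrise f (List.ofFn fun i => P.ι (x i)).prod =
      ((n.factorial : 𝕜)⁻¹) • ∑ τ : Equiv.Perm (Fin n),
        koszulSign ε τ • (List.ofFn fun i => f (x (τ i))).prod := by
  rw [← P.symMulti_apply f n x ε hx, ← symTensor_ofFn, ← symmetrise_mk,
    map_list_prod P.symMk]
  congr 2
  apply List.ext_getElem <;> simp [ι]

/-! ### Super derivations -/

/-- The algebra automorphism of `S(V)` that is `(-1)^(a b)` on elements of parity `b`. -/
def twist (a : ZMod 2) : P.Sym →ₐ[𝕜] P.Sym :=
  P.symLift (P.ι ∘ₗ (P.proj 0 + koszul a 1 • P.proj 1)) (by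
    intro b c x y hx hy
    have h : ∀ {d : ZMod 2} {z : V}, z ∈ P.par d →
        P.ι ((P.proj 0 + koszul a 1 • P.proj 1) z) = koszul a d • P.ι z := by
      intro d z hz
      rcases zmod_two_cases d with rfl | rfl
      · simp [P.proj_of_mem hz, P.proj_of_mem_ne hz (b := 1) (by decide), koszul_zero_right]
      · simp [P.proj_of_mem hz, P.proj_of_mem_ne hz (b := 0) (by decide)]
    simp only [LinearMap.comp_apply]
    rw [h hx, h hy, smul_mul_smul_comm, smul_mul_smul_comm, P.ι_mul_ι hx hy, smul_comm,
      mul_comm (koszul a b)])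

theorem twist_ι (a : ZMod 2) {b : ZMod 2} {x : V} (hx : x ∈ P.par b) :
    P.twist a (P.ι x) = koszul a b • P.ι x := by
  rw [twist, symLift_ι]
  rcases zmod_two_cases b with rfl | rfl
  · simp [P.proj_of_mem hx, P.proj_of_mem_ne hx (b := 1) (by decide), koszul_zero_right]
  · simp [P.proj_of_mem hx, P.proj_of_mem_ne hx (b := 0) (by decide)]

/-- The algebra morphism to upper triangular matrices whose diagonal entries are `twist a` and the
identity and whose upper right entry is a super derivation. -/
def derivHom (a : ZMod 2) (ξ : V →ₗ[𝕜] 𝕜) : P.Sym →ₐ[𝕜] Matrix (Fin 2) (Fin 2) P.Sym :=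
  P.symLift
    { toFun := fun x => !![P.twist a (P.ι x), algebraMap 𝕜 P.Sym (ξ (P.proj a x)); 0, P.ι x]
      map_add' := fun x y => by
        ext i j; fin_cases i <;> fin_cases j <;> simp
      map_smul' := fun c x => by
        ext i j; fin_cases i <;> fin_cases j <;> simp [Algebra.smul_def] }
    (by
      intro b c x y hx hy
      simp only [LinearMap.coe_mk, AddHom.coe_mk, Matrix.mul_fin_two, Matrix.smul_of,
        Matrix.smul_cons, mul_zero, add_zero, zero_mul, zero_add,
        Matrix.smul_empty]
      have h1 : P.twist a (P.ι x) * P.twist a (P.ι y) =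
          koszul b c • (P.twist a (P.ι y) * P.twist a (P.ι x)) := by
        rw [← map_mul, P.ι_mul_ι hx hy, map_zsmul, map_mul]
      have h2 : P.twist a (P.ι x) * algebraMap 𝕜 P.Sym (ξ (P.proj a y)) +
          algebraMap 𝕜 P.Sym (ξ (P.proj a x)) * P.ι y =
          koszul b c • (P.twist a (P.ι y) * algebraMap 𝕜 P.Sym (ξ (P.proj a x))) +
          koszul b c • (algebraMap 𝕜 P.Sym (ξ (P.proj a y)) * P.ι x) := by
        have hl : P.twist a (P.ι x) * algebraMap 𝕜 P.Sym (ξ (P.proj a y)) =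
            koszul b c • (algebraMap 𝕜 P.Sym (ξ (P.proj a y)) * P.ι x) := by
          rw [P.twist_ι a hx]
          by_cases h : a = c
          · subst h
            rw [koszul_comm, smul_mul_assoc, Algebra.commutes]
          · rw [P.proj_of_mem_ne hy h]; simp
        have hr : algebraMap 𝕜 P.Sym (ξ (P.proj a x)) * P.ι y =
            koszul b c • (P.twist a (P.ι y) * algebraMap 𝕜 P.Sym (ξ (P.proj a x))) := by
          rw [P.twist_ι a hy]
          by_cases h : a = b
          · subst h
            rw [smul_mul_assoc, smul_smul, koszul_mul_self, one_smul, Algebra.commutes]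
          · rw [P.proj_of_mem_ne hx h]; simp
        rw [hl, hr, add_comm]
      rw [h1, h2, P.ι_mul_ι hx hy]
      simp only [smul_add, smul_zero])

/-- The super derivation of parity `a` of `S(V)` that extends the linear form `ξ` on the part of
`V` of parity `a` and vanishes on the other part, see `superDeriv_ι` and `superDeriv_mul`. -/
def superDeriv (a : ZMod 2) (ξ : V →ₗ[𝕜] 𝕜) : Module.End 𝕜 P.Sym where
  toFun z := P.derivHom a ξ z 0 1
  map_add' x y := by simp
  map_smul' c x := by simp

theorem superDeriv_ι (a : ZMod 2) (ξ : V →ₗ[𝕜] 𝕜) (x : V) :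
    P.superDeriv a ξ (P.ι x) = algebraMap 𝕜 P.Sym (ξ (P.proj a x)) := by
  simp [superDeriv, derivHom, symLift_ι]

theorem sym_induction {p : P.Sym → Prop} (h1 : ∀ r, p (algebraMap 𝕜 P.Sym r))
    (hι : ∀ x, p (P.ι x)) (hadd : ∀ x y, p x → p y → p (x + y))
    (hmul : ∀ x y, p x → p y → p (x * y)) (z : P.Sym) : p z := by
  obtain ⟨t, rfl⟩ : ∃ t, P.symMk t = z := RingQuot.mkAlgHom_surjective 𝕜 P.SymRel z
  induction t using TensorAlgebra.induction with
  | algebraMap r => rw [AlgHom.commutes]; exact h1 r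
  | ι x => exact hι x
  | mul s t hs ht => rw [map_mul]; exact hmul _ _ hs ht
  | add s t hs ht => rw [map_add]; exact hadd _ _ hs ht

theorem derivHom_entries (a : ZMod 2) (ξ : V →ₗ[𝕜] 𝕜) (z : P.Sym) :
    P.derivHom a ξ z 0 0 = P.twist a z ∧ P.derivHom a ξ z 1 0 = 0 ∧
      P.derivHom a ξ z 1 1 = z := by
  induction z using P.sym_induction with
  | h1 r => simp [Matrix.algebraMap_matrix_apply]
  | hι x => simp [derivHom, symLift_ι]
  | hadd x y hx hy => simp [hx, hy]
  | hmul x y hx hy => simp [Matrix.mul_apply, hx, hy]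

/-- The super Leibniz rule. -/
theorem superDeriv_mul (a : ZMod 2) (ξ : V →ₗ[𝕜] 𝕜) (y z : P.Sym) :
    P.superDeriv a ξ (y * z) = P.superDeriv a ξ y * z + P.twist a y * P.superDeriv a ξ z := by
  simp [superDeriv, Matrix.mul_apply, P.derivHom_entries, add_comm]

end SuperSpace

/-! ### Multi-indices and coefficients -/

/-- The multi-indices `K ≠ 0` in `ℕ^{r|s}`: the last `s` entries are at most one. -/
def MultiIndex (r s : ℕ) : Type :=
  {K : Fin (r + s) → ℕ // K ≠ 0 ∧ ∀ i : Fin (r + s), r ≤ (i : ℕ) → K i ≤ 1}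

/-- `|K|`. -/
def MultiIndex.size {r s : ℕ} (K : MultiIndex r s) : ℕ := ∑ i, K.1 i

/-- `K!`; the entries at the odd places are at most one and contribute a factor one. -/
def MultiIndex.fact {r s : ℕ} (K : MultiIndex r s) : ℕ := ∏ i, (K.1 i).factorial

/-- The parity of the `i`-th vector of a basis of `r` even and `s` odd vectors, in this order. -/
def indexParity {r s : ℕ} (i : Fin (r + s)) : ZMod 2 := if (i : ℕ) < r then 0 else 1

/-- The numbers `C_n`: `C_1 = B_1 = -1/2` and `C_n = -B_n` for `n ≥ 2`. -/
def bernoulliC (n : ℕ) : ℚ := if n = 1 then bernoulli 1 else -bernoulli n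

/-- The coefficient `(-1)^|K| B_|K| / K!`. -/
def coeffB (𝕜 : Type u) [Field 𝕜] {r s : ℕ} (K : MultiIndex r s) : 𝕜 :=
  (-1) ^ K.size * ((bernoulli K.size : ℚ) : 𝕜) / (K.fact : 𝕜)

/-- The coefficient `(-1)^|K| C_|K| / K!`. -/
def coeffC (𝕜 : Type u) [Field 𝕜] {r s : ℕ} (K : MultiIndex r s) : 𝕜 :=
  (-1) ^ K.size * ((bernoulliC K.size : ℚ) : 𝕜) / (K.fact : 𝕜)

/-! ### Lie superalgebras -/

/-- A Lie superalgebra structure on the vector space `g`. -/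
structure LieSuperalgebra (𝕜 : Type u) (g : Type v) [Field 𝕜] [AddCommGroup g] [Module 𝕜 g]
    extends SuperSpace 𝕜 g where
  bracket : g →ₗ[𝕜] g →ₗ[𝕜] g
  bracket_mem : ∀ {a b : ZMod 2} {x y : g}, x ∈ par a → y ∈ par b → bracket x y ∈ par (a + b)
  skew : ∀ {a b : ZMod 2} {x y : g}, x ∈ par a → y ∈ par b →
    bracket x y = -(koszul a b • bracket y x)
  jacobi : ∀ {a b : ZMod 2} {x y : g} (z : g), x ∈ par a → y ∈ par b →
    bracket x (bracket y z) = bracket (bracket x y) z + koszul a b • bracket y (bracket x z)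

namespace LieSuperalgebra

variable {𝕜 : Type u} {g : Type v} [Field 𝕜] [AddCommGroup g] [Module 𝕜 g]
variable (L : LieSuperalgebra 𝕜 g)

/-- The relations `x y - (-1)^(|x| |y|) y x = [x, y]` for homogeneous `x`, `y` in `g`. -/
inductive EnvRel : TensorAlgebra 𝕜 g → TensorAlgebra 𝕜 g → Prop
  | swap {a b : ZMod 2} {x y : g} (hx : x ∈ L.par a) (hy : y ∈ L.par b) :
      EnvRel (TensorAlgebra.ι 𝕜 x * TensorAlgebra.ι 𝕜 y)
        (koszul a b • (TensorAlgebra.ι 𝕜 y * TensorAlgebra.ι 𝕜 x) +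
          TensorAlgebra.ι 𝕜 (L.bracket x y))

/-- The universal enveloping algebra `U(g)`. -/
def Env : Type (max u v) := RingQuot L.EnvRel

instance : Ring L.Env := inferInstanceAs (Ring (RingQuot L.EnvRel))

instance : Algebra 𝕜 L.Env := inferInstanceAs (Algebra 𝕜 (RingQuot L.EnvRel))

/-- The quotient map from the tensor algebra to `U(g)`. -/
def envMk : TensorAlgebra 𝕜 g →ₐ[𝕜] L.Env := RingQuot.mkAlgHom 𝕜 L.EnvRel

/-- The canonical map from `g` to `U(g)`. -/
def envι : g →ₗ[𝕜] L.Env :=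
  L.envMk.toLinearMap ∘ₗ TensorAlgebra.ι 𝕜

theorem envι_mul_envι {a b : ZMod 2} {x y : g} (hx : x ∈ L.par a) (hy : y ∈ L.par b) :
    L.envι x * L.envι y = koszul a b • (L.envι y * L.envι x) + L.envι (L.bracket x y) := by
  have h : L.envMk _ = L.envMk _ := RingQuot.mkAlgHom_rel 𝕜 (EnvRel.swap (L := L) hx hy)
  simpa [envι] using h

/-- Algebra morphisms out of `U(g)`. -/
def envLift {A : Type w} [Ring A] [Algebra 𝕜 A] (f : g →ₗ[𝕜] A)
    (hf : ∀ ⦃a b : ZMod 2⦄ ⦃x y : g⦄, x ∈ L.par a → y ∈ L.par b →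
      f x * f y = koszul a b • (f y * f x) + f (L.bracket x y)) : L.Env →ₐ[𝕜] A :=
  RingQuot.liftAlgHom 𝕜 ⟨TensorAlgebra.lift 𝕜 f, by
    rintro _ _ ⟨hx, hy⟩
    simpa using hf hx hy⟩

/-- The Lie superalgebra structure on a graded subalgebra `W`. -/
def sub (W : Submodule 𝕜 g) (hp : ∀ a, ∀ x ∈ W, L.proj a x ∈ W)
    (hb : ∀ x ∈ W, ∀ y ∈ W, L.bracket x y ∈ W) : LieSuperalgebra 𝕜 W where
  toSuperSpace := L.toSuperSpace.restrict W hp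
  bracket := LinearMap.mk₂ 𝕜 (fun x y => ⟨L.bracket x y, hb x x.2 y y.2⟩)
    (fun x y z => Subtype.ext (by simp)) (fun c x y => Subtype.ext (by simp))
    (fun x y z => Subtype.ext (by simp)) (fun c x y => Subtype.ext (by simp))
  bracket_mem hx hy := L.bracket_mem (Submodule.mem_comap.mp hx) (Submodule.mem_comap.mp hy)
  skew hx hy := Subtype.ext
    (by simpa using L.skew (Submodule.mem_comap.mp hx) (Submodule.mem_comap.mp hy))
  jacobi z hx hy := Subtype.ext
    (by simpa using L.jacobi (z : g) (Submodule.mem_comap.mp hx) (Submodule.mem_comap.mp hy))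

/-- A `ℤ`-grading of a Lie superalgebra, by super subspaces. -/
structure ZGrading where
  gr : ℤ → Submodule 𝕜 g
  isInternal : DirectSum.IsInternal gr
  proj_mem : ∀ {i : ℤ} (a : ZMod 2) {x : g}, x ∈ gr i → L.proj a x ∈ gr i
  bracket_mem : ∀ {i j : ℤ} {x y : g}, x ∈ gr i → y ∈ gr j → L.bracket x y ∈ gr (i + j)

namespace ZGrading

variable {L} (G : L.ZGrading)

/-- The subspace `g_-`. -/
def minus : Submodule 𝕜 g := ⨆ i : {i : ℤ // i < 0}, G.gr i

/-- The subspace `g_+`. -/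
def plus : Submodule 𝕜 g := ⨆ i : {i : ℤ // 0 < i}, G.gr i

/-- The subspace `k = g_0 ⊕ g_+`. -/
def nonneg : Submodule 𝕜 g := ⨆ i : {i : ℤ // 0 ≤ i}, G.gr i

theorem proj_mem_iSup {κ : Type*} (d : κ → ℤ) (a : ZMod 2) :
    ∀ x ∈ (⨆ i, G.gr (d i) : Submodule 𝕜 g), L.proj a x ∈ (⨆ i, G.gr (d i)) := by
  intro x hx
  induction hx using Submodule.iSup_induction' with
  | mem i x hx => exact Submodule.mem_iSup_of_mem i (G.proj_mem a hx)
  | zero => simp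
  | add x y _ _ hx hy => rw [map_add]; exact Submodule.add_mem _ hx hy

theorem nonneg_bracket : ∀ x ∈ G.nonneg, ∀ y ∈ G.nonneg, L.bracket x y ∈ G.nonneg := by
  intro x hx y hy
  induction hx using Submodule.iSup_induction' with
  | mem i x hx =>
    induction hy using Submodule.iSup_induction' with
    | mem j y hy =>
      exact Submodule.mem_iSup_of_mem (p := fun i : {i : ℤ // 0 ≤ i} => G.gr i)
        ⟨i + j, add_nonneg i.2 j.2⟩ (G.bracket_mem hx hy)
    | zero => simp
    | add y z _ _ hy hz => rw [map_add]; exact Submodule.add_mem _ hy hz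
  | zero => simp
  | add x z _ _ hx hz => rw [map_add, LinearMap.add_apply]; exact Submodule.add_mem _ hx hz

/-- The super vector space `g_-`. -/
def minusSpace : SuperSpace 𝕜 G.minus :=
  L.toSuperSpace.restrict G.minus (fun a => G.proj_mem_iSup _ a)

/-- The Lie superalgebra `k`. -/
def nonnegAlgebra : LieSuperalgebra 𝕜 G.nonneg :=
  L.sub G.nonneg (fun a => G.proj_mem_iSup _ a) G.nonneg_bracket

/-- The decomposition of `g` as the direct sum of its graded parts. -/
def decomp : g ≃ₗ[𝕜] ⨁ i, G.gr i :=
  (LinearEquiv.ofBijective (DirectSum.coeLinearMap G.gr) G.isInternal).symm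

theorem decomp_of_mem {i : ℤ} {x : g} (hx : x ∈ G.gr i) :
    G.decomp x = DirectSum.lof 𝕜 ℤ (fun i => G.gr i) i ⟨x, hx⟩ := by
  rw [decomp, LinearEquiv.symm_apply_eq]
  exact (DirectSum.coeLinearMap_lof G.gr i ⟨x, hx⟩).symm

/-- The projection of `g` onto `g_0`. -/
def toZero : g →ₗ[𝕜] G.gr 0 :=
  DirectSum.component 𝕜 ℤ (fun i => G.gr i) 0 ∘ₗ G.decomp.toLinearMap

theorem toZero_of_mem {x : g} (hx : x ∈ G.gr 0) : G.toZero x = ⟨x, hx⟩ := by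
  simp [toZero, G.decomp_of_mem hx, DirectSum.component.lof_self]

theorem toZero_of_mem_ne {i : ℤ} {x : g} (hx : x ∈ G.gr i) (h : i ≠ 0) : G.toZero x = 0 := by
  simp [toZero, G.decomp_of_mem hx, DirectSum.component.of, h]

/-- The projection of `g = g_- ⊕ k` onto `g_-`. -/
def toMinus : g →ₗ[𝕜] G.minus :=
  DirectSum.toModule 𝕜 ℤ G.minus (fun i => if h : i < 0 then
    Submodule.inclusion (le_iSup (fun i : {i : ℤ // i < 0} => G.gr i) ⟨i, h⟩) else 0) ∘ₗ
  G.decomp.toLinearMap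

/-- The projection of `g = g_- ⊕ k` onto `k`, as a map from `g` to itself. -/
def projNonneg : Module.End 𝕜 g := LinearMap.id - G.minus.subtype ∘ₗ G.toMinus

theorem toMinus_of_mem (x : G.minus) : G.toMinus x = x := by
  obtain ⟨x, hx⟩ := x
  refine Subtype.ext ?_
  change (G.toMinus x : g) = x
  induction hx using Submodule.iSup_induction' with
  | mem i x hx =>
    simp only [toMinus, LinearMap.comp_apply, LinearEquiv.coe_coe, G.decomp_of_mem hx,
      DirectSum.toModule_lof, dif_pos i.2]
    rfl
  | zero => simp
  | add x y _ _ hx hy => simp [hx, hy]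

theorem toMinus_of_nonneg {x : g} (hx : x ∈ G.nonneg) : G.toMinus x = 0 := by
  induction hx using Submodule.iSup_induction' with
  | mem i x hx =>
    simp only [toMinus, LinearMap.comp_apply, LinearEquiv.coe_coe, G.decomp_of_mem hx,
      DirectSum.toModule_lof, dif_neg (not_lt.mpr i.2), LinearMap.zero_apply]
  | zero => simp
  | add x y _ _ hx hy => simp [hx, hy]

theorem bracket_mem_zero (x y : G.gr 0) : L.bracket x y ∈ G.gr 0 := by
  simpa using G.bracket_mem x.2 y.2

/-- A character of `g_0`: an even Lie superalgebra morphism to `𝕜`, which is purely even with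
zero bracket. -/
structure Character where
  toFun : G.gr 0 →ₗ[𝕜] 𝕜
  even : ∀ x : G.gr 0, (x : g) ∈ L.par 1 → toFun x = 0
  bracket : ∀ x y : G.gr 0, toFun ⟨L.bracket x y, G.bracket_mem_zero x y⟩ = 0

namespace Character

variable {G} (lam : G.Character)

/-- The extension of the character by zero on all `g_i` with `i ≠ 0`; only its values on
`k = g_0 ⊕ g_+` matter. -/
def ext : g →ₗ[𝕜] 𝕜 := lam.toFun ∘ₗ G.toZero

theorem ext_odd {x : g} (hx : x ∈ G.nonneg) (h1 : x ∈ L.par 1) : lam.ext x = 0 := by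
  have key : ∀ y ∈ G.nonneg, lam.ext (L.proj 1 y) = 0 := by
    intro y hy
    induction hy using Submodule.iSup_induction' with
    | mem i y hy =>
      have hm := G.proj_mem 1 hy
      by_cases h : (i : ℤ) = 0
      · rw [h] at hm
        simp only [ext, LinearMap.comp_apply, G.toZero_of_mem hm]
        exact lam.even _ (L.toSuperSpace.proj_mem 1 y)
      · simp [ext, G.toZero_of_mem_ne hm h]
    | zero => simp
    | add x y _ _ hx hy => simp [hx, hy]
  rw [← L.proj_of_mem h1]
  exact key x hx

theorem ext_bracket {x y : g} (hx : x ∈ G.nonneg) (hy : y ∈ G.nonneg) :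
    lam.ext (L.bracket x y) = 0 := by
  induction hx using Submodule.iSup_induction' with
  | mem i x hx =>
    induction hy using Submodule.iSup_induction' with
    | mem j y hy =>
      obtain ⟨i, hi⟩ := i
      obtain ⟨j, hj⟩ := j
      have hm := G.bracket_mem hx hy
      by_cases h : i + j = 0
      · obtain rfl : i = 0 := by omega
        obtain rfl : j = 0 := by omega
        simp only [ext, LinearMap.comp_apply, G.toZero_of_mem (G.bracket_mem_zero ⟨x, hx⟩ ⟨y, hy⟩)]
        exact lam.bracket ⟨x, hx⟩ ⟨y, hy⟩
      · simp [ext, G.toZero_of_mem_ne hm h]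
    | zero => simp
    | add y z _ _ hy hz => simp [hy, hz]
  | zero => simp
  | add x z _ _ hx hz => simp [hx, hz]

/-! ### The parabolic Verma module of scalar type -/

/-- The algebra morphism from `U(k)` to `𝕜` through which `U(k)` acts on the one-dimensional
module `𝕜_λ`. -/
def envChar : G.nonnegAlgebra.Env →ₐ[𝕜] 𝕜 :=
  G.nonnegAlgebra.envLift (lam.ext ∘ₗ G.nonneg.subtype) (by
    intro a b x y hx hy
    have hb : lam.ext (L.bracket x y) = 0 := lam.ext_bracket x.2 y.2
    change lam.ext x * lam.ext y = koszul a b • (lam.ext y * lam.ext x) + lam.ext (L.bracket x y)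
    rw [hb, add_zero]
    by_cases h : a = 1 ∧ b = 1
    · obtain ⟨rfl, rfl⟩ := h
      have : lam.ext (x : g) = 0 := lam.ext_odd x.2 hx
      simp [this]
    · simp [koszul, h, mul_comm])

variable (G) in
/-- The algebra morphism from `U(k)` to `U(g)` induced by the inclusion. -/
def envIncl : G.nonnegAlgebra.Env →ₐ[𝕜] L.Env :=
  G.nonnegAlgebra.envLift (L.envι ∘ₗ G.nonneg.subtype) (fun _ _ _ _ hx hy =>
    L.envι_mul_envι (Submodule.mem_comap.mp hx) (Submodule.mem_comap.mp hy))

/-- The `U(g)`-submodule of `U(g) ⊗ 𝕜` spanned by the elements `u z ⊗ c - u ⊗ z c` with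
`z` in `U(k)`. -/
def balanced : Submodule L.Env (L.Env ⊗[𝕜] 𝕜) :=
  Submodule.span L.Env {t | ∃ (u : L.Env) (z : G.nonnegAlgebra.Env) (c : 𝕜),
    t = (u * envIncl G z) ⊗ₜ[𝕜] c - u ⊗ₜ[𝕜] (lam.envChar z * c)}

/-- The parabolic Verma module of scalar type `U(g) ⊗_{U(k)} 𝕜_λ`. -/
abbrev Verma : Type (max u v) := (L.Env ⊗[𝕜] 𝕜) ⧸ lam.balanced

/-- The linear map `Y ↦ σ(Y) ⊗ 1` from `S(g_-)` to the parabolic Verma module. -/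
def vermaMap : G.minusSpace.Sym →ₗ[𝕜] lam.Verma :=
  (lam.balanced.mkQ.restrictScalars 𝕜) ∘ₗ (TensorProduct.mk 𝕜 L.Env 𝕜).flip 1 ∘ₗ
    G.minusSpace.symmetrise (L.envι ∘ₗ G.minus.subtype)

/-- The action of `Z` in `g` on `S(g_-)` obtained from its action on the parabolic Verma module by
transport along the linear isomorphism `Y ↦ σ(Y) ⊗ 1`. -/
def realisation (h : Function.Bijective lam.vermaMap) (Z : g) :
    Module.End 𝕜 G.minusSpace.Sym :=
  (LinearEquiv.ofBijective lam.vermaMap h).symm.toLinearMap ∘ₗ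
    Algebra.lsmul 𝕜 𝕜 lam.Verma (L.envι Z) ∘ₗ lam.vermaMap

end Character

/-! ### The differential operators -/

variable {r s : ℕ} (X : Module.Basis (Fin (r + s)) 𝕜 G.minus)

/-- Multiplication by an element of `g_-` on `S(g_-)`. -/
def mulOp : G.minus →ₗ[𝕜] Module.End 𝕜 G.minusSpace.Sym :=
  LinearMap.mul 𝕜 G.minusSpace.Sym ∘ₗ G.minusSpace.ι

/-- The partial derivative `∂^i` on `S(g_-)`. -/
def partialDeriv (i : Fin (r + s)) : Module.End 𝕜 G.minusSpace.Sym :=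
  G.minusSpace.superDeriv (indexParity i) (X.coord i)

theorem partialDeriv_basis (h0 : ∀ i : Fin (r + s), (i : ℕ) < r → (X i : g) ∈ L.par 0)
    (h1 : ∀ i : Fin (r + s), r ≤ (i : ℕ) → (X i : g) ∈ L.par 1) (i j : Fin (r + s)) :
    G.partialDeriv X i (G.minusSpace.ι (X j)) = if i = j then 1 else 0 := by
  have hX : ∀ k, X k ∈ G.minusSpace.par (indexParity k) := by
    intro k
    by_cases h : (k : ℕ) < r
    · rw [indexParity, if_pos h]; exact h0 k h
    · rw [indexParity, if_neg h]; exact h1 k (not_lt.mp h)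
  rw [partialDeriv, SuperSpace.superDeriv_ι]
  by_cases h : i = j
  · subst h; simp [SuperSpace.proj_of_mem _ (hX i)]
  · by_cases hp : indexParity i = indexParity j
    · rw [hp, SuperSpace.proj_of_mem _ (hX j)]
      simp [h]
    · rw [SuperSpace.proj_of_mem_ne _ (hX j) hp]; simp [h]

/-- `∂^K = (∂^1)^{k_1} ⋯ (∂^{r+s})^{k_{r+s}}`. -/
def partialPow (K : MultiIndex r s) : Module.End 𝕜 G.minusSpace.Sym :=
  (List.ofFn fun i => G.partialDeriv X i ^ K.1 i).prod

/-- The operator on `g` that sends `Y` to `[Y, Z]`, for `Z` in `g_-`. -/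
def adTilde : G.minus →ₗ[𝕜] Module.End 𝕜 g := L.bracket.flip ∘ₗ G.minus.subtype

/-- The operator `s^K` on `g`: the symmetrisation of the product in which the operator
`adTilde X_i` occurs `k_i` times, in the order of the basis. -/
def sOp (K : MultiIndex r s) : Module.End 𝕜 g :=
  G.minusSpace.symmetrise G.adTilde (List.ofFn fun i => G.minusSpace.ι (X i) ^ K.1 i).prod

/-- The element `W_{i,K_1,…,K_j}(Z) + H_{i,K_1,…,K_j}(Z)` of `g`; the list is
`[K_j, …, K_1]`. -/
def whTerm (Z : g) (i : Fin (r + s)) : List (MultiIndex r s) → g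
  | [] => L.bracket Z (X i)
  | K :: Ks => coeffC 𝕜 K • G.sOp X K (G.projNonneg (whTerm Z i Ks))

/-- `W_{i,K_1,…,K_j}(Z)`, the component in `g_-`. -/
def wTerm (Z : g) (i : Fin (r + s)) (Ks : List (MultiIndex r s)) : G.minus :=
  G.toMinus (G.whTerm X Z i Ks)

/-- `H_{i,K_1,…,K_j}(Z)`, the component in `k`. -/
def hTerm (Z : g) (i : Fin (r + s)) (Ks : List (MultiIndex r s)) : g :=
  G.projNonneg (G.whTerm X Z i Ks)

/-- `∂^{K_j} ⋯ ∂^{K_1} ∂^i`, for the list `[K_j, …, K_1]`. -/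
def partialList (i : Fin (r + s)) (Ks : List (MultiIndex r s)) :
    Module.End 𝕜 G.minusSpace.Sym :=
  (Ks.map (G.partialPow X)).prod * G.partialDeriv X i

end ZGrading

end LieSuperalgebra

end

/-! Write Φ(z) = σ(z) ⊗ 1 and let D = ∑ ad~X_i ⊗ ∂^i act on g ⊗ S(g_-) (`shift`). D lowers a finite
filtration of g, so it is nilpotent and power series in D make sense. Consider the symmetrised
product of x in g with z in S(g_-), that is, the average over all positions of x among the factors
of z. Moving x to the front of each term in U(g) shows that this product is the map x ⊗ z ↦ x σ(z)
applied to ((1 - e^{-D})/D)(x ⊗ z); moving x to the back instead corresponds to e^{-D}. Let Q be the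
symmetrised product, transported to S(g_-). Then the action has to be Q ∘ D/(1 - e^{-D}). On g_- ⊗
S(g_-) the map Q is the product of S(g_-). On k ⊗ S(g_-) a factor at the back acts on the generator
by λ, so Q ∘ D/(e^D - 1) = λ. These two conditions determine Q (`symAct`), because D/(e^D - 1) is
the identity plus a nilpotent operator.

This candidate (`act`) is taken as a definition, and the Poincaré–Birkhoff–Witt theorem is not used.
Two identities carry the proof that it is a representation. One is Euler's, ∑ X_i · ∂^i z = n z for
z of degree n (`sum_act_pd`). The other is the averaging identity ∑ ± X_i · (x · ∂^i z) = n x · z -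
(action map)(D(x ⊗ z)) (`average_act`), proved by induction on n from the series identity
`sum_symSeries`. It says that the curvature F(x, X_i), summed against ∂^i z, vanishes. With the
Bianchi identity, and in an induction on the degree, it gives n F(x, y) z = -c F(x, y) z, where c is
the number of arguments in g_-. So F vanishes except possibly for both arguments in k and n = 0, and
there λ being a character suffices (`curv_symDeg`).

Hence U(g) acts on S(g_-) and k acts on 1 through λ. Evaluation at 1 factors through the Verma
module and is a left inverse of Φ, so Φ is injective. In the Verma module the averaging identity is
just a commutator relation; the same inductions show that the symmetrised product satisfies the
conditions defining Q, so Φ is equivariant (`vermaAct_vermaMap`). Its range is then a submodule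
containing the generator, and Φ is bijective.

The explicit formulas come from D^n = n! ∑ s^K ⊗ ∂^K / K! over |K| = n (`shift_pow_eq`). On g_- one
expands D/(1 - e^{-D}). On k one uses D/(1 - e^{-D}) = D/(e^D - 1) + D, so that x acts by λ(x) + Q
D. For g_0, D lands in g_- at once. For g_+, the equation Q ∘ D/(e^D - 1) = λ is solved for Q and
iterated on the components in k, which creates the W and H. -/

noncomputable section

universe u v w

/-! ### Parity signs and supercommuting derivations of S(V) -/

namespace SuperSpace

variable {𝕜 : Type u} {V : Type v} [Field 𝕜] [AddCommGroup V] [Module 𝕜 V]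
variable (P : SuperSpace 𝕜 V)

/-- The linear automorphism of `V` that is `(-1)^(a b)` on the part of parity `b`. -/
def sgn (a : ZMod 2) : V →ₗ[𝕜] V := P.proj 0 + koszul a 1 • P.proj 1

theorem sgn_of_mem (a : ZMod 2) {b : ZMod 2} {x : V} (hx : x ∈ P.par b) :
    P.sgn a x = koszul a b • x := by
  rcases zmod_two_cases b with rfl | rfl
  · simp [sgn, P.proj_of_mem hx, P.proj_of_mem_ne hx (b := 1) (by decide), koszul_zero_right]
  · simp [sgn, P.proj_of_mem hx, P.proj_of_mem_ne hx (b := 0) (by decide)]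

theorem linearMap_ext_par {M : Type*} [AddCommGroup M] [Module 𝕜 M] {f g : V →ₗ[𝕜] M}
    (h : ∀ b, ∀ x ∈ P.par b, f x = g x) : f = g := by
  ext x
  rw [← P.proj_zero_add_proj_one x, map_add, map_add, h 0 _ (P.proj_mem 0 x),
    h 1 _ (P.proj_mem 1 x)]

theorem ι_sgn (a : ZMod 2) (x : V) : P.ι (P.sgn a x) = P.twist a (P.ι x) := by
  have : P.ι ∘ₗ P.sgn a = (P.twist a).toLinearMap ∘ₗ P.ι := by
    refine P.linearMap_ext_par fun b x hx => ?_
    simp [P.sgn_of_mem a hx, P.twist_ι a hx]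
  exact LinearMap.congr_fun this x

theorem superDeriv_algebraMap (a : ZMod 2) (ξ : V →ₗ[𝕜] 𝕜) (r : 𝕜) :
    P.superDeriv a ξ (algebraMap 𝕜 P.Sym r) = 0 := by
  simp [superDeriv, Matrix.algebraMap_matrix_apply]

theorem superDeriv_one (a : ZMod 2) (ξ : V →ₗ[𝕜] 𝕜) : P.superDeriv a ξ 1 = 0 := by
  simpa using P.superDeriv_algebraMap a ξ 1

theorem superDeriv_ι_mul {a b : ZMod 2} (ξ : V →ₗ[𝕜] 𝕜) {x : V} (hx : x ∈ P.par b)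
    (z : P.Sym) : P.superDeriv a ξ (P.ι x * z) =
      ξ (P.proj a x) • z + koszul a b • (P.ι x * P.superDeriv a ξ z) := by
  rw [superDeriv_mul, superDeriv_ι, P.twist_ι a hx, smul_mul_assoc, Algebra.smul_def (ξ _) z]

/-- Linear maps on `S(V)` are equal if they agree at one and if agreement at `z` passes to
`x z` for homogeneous `x` in `V`. -/
theorem sym_hom_induction {p : P.Sym → Prop} (h1 : p 1) (hadd : ∀ x y, p x → p y → p (x + y))
    (hsmul : ∀ (c : 𝕜) x, p x → p (c • x))
    (hmul : ∀ b, ∀ x ∈ P.par b, ∀ z, p z → p (P.ι x * z)) (z : P.Sym) : p z := by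
  -- Only left multiplication by vectors preserves `p`, so the claim is strengthened to left
  -- multiplication by `z`, which is compatible with products.
  suffices H : ∀ y, p y → p (z * y) by simpa using H 1 h1
  induction z using P.sym_induction with
  | h1 r => intro y hy; rw [← Algebra.smul_def]; exact hsmul r y hy
  | hι x =>
    intro y hy
    rw [← P.proj_zero_add_proj_one x, map_add, add_mul]
    exact hadd _ _ (hmul 0 _ (P.proj_mem 0 x) y hy) (hmul 1 _ (P.proj_mem 1 x) y hy)
  | hadd x y hx hy => intro z hz; rw [add_mul]; exact hadd _ _ (hx z hz) (hy z hz)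
  | hmul x y hx hy => intro z hz; rw [mul_assoc]; exact hx _ (hy z hz)

/-- Super derivations of `S(V)` that are constant on `V` supercommute. -/
theorem superDeriv_comm (a b : ZMod 2) (ξ η : V →ₗ[𝕜] 𝕜) (z : P.Sym) :
    P.superDeriv a ξ (P.superDeriv b η z) =
      koszul a b • P.superDeriv b η (P.superDeriv a ξ z) := by
  induction z using P.sym_hom_induction with
  | h1 => simp [superDeriv_one]
  | hadd x y hx hy => simp only [map_add, hx, hy, smul_add]
  | hsmul c x hx => simp only [map_smul, hx]; rw [smul_comm]
  | hmul c x hx z hz =>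
    simp only [P.superDeriv_ι_mul _ hx, map_add, map_smul, map_zsmul, hz, smul_add,
      mul_smul_comm, smul_smul]
    -- The coordinate of `x` vanishes unless `x` has the parity of the derivation; in that case the
    -- two Koszul signs agree.
    have h1 : η (P.proj b x) • P.superDeriv a ξ z =
        (koszul a b * koszul a c) • η (P.proj b x) • P.superDeriv a ξ z := by
      by_cases h : b = c
      · rw [h, koszul_mul_self, one_smul]
      · rw [P.proj_of_mem_ne hx h]; simp
    have h2 : koszul b c • ξ (P.proj a x) • P.superDeriv b η z =
        koszul a b • ξ (P.proj a x) • P.superDeriv b η z := by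
      by_cases h : a = c
      · rw [h, koszul_comm]
      · rw [P.proj_of_mem_ne hx h]; simp
    rw [h2, ← h1, show koszul a b * (koszul a c * koszul b c) =
      koszul b c * (koszul a c * koszul a b) by ring]
    simp only [mul_comm, mul_left_comm]
    abel

end SuperSpace

/-! ### The grading of S(V) by degree -/

namespace SuperSpace

variable {𝕜 : Type u} {V : Type v} [Field 𝕜] [AddCommGroup V] [Module 𝕜 V]
variable (P : SuperSpace 𝕜 V)

/-- The part of degree `n` of `S(V)`. -/
def symDeg (n : ℕ) : Submodule 𝕜 P.Sym := LinearMap.range P.ι ^ n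

theorem one_mem_symDeg : (1 : P.Sym) ∈ P.symDeg 0 := by
  rw [symDeg, pow_zero]; exact Submodule.one_le.mp le_rfl

theorem ι_mul_mem_symDeg {n : ℕ} (x : V) {z : P.Sym} (hz : z ∈ P.symDeg n) :
    P.ι x * z ∈ P.symDeg (n + 1) := by
  rw [symDeg, pow_succ']
  exact Submodule.mul_mem_mul ⟨x, rfl⟩ hz

theorem mul_mem_symDeg {m n : ℕ} {y z : P.Sym} (hy : y ∈ P.symDeg m) (hz : z ∈ P.symDeg n) :
    y * z ∈ P.symDeg (m + n) := by
  rw [symDeg, pow_add]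
  exact Submodule.mul_mem_mul hy hz

theorem mem_symDeg_zero {z : P.Sym} (hz : z ∈ P.symDeg 0) : ∃ c : 𝕜, z = c • (1 : P.Sym) := by
  rw [symDeg, pow_zero, Submodule.mem_one] at hz
  obtain ⟨c, rfl⟩ := hz
  exact ⟨c, Algebra.algebraMap_eq_smul_one c⟩

theorem symDeg_succ_induction {n : ℕ} {p : P.Sym → Prop}
    (hadd : ∀ x y, p x → p y → p (x + y))
    (hmul : ∀ b, ∀ x ∈ P.par b, ∀ z ∈ P.symDeg n, p (P.ι x * z))
    (z : P.Sym) (hz : z ∈ P.symDeg (n + 1)) : p z := by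
  rw [symDeg, pow_succ'] at hz
  induction hz using Submodule.mul_induction_on' with
  | mem_mul_mem x hx z hz =>
    obtain ⟨x, rfl⟩ := hx
    rw [← P.proj_zero_add_proj_one x, map_add, add_mul]
    exact hadd _ _ (hmul 0 _ (P.proj_mem 0 x) z hz) (hmul 1 _ (P.proj_mem 1 x) z hz)
  | add x _ y _ hx hy => exact hadd x y hx hy

theorem iSup_symDeg : ⨆ n, P.symDeg n = ⊤ := by
  rw [Submodule.eq_top_iff']
  intro z
  induction z using P.sym_hom_induction with
  | h1 => exact Submodule.mem_iSup_of_mem 0 P.one_mem_symDeg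
  | hadd x y hx hy => exact Submodule.add_mem _ hx hy
  | hsmul c x hx => exact Submodule.smul_mem _ c hx
  | hmul b x hx z hz =>
    induction hz using Submodule.iSup_induction' with
    | mem n z hz => exact Submodule.mem_iSup_of_mem (n + 1) (P.ι_mul_mem_symDeg x hz)
    | zero => simp
    | add y z _ _ hy hz => rw [mul_add]; exact Submodule.add_mem _ hy hz

theorem sym_linearMap_ext {M : Type*} [AddCommGroup M] [Module 𝕜 M] {f g : P.Sym →ₗ[𝕜] M}
    (h : ∀ n, ∀ z ∈ P.symDeg n, f z = g z) : f = g := by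
  ext z
  have hz : z ∈ ⨆ n, P.symDeg n := by rw [iSup_symDeg]; trivial
  induction hz using Submodule.iSup_induction' with
  | mem n z hz => exact h n z hz
  | zero => simp
  | add y z _ _ hy hz => rw [map_add, map_add, hy, hz]

theorem superDeriv_symDeg_zero (a : ZMod 2) (ξ : V →ₗ[𝕜] 𝕜) {z : P.Sym}
    (hz : z ∈ P.symDeg 0) : P.superDeriv a ξ z = 0 := by
  obtain ⟨c, rfl⟩ := P.mem_symDeg_zero hz
  rw [map_smul, superDeriv_one, smul_zero]

theorem superDeriv_mem_symDeg (a : ZMod 2) (ξ : V →ₗ[𝕜] 𝕜) {n : ℕ} {z : P.Sym}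
    (hz : z ∈ P.symDeg (n + 1)) : P.superDeriv a ξ z ∈ P.symDeg n := by
  induction n generalizing z with
  | zero =>
    refine P.symDeg_succ_induction (p := fun z => P.superDeriv a ξ z ∈ P.symDeg 0) (fun x y hx hy => ?_)
      (fun b x hx z hz => ?_) z hz
    · rw [map_add]; exact Submodule.add_mem _ hx hy
    · rw [P.superDeriv_ι_mul ξ hx, P.superDeriv_symDeg_zero a ξ hz, mul_zero, smul_zero, add_zero]
      exact Submodule.smul_mem _ _ hz
  | succ n ih =>
    refine P.symDeg_succ_induction (p := fun z => P.superDeriv a ξ z ∈ P.symDeg (n + 1)) (fun x y hx hy => ?_)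
      (fun b x hx z hz => ?_) z hz
    · rw [map_add]; exact Submodule.add_mem _ hx hy
    · rw [P.superDeriv_ι_mul ξ hx]
      exact Submodule.add_mem _ (Submodule.smul_mem _ _ hz)
        (zsmul_mem (P.ι_mul_mem_symDeg x (ih hz)) _)

/-! ### Homogeneous bases -/

variable {I : Type*} (X : Module.Basis I 𝕜 V) (d : I → ZMod 2)

/-- The partial derivatives of `S(V)` with respect to a basis of homogeneous vectors. -/
def pd (i : I) : Module.End 𝕜 P.Sym := P.superDeriv (d i) (X.coord i)

theorem pd_mul (i : I) (y z : P.Sym) :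
    P.pd X d i (y * z) = P.pd X d i y * z + P.twist (d i) y * P.pd X d i z :=
  P.superDeriv_mul _ _ y z

theorem pd_ι_mul (i : I) {b : ZMod 2} {x : V} (hx : x ∈ P.par b) (z : P.Sym) :
    P.pd X d i (P.ι x * z) =
      X.coord i (P.proj (d i) x) • z + koszul (d i) b • (P.ι x * P.pd X d i z) :=
  P.superDeriv_ι_mul _ hx z

theorem pd_one (i : I) : P.pd X d i 1 = 0 := P.superDeriv_one _ _

theorem pd_pd (i j : I) (z : P.Sym) :
    P.pd X d i (P.pd X d j z) = koszul (d i) (d j) • P.pd X d j (P.pd X d i z) :=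
  P.superDeriv_comm _ _ _ _ z

theorem pd_symDeg_zero (i : I) {z : P.Sym} (hz : z ∈ P.symDeg 0) : P.pd X d i z = 0 :=
  P.superDeriv_symDeg_zero _ _ hz

theorem pd_mem_symDeg (i : I) {n : ℕ} {z : P.Sym} (hz : z ∈ P.symDeg (n + 1)) :
    P.pd X d i z ∈ P.symDeg n := P.superDeriv_mem_symDeg _ _ hz

/-- For a homogeneous basis the coordinate form of `X i` already vanishes on the other parity, so
the projection built into `superDeriv` can be dropped. -/
theorem coord_proj (hX : ∀ i, X i ∈ P.par (d i)) (i : I) (x : V) : X.coord i (P.proj (d i) x) = X.coord i x := by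
  classical
  have : X.coord i ∘ₗ P.proj (d i) = X.coord i := by
    refine X.ext fun j => ?_
    by_cases h : d i = d j
    · rw [LinearMap.comp_apply, h, P.proj_of_mem (hX j)]
    · have hij : j ≠ i := fun e => h (by rw [e])
      rw [LinearMap.comp_apply, P.proj_of_mem_ne (hX j) h]
      simp [hij]
  exact LinearMap.congr_fun this x

/-- With the sign absorbed into `sgn`, the Leibniz rule needs no homogeneity of `x`. -/
theorem pd_ι_mul' (hX : ∀ i, X i ∈ P.par (d i)) (i : I) (x : V) (z : P.Sym) :
    P.pd X d i (P.ι x * z) = X.coord i x • z + P.ι (P.sgn (d i) x) * P.pd X d i z := by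
  rw [pd_mul, ← P.ι_sgn]
  congr 1
  rw [pd, superDeriv_ι, P.coord_proj X d hX, Algebra.smul_def]

theorem pd_basis_mul [DecidableEq I] (hX : ∀ i, X i ∈ P.par (d i)) (i j : I) (z : P.Sym) :
    P.pd X d i (P.ι (X j) * z) = (if i = j then (1 : 𝕜) else 0) • z +
      koszul (d i) (d j) • (P.ι (X j) * P.pd X d i z) := by
  rw [P.pd_ι_mul X d i (hX j), P.coord_proj X d hX]
  congr 2
  simp [Finsupp.single_apply, eq_comm]

/-- Euler's identity. -/
theorem sum_ι_mul_pd [Fintype I] (hX : ∀ i, X i ∈ P.par (d i)) {n : ℕ} {z : P.Sym} (hz : z ∈ P.symDeg n) :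
    ∑ i, P.ι (X i) * P.pd X d i z = (n : 𝕜) • z := by
  induction n generalizing z with
  | zero => simp [P.pd_symDeg_zero X d _ hz]
  | succ n ih =>
    refine P.symDeg_succ_induction (p := fun z => ∑ i, P.ι (X i) * P.pd X d i z = ((n + 1 : ℕ) : 𝕜) • z) (fun x y hx hy => ?_)
      (fun b x hx z hz => ?_) z hz
    · simp only [map_add, mul_add, Finset.sum_add_distrib, hx, hy, smul_add]
    -- The Leibniz sign cancels against the sign of moving `X i` past `x`, so Euler's identity has
    -- no signs.
    · have h : ∀ i, P.ι (X i) * P.pd X d i (P.ι x * z) =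
          P.ι (X.coord i x • X i) * z + P.ι x * (P.ι (X i) * P.pd X d i z) := by
        intro i
        rw [P.pd_ι_mul X d i hx, P.coord_proj X d hX, mul_add, mul_smul_comm, map_smul,
          smul_mul_assoc, mul_smul_comm, ← mul_assoc (P.ι x), P.ι_mul_ι hx (hX i),
          smul_mul_assoc, koszul_comm b, mul_assoc]
      simp only [h, Finset.sum_add_distrib, ← Finset.sum_mul, ← map_sum, ← Finset.mul_sum, ih hz]
      have : ∑ i, X.coord i x • X i = x := by simp [X.sum_repr x]
      rw [this, Nat.cast_succ, add_smul, one_smul, mul_smul_comm, add_comm]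

/-- The sign of moving the `i`-th of a family of elements of parities `ε` to the front. -/
def frontSign {n : ℕ} (ε : Fin (n + 1) → ZMod 2) (i : Fin (n + 1)) : ℤ :=
  ∏ j : Fin n, if i.succAbove j < i then koszul (ε (i.succAbove j)) (ε i) else 1

theorem frontSign_zero {n : ℕ} (ε : Fin (n + 1) → ZMod 2) : frontSign ε 0 = 1 := by
  simp [frontSign]

theorem frontSign_succ {n : ℕ} (ε : Fin (n + 2) → ZMod 2) (i : Fin (n + 1)) :
    frontSign ε i.succ = koszul (ε 0) (ε i.succ) * frontSign (fun j => ε j.succ) i := by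
  simp [frontSign, Fin.prod_univ_succ]

/-- The total derivative of a product of elements of `V`. -/
theorem sum_pd_prod [Fintype I] (hX : ∀ i, X i ∈ P.par (d i))
    {M : Type*} [AddCommGroup M] [Module 𝕜 M]
    {n : ℕ} (F : V →ₗ[𝕜] P.Sym →ₗ[𝕜] M) (x : Fin (n + 1) → V) (ε : Fin (n + 1) → ZMod 2)
    (hx : ∀ i, x i ∈ P.par (ε i)) :
    ∑ a, F (X a) (P.pd X d a (List.ofFn fun i => P.ι (x i)).prod) =
      ∑ i, frontSign ε i • F (x i) (List.ofFn fun j => P.ι (x (i.succAbove j))).prod := by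
  have hsum : ∀ y, ∑ i, X.coord i y • X i = y := fun y => by simp [X.sum_repr y]
  -- One factor is split off. The sign of moving the derivative past `y` is put into `F` through
  -- `sgn`, so the remaining sum again has the shape of the claim.
  have hstep : ∀ (F : V →ₗ[𝕜] P.Sym →ₗ[𝕜] M) (y : V) (b : ZMod 2) (hy : y ∈ P.par b) (z : P.Sym),
      ∑ a, F (X a) (P.pd X d a (P.ι y * z)) = F y z +
        ∑ a, (F ∘ₗ P.sgn b) (X a) (P.ι y * P.pd X d a z) := by
    intro F y b hy z
    conv_rhs => rw [← hsum y, map_sum, LinearMap.sum_apply, ← Finset.sum_add_distrib, hsum y]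
    refine Finset.sum_congr rfl fun a _ => ?_
    rw [P.pd_ι_mul X d a hy, P.coord_proj X d hX, LinearMap.comp_apply, P.sgn_of_mem b (hX a)]
    simp only [map_add, map_smul, LinearMap.smul_apply, map_zsmul,
      koszul_comm b]
  induction n generalizing F with
  | zero =>
    rw [List.ofFn_succ, List.prod_cons, hstep _ _ _ (hx 0)]
    simp [pd_one, frontSign]
  | succ n ih =>
    rw [List.ofFn_succ, List.prod_cons, hstep _ _ _ (hx 0), Fin.sum_univ_succ, frontSign_zero,
      one_smul]
    congr 1
    -- The induction hypothesis is used for a new `F`, which contains left multiplication by `x 0`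
    -- and the sign of passing it.
    have := ih ((LinearMap.mulLeft 𝕜 (P.ι (x 0))).lcomp 𝕜 M ∘ₗ F ∘ₗ P.sgn (ε 0))
      (fun i => x i.succ) (fun i => ε i.succ) (fun i => hx i.succ)
    simp only [LinearMap.comp_apply, LinearMap.lcomp_apply, LinearMap.mulLeft_apply] at this ⊢
    rw [this]
    refine Finset.sum_congr rfl fun i _ => ?_
    rw [P.sgn_of_mem _ (hx i.succ), frontSign_succ, List.ofFn_succ, List.prod_cons, mul_comm,
      mul_smul]
    simp

/-! ### The recursion for symmetrisation -/

/-- The permutation that sends `0` to `i` and is given by `τ` on the remaining elements, in their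
order. -/
def consPerm {n : ℕ} (i : Fin (n + 1)) (τ : Equiv.Perm (Fin n)) : Equiv.Perm (Fin (n + 1)) :=
  i.cycleRange.symm * Equiv.Perm.decomposeFin.symm (0, τ)

theorem consPerm_zero {n : ℕ} (i : Fin (n + 1)) (τ : Equiv.Perm (Fin n)) :
    consPerm i τ 0 = i := by
  simp [consPerm]

theorem consPerm_succ {n : ℕ} (i : Fin (n + 1)) (τ : Equiv.Perm (Fin n)) (k : Fin n) :
    consPerm i τ k.succ = i.succAbove (τ k) := by
  simp [consPerm]

theorem consPerm_symm_self {n : ℕ} (i : Fin (n + 1)) (τ : Equiv.Perm (Fin n)) :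
    (consPerm i τ).symm i = 0 := by
  rw [Equiv.symm_apply_eq, consPerm_zero]

theorem consPerm_symm_succAbove {n : ℕ} (i : Fin (n + 1)) (τ : Equiv.Perm (Fin n)) (k : Fin n) :
    (consPerm i τ).symm (i.succAbove k) = (τ.symm k).succ := by
  rw [Equiv.symm_apply_eq, consPerm_succ, Equiv.apply_symm_apply]

/-- The image of 0 recovers `i`, the other values recover `τ`, and (n + 1) · n! = (n + 1)!. -/
theorem consPerm_bijective {n : ℕ} :
    Function.Bijective fun p : Fin (n + 1) × Equiv.Perm (Fin n) => consPerm p.1 p.2 := by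
  rw [Fintype.bijective_iff_injective_and_card]
  constructor
  · rintro ⟨i, τ⟩ ⟨j, ρ⟩ h
    simp only at h
    have hij : i = j := by rw [← consPerm_zero i τ, h, consPerm_zero]
    subst hij
    have : τ = ρ := by
      ext k
      have := congrArg (fun e : Equiv.Perm (Fin (n + 1)) => e k.succ) h
      simp only [consPerm_succ] at this
      exact congrArg Fin.val (Fin.succAbove_right_injective this)
    rw [this]
  · simp [Fintype.card_perm, Nat.factorial_succ]

/-- A pair containing `i` is reversed exactly when its other member originally precedes `i`; the
order of all other pairs is decided by `τ`. -/
theorem koszulSign_consPerm {n : ℕ} (ε : Fin (n + 1) → ZMod 2) (i : Fin (n + 1))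
    (τ : Equiv.Perm (Fin n)) : koszulSign ε (consPerm i τ) =
      frontSign ε i * koszulSign (fun j => ε (i.succAbove j)) τ := by
  simp only [koszulSign, Fintype.prod_prod_type, frontSign]
  rw [Fin.prod_univ_succAbove _ i, Fin.prod_univ_succAbove _ i]
  simp only [lt_irrefl, if_false, consPerm_symm_self, Fin.not_lt_zero, and_false,
    Finset.prod_const_one, mul_one, one_mul]
  rw [← Finset.prod_mul_distrib]
  refine Finset.prod_congr rfl fun j _ => ?_
  rw [Fin.prod_univ_succAbove _ i]
  simp [consPerm_symm_self, consPerm_symm_succAbove, Fin.succAbove_lt_succAbove_iff]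

variable {A : Type w} [Ring A] [Algebra 𝕜 A]

theorem symmetrise_one (f : V →ₗ[𝕜] A) : P.symmetrise f 1 = 1 := by
  have := P.symmetrise_apply f (n := 0) Fin.elim0 Fin.elim0 (fun i => i.elim0)
  simpa [koszulSign] using this

/-- The permutations are sorted by the factor that comes first. What remains is the symmetrisation
of the other factors, and (n + 1)! = (n + 1) · n! explains the coefficient. -/
theorem symmetrise_prod_succ [CharZero 𝕜] (f : V →ₗ[𝕜] A) {n : ℕ} (x : Fin (n + 1) → V)
    (ε : Fin (n + 1) → ZMod 2) (hx : ∀ i, x i ∈ P.par (ε i)) :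
    ((n + 1 : ℕ) : 𝕜) • P.symmetrise f (List.ofFn fun i => P.ι (x i)).prod =
      ∑ i, frontSign ε i •
        (f (x i) * P.symmetrise f (List.ofFn fun j => P.ι (x (i.succAbove j))).prod) := by
  have h1 := P.symmetrise_apply f x ε hx
  have h2 := fun i : Fin (n + 1) => P.symmetrise_apply f (fun j => x (i.succAbove j))
    (fun j => ε (i.succAbove j)) (fun j => hx _)
  have hn : ((n + 1 : ℕ) : 𝕜) ≠ 0 := Nat.cast_ne_zero.mpr n.succ_ne_zero
  simp only [h1, h2]
  rw [Nat.factorial_succ, Nat.cast_mul, mul_inv, smul_smul, ← mul_assoc, mul_inv_cancel₀ hn,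
    one_mul]
  simp only [mul_smul_comm]
  simp only [smul_comm _ ((n.factorial : 𝕜)⁻¹), ← Finset.smul_sum]
  congr 1
  rw [← (Equiv.ofBijective _ consPerm_bijective).sum_comp, Fintype.sum_prod_type]
  refine Finset.sum_congr rfl fun i _ => ?_
  rw [Finset.mul_sum, Finset.smul_sum]
  refine Finset.sum_congr rfl fun τ _ => ?_
  simp only [Equiv.ofBijective_apply, koszulSign_consPerm, List.ofFn_succ, List.prod_cons,
    consPerm_zero, consPerm_succ, mul_smul, mul_smul_comm]

/-- Reduces linear identities in degree `n` to products of homogeneous vectors, the only elements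
for which signs are explicit. -/
theorem symDeg_le_span (n : ℕ) : P.symDeg n ≤ Submodule.span 𝕜
    {z | ∃ (x : Fin n → V) (ε : Fin n → ZMod 2), (∀ i, x i ∈ P.par (ε i)) ∧
      z = (List.ofFn fun i => P.ι (x i)).prod} := by
  induction n with
  | zero =>
    intro z hz
    obtain ⟨c, rfl⟩ := P.mem_symDeg_zero hz
    exact Submodule.smul_mem _ _ (Submodule.subset_span
      ⟨Fin.elim0, Fin.elim0, fun i => i.elim0, by simp⟩)
  | succ n ih =>
    intro z hz
    refine P.symDeg_succ_induction (p := fun z => z ∈ Submodule.span 𝕜 _)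
      (fun x y hx hy => Submodule.add_mem _ hx hy) (fun b x hx z hz => ?_) z hz
    refine Submodule.span_induction (p := fun z _ => P.ι x * z ∈ Submodule.span 𝕜 _) ?_ ?_ ?_ ?_
      (ih hz)
    · rintro _ ⟨y, ε, hy, rfl⟩
      refine Submodule.subset_span ⟨Fin.cons x y, Fin.cons b ε, fun i => ?_, ?_⟩
      · refine Fin.cases ?_ (fun i => ?_) i
        · simpa using hx
        · simpa using hy i
      · simp [List.ofFn_succ]
    · rw [mul_zero]; exact Submodule.zero_mem _
    · intro y z _ _ hy hz; rw [mul_add]; exact Submodule.add_mem _ hy hz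
    · intro c y _ hy; rw [mul_smul_comm]; exact Submodule.smul_mem _ _ hy

/-- The Euler type recursion for the symmetrisation map. -/
theorem sum_mul_symmetrise_pd [CharZero 𝕜] [Fintype I] (hX : ∀ i, X i ∈ P.par (d i))
    (f : V →ₗ[𝕜] A) {n : ℕ} {z : P.Sym} (hz : z ∈ P.symDeg n) :
    ∑ i, f (X i) * P.symmetrise f (P.pd X d i z) = (n : 𝕜) • P.symmetrise f z := by
  cases n with
  | zero => simp [P.pd_symDeg_zero X d _ hz]
  | succ n =>
    refine Submodule.span_induction (p := fun z _ => ∑ i, f (X i) *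
      P.symmetrise f (P.pd X d i z) = ((n + 1 : ℕ) : 𝕜) • P.symmetrise f z) ?_ ?_ ?_ ?_
      (P.symDeg_le_span _ hz)
    · rintro _ ⟨x, ε, hx, rfl⟩
      rw [P.symmetrise_prod_succ f x ε hx]
      -- Applied to the bilinear map (x, z) ↦ f(x) σ(z), the total derivative of a product is
      -- exactly the sum over first factors.
      exact P.sum_pd_prod X d hX
        ((LinearMap.lcomp 𝕜 A (P.symmetrise f)) ∘ₗ LinearMap.mul 𝕜 A ∘ₗ f) x ε hx
    · simp
    · intro y z _ _ hy hz
      simp only [map_add, mul_add, Finset.sum_add_distrib, hy, hz, smul_add]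
    · intro c y _ hy
      simp only [map_smul, mul_smul_comm, ← Finset.smul_sum, hy]
      rw [smul_comm]

end SuperSpace

/-! ### Power series in a nilpotent element -/

section NilEval

open PowerSeries

variable {𝕜 : Type u} [Field 𝕜] {A : Type v} [Ring A] [Algebra 𝕜 A]

/-- The value of the power series `φ`, truncated at degree `N`, at `a`. -/
def nilEval (N : ℕ) (a : A) (φ : PowerSeries 𝕜) : A :=
  ∑ k ∈ Finset.range N, coeff k φ • a ^ k

theorem nilEval_eq_aeval (N : ℕ) (a : A) (φ : PowerSeries 𝕜) :
    nilEval N a φ = Polynomial.aeval a (trunc N φ) := by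
  rw [trunc_apply, Nat.Ico_zero_eq_range, map_sum, nilEval]
  simp [Polynomial.aeval_monomial, Algebra.smul_def]

theorem nilEval_coe {N : ℕ} {a : A} (ha : a ^ N = 0) (p : Polynomial 𝕜) :
    nilEval N a (p : PowerSeries 𝕜) = Polynomial.aeval a p := by
  induction p using Polynomial.induction_on' with
  | add p q hp hq =>
    rw [Polynomial.coe_add, map_add, ← hp, ← hq]
    simp [nilEval, add_smul, Finset.sum_add_distrib]
  | monomial n c =>
    rw [nilEval, Polynomial.aeval_monomial]
    simp only [Polynomial.coeff_coe, Polynomial.coeff_monomial, ite_smul, zero_smul,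
      Finset.sum_ite_eq, Finset.mem_range, ← Algebra.smul_def]
    split_ifs with h
    · rfl
    · rw [pow_eq_zero_of_le (not_lt.mp h) ha, smul_zero]

/-- Truncating the product discards only degrees from `N` on, where the powers of `a` vanish. -/
theorem nilEval_mul {N : ℕ} {a : A} (ha : a ^ N = 0) (φ ψ : PowerSeries 𝕜) :
    nilEval N a (φ * ψ) = nilEval N a φ * nilEval N a ψ := by
  rw [nilEval_eq_aeval N a φ, nilEval_eq_aeval N a ψ, ← map_mul, ← nilEval_coe ha,
    nilEval_eq_aeval, nilEval_eq_aeval, Polynomial.coe_mul, trunc_trunc_mul_trunc]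

theorem nilEval_one {N : ℕ} {a : A} (ha : a ^ N = 0) : nilEval N a (1 : PowerSeries 𝕜) = 1 := by
  simpa using nilEval_coe ha (1 : Polynomial 𝕜)

theorem nilEval_X {N : ℕ} {a : A} (ha : a ^ N = 0) :
    nilEval N a (PowerSeries.X : PowerSeries 𝕜) = a := by
  simpa using nilEval_coe ha (Polynomial.X : Polynomial 𝕜)

theorem nilEval_add (N : ℕ) (a : A) (φ ψ : PowerSeries 𝕜) :
    nilEval N a (φ + ψ) = nilEval N a φ + nilEval N a ψ := by
  simp [nilEval, add_smul, Finset.sum_add_distrib]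

theorem nilEval_commute {a c : A} (h : Commute c a) (N : ℕ) (φ : PowerSeries 𝕜) :
    Commute c (nilEval N a φ) :=
  Commute.sum_right _ _ _ fun k _ => (h.pow_right k).smul_right _

variable (𝕜) [CharZero 𝕜]

/-- The series `(1 - exp (-t)) / t`. -/
def symSeries : PowerSeries 𝕜 := PowerSeries.mk fun k => (-1) ^ k / ((k + 1).factorial : 𝕜)

/-- The series `t / (1 - exp (-t))`. -/
def bernSeries' : PowerSeries 𝕜 := PowerSeries.mk fun k =>
  (-1) ^ k * ((bernoulli k : ℚ) : 𝕜) / (k.factorial : 𝕜)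

/-- The series `t / (exp t - 1)`. -/
def bernSeries : PowerSeries 𝕜 := PowerSeries.mk fun k =>
  ((bernoulli k : ℚ) : 𝕜) / (k.factorial : 𝕜)

/-- The sign (-1)^k changes only the coefficient of degree one, since the other odd Bernoulli
numbers vanish; there it turns -1/2 into 1/2. -/
theorem bernSeries'_eq_add : bernSeries' 𝕜 = bernSeries 𝕜 + PowerSeries.X := by
  ext k
  simp only [bernSeries', bernSeries, coeff_mk, map_add, coeff_X]
  by_cases h : k = 1
  · subst h; simp [bernoulli_one]; norm_num
  · have := bernoulli_eq_bernoulli'_of_ne_one h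
    have h2 : bernoulli k = (-1) ^ k * bernoulli' k := rfl
    rw [← this] at h2
    have h3 : ((bernoulli k : ℚ) : 𝕜) = (-1) ^ k * ((bernoulli k : ℚ) : 𝕜) := by
      conv_lhs => rw [h2]
      push_cast; rfl
    rw [← h3]; simp [h]

theorem bernSeries_mul_exp : bernSeries 𝕜 * (exp 𝕜 - 1) = PowerSeries.X := by
  have h := bernoulliPowerSeries_mul_exp_sub_one 𝕜
  convert h using 2
  ext k
  simp [bernSeries, bernoulliPowerSeries]

theorem X_mul_symSeries : PowerSeries.X * symSeries 𝕜 = 1 - evalNegHom (exp 𝕜) := by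
  ext k
  cases k with
  | zero =>
    rw [coeff_zero_X_mul, map_sub, evalNegHom, coeff_rescale]
    simp
  | succ k =>
    rw [mul_comm, coeff_succ_mul_X]
    simp [symSeries, evalNegHom, coeff_exp, pow_succ, coeff_one]
    ring

theorem bernSeries'_mul_symSeries : bernSeries' 𝕜 * symSeries 𝕜 = 1 := by
  have hE : exp 𝕜 * evalNegHom (exp 𝕜) = 1 := exp_mul_exp_neg_eq_one
  have h1 := X_mul_symSeries 𝕜
  have h2 := bernSeries_mul_exp 𝕜
  have hX : (PowerSeries.X : PowerSeries 𝕜) ≠ 0 := X_ne_zero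
  -- Division by `t` is avoided: after multiplying by `t`, only e^t · e^{-t} = 1 and the defining
  -- relations of the two series are needed.
  apply mul_left_cancel₀ hX
  rw [bernSeries'_eq_add]
  linear_combination (bernSeries 𝕜 + PowerSeries.X) * h1 + (evalNegHom (exp 𝕜)) * h2 - (bernSeries 𝕜) * hE

theorem coeff_zero_symSeries : coeff 0 (symSeries 𝕜) = 1 := by simp [symSeries]

/-- The differential equation (t φ)' = 1 - t φ for φ = (1 - e^{-t})/t, read off on coefficients. -/
theorem coeff_symSeries_succ (k : ℕ) :
    ((k + 1 : ℕ) + 1 : 𝕜) * coeff (k + 1) (symSeries 𝕜) = - coeff k (symSeries 𝕜) := by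
  simp only [symSeries, coeff_mk]
  rw [Nat.factorial_succ (k + 1), pow_succ]
  have h1 : ((k + 1).factorial : 𝕜) ≠ 0 := Nat.cast_ne_zero.mpr (Nat.factorial_ne_zero _)
  have h2 : ((k + 1 : ℕ) + 1 : 𝕜) ≠ 0 := by exact_mod_cast (Nat.succ_ne_zero (k + 1))
  push_cast at h2 ⊢
  field_simp

theorem coeff_zero_bernSeries : coeff 0 (bernSeries 𝕜) = 1 := by simp [bernSeries]

theorem coeff_zero_bernSeries' : coeff 0 (bernSeries' 𝕜) = 1 := by simp [bernSeries']

/-- A telescoping identity for the coefficients of `(1 - exp (-t)) / t`. -/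
theorem sum_symSeries {W : Type*} [AddCommGroup W] [Module 𝕜 W] (n : 𝕜) (v : ℕ → W) (N : ℕ) :
    ∑ k ∈ Finset.range N, coeff k (symSeries 𝕜) • ((n - k) • v k - v (k + 1)) =
      (n + 1) • ∑ k ∈ Finset.range N, coeff k (symSeries 𝕜) • v k - v 0 +
        ((N + 1 : 𝕜) * coeff N (symSeries 𝕜)) • v N := by
  induction N with
  | zero => simp [coeff_zero_symSeries]
  | succ N ih =>
    rw [Finset.sum_range_succ, Finset.sum_range_succ, ih, coeff_symSeries_succ]
    module

end NilEval

theorem koszul_add_right (a b c : ZMod 2) : koszul a (b + c) = koszul a b * koszul a c := by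
  revert a b c; unfold koszul; decide

theorem koszul_add_left (a b c : ZMod 2) : koszul (a + b) c = koszul a c * koszul b c := by
  revert a b c; unfold koszul; decide

namespace LieSuperalgebra

variable {𝕜 : Type u} {g : Type v} [Field 𝕜] [AddCommGroup g] [Module 𝕜 g]
variable {L : LieSuperalgebra 𝕜 g}

theorem sgn_bracket (a : ZMod 2) {b : ZMod 2} (x : g) {y : g} (hy : y ∈ L.par b) :
    L.sgn a (L.bracket x y) = koszul a b • L.bracket (L.sgn a x) y := by
  have : L.sgn a ∘ₗ L.bracket.flip y = koszul a b • (L.bracket.flip y ∘ₗ L.sgn a) := by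
    refine L.linearMap_ext_par fun c x hx => ?_
    simp only [LinearMap.comp_apply, LinearMap.smul_apply, LinearMap.flip_apply]
    rw [L.sgn_of_mem a (L.bracket_mem hx hy), L.sgn_of_mem a hx, koszul_add_right, map_zsmul,
      LinearMap.smul_apply, smul_smul, mul_comm]
  exact LinearMap.congr_fun this x

namespace ZGrading

variable (G : L.ZGrading)

/-! ### The grading -/

theorem bracket_mem_minus {x y : g} (hx : x ∈ G.minus) (hy : y ∈ G.minus) :
    L.bracket x y ∈ G.minus := by
  induction hx using Submodule.iSup_induction' with
  | mem i x hx =>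
    induction hy using Submodule.iSup_induction' with
    | mem j y hy =>
      exact Submodule.mem_iSup_of_mem (p := fun i : {i : ℤ // i < 0} => G.gr i)
        ⟨i + j, add_neg i.2 j.2⟩ (G.bracket_mem hx hy)
    | zero => simp
    | add y z _ _ hy hz => rw [map_add]; exact Submodule.add_mem _ hy hz
  | zero => simp
  | add x z _ _ hx hz => rw [map_add, LinearMap.add_apply]; exact Submodule.add_mem _ hx hz

theorem projNonneg_apply (x : g) : G.projNonneg x = x - G.toMinus x := rfl

theorem toMinus_add_projNonneg (x : g) : (G.toMinus x : g) + G.projNonneg x = x := by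
  rw [projNonneg_apply, add_sub_cancel]

theorem gr_le_minus {i : ℤ} (hi : i < 0) : G.gr i ≤ G.minus :=
  le_iSup (fun i : {i : ℤ // i < 0} => G.gr i) ⟨i, hi⟩

theorem gr_le_nonneg {i : ℤ} (hi : 0 ≤ i) : G.gr i ≤ G.nonneg :=
  le_iSup (fun i : {i : ℤ // 0 ≤ i} => G.gr i) ⟨i, hi⟩

theorem plus_le_nonneg : G.plus ≤ G.nonneg := iSup_le fun i => G.gr_le_nonneg i.2.le

theorem toMinus_of_mem_minus {x : g} (hx : x ∈ G.minus) : (G.toMinus x : g) = x := by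
  rw [G.toMinus_of_mem ⟨x, hx⟩]

theorem projNonneg_of_mem_minus {x : g} (hx : x ∈ G.minus) : G.projNonneg x = 0 := by
  rw [projNonneg_apply, G.toMinus_of_mem_minus hx, sub_self]

theorem projNonneg_of_mem_nonneg {x : g} (hx : x ∈ G.nonneg) : G.projNonneg x = x := by
  rw [projNonneg_apply, G.toMinus_of_nonneg hx, Submodule.coe_zero, sub_zero]

theorem iSup_gr : ⨆ i, G.gr i = ⊤ := G.isInternal.submodule_iSup_eq_top

/-- The part of the filtration of `g` in degrees at most `m`. -/
def grLE (m : ℤ) : Submodule 𝕜 g := ⨆ i : {i : ℤ // i ≤ m}, G.gr i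

theorem gr_le_grLE {i m : ℤ} (h : i ≤ m) : G.gr i ≤ G.grLE m :=
  le_iSup (fun i : {i : ℤ // i ≤ m} => G.gr i) ⟨i, h⟩

theorem grLE_mono {m n : ℤ} (h : m ≤ n) : G.grLE m ≤ G.grLE n :=
  iSup_le fun i => G.gr_le_grLE (i.2.trans h)

theorem projNonneg_mem (x : g) : G.projNonneg x ∈ G.nonneg := by
  have hx : x ∈ ⨆ i, G.gr i := by rw [iSup_gr]; trivial
  induction hx using Submodule.iSup_induction' with
  | mem i x hx =>
    rcases lt_or_ge i 0 with h | h
    · rw [G.projNonneg_of_mem_minus (G.gr_le_minus h hx)]; exact Submodule.zero_mem _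
    · have := G.gr_le_nonneg h hx
      rwa [G.projNonneg_of_mem_nonneg this]
  | zero => simp
  | add x y _ _ hx hy => rw [map_add]; exact Submodule.add_mem _ hx hy

theorem projNonneg_mem_grLE {m : ℤ} {x : g} (hx : x ∈ G.grLE m) : G.projNonneg x ∈ G.grLE m := by
  induction hx using Submodule.iSup_induction' with
  | mem i x hx =>
    rcases lt_or_ge (i : ℤ) 0 with h | h
    · rw [G.projNonneg_of_mem_minus (G.gr_le_minus h hx)]; exact Submodule.zero_mem _
    · rw [G.projNonneg_of_mem_nonneg (G.gr_le_nonneg h hx)]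
      exact G.gr_le_grLE i.2 hx
  | zero => simp
  | add x y _ _ hx hy => rw [map_add]; exact Submodule.add_mem _ hx hy

theorem adTilde_mem_grLE (Z : G.minus) {m : ℤ} {x : g} (hx : x ∈ G.grLE m) :
    G.adTilde Z x ∈ G.grLE (m - 1) := by
  obtain ⟨z, hz⟩ := Z
  change L.bracket x z ∈ _
  induction hx using Submodule.iSup_induction' with
  | mem i x hx =>
    induction hz using Submodule.iSup_induction' with
    | mem j z hz =>
      have h := G.bracket_mem hx hz
      have hi := i.2
      have hj := j.2
      exact G.gr_le_grLE (by omega) h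
    | zero => simp
    | add y z _ _ hy hz => rw [map_add]; exact Submodule.add_mem _ hy hz
  | zero => simp
  | add x y _ _ hx hy => rw [map_add, LinearMap.add_apply]; exact Submodule.add_mem _ hx hy

theorem adTilde_mem_minus (Z : G.minus) {x : g} (hx : x ∈ G.minus) : G.adTilde Z x ∈ G.minus :=
  G.bracket_mem_minus hx Z.2

theorem exists_grLE [FiniteDimensional 𝕜 g] :
    ∃ (a : ℤ) (N : ℕ), G.grLE a = ⊤ ∧ ∀ m, m + N ≤ a → G.grLE m = ⊥ := by
  have hfin : {i | G.gr i ≠ ⊥}.Finite :=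
    WellFoundedGT.finite_ne_bot_of_iSupIndep G.isInternal.submodule_iSupIndep
  obtain ⟨a, ha⟩ := hfin.bddAbove
  obtain ⟨b, hb⟩ := hfin.bddBelow
  -- All degrees that occur lie between `b` and `a`; if m + N ≤ a then m < b, and nothing is left in
  -- degrees at most `m`.
  refine ⟨a, (a - b + 1).toNat, ?_, fun m hm => ?_⟩
  · rw [eq_top_iff, ← G.iSup_gr]
    refine iSup_le fun i => ?_
    by_cases h : G.gr i = ⊥
    · simp [h]
    · exact G.gr_le_grLE (ha h)
  · rw [eq_bot_iff]
    refine iSup_le fun i => ?_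
    by_contra h
    have : G.gr i ≠ ⊥ := fun h' => h (by rw [h'])
    have h1 := hb this
    have h2 := i.2
    omega

/-! ### The shift operator on `g ⊗ S(g_-)` -/

/-- The subspace of `g ⊗ S(g_-)` spanned by the tensors of elements of `W` and `U`. -/
def tp (W : Submodule 𝕜 g) (U : Submodule 𝕜 G.minusSpace.Sym) :
    Submodule 𝕜 (g ⊗[𝕜] G.minusSpace.Sym) :=
  Submodule.map₂ (TensorProduct.mk 𝕜 g G.minusSpace.Sym) W U

variable {G} in
theorem tp_le {W : Submodule 𝕜 g} {U : Submodule 𝕜 G.minusSpace.Sym}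
    {N : Submodule 𝕜 (g ⊗[𝕜] G.minusSpace.Sym)} :
    G.tp W U ≤ N ↔ ∀ x ∈ W, ∀ z ∈ U, x ⊗ₜ[𝕜] z ∈ N := Submodule.map₂_le

variable {G} in
theorem tmul_mem_tp {W : Submodule 𝕜 g} {U : Submodule 𝕜 G.minusSpace.Sym} {x : g}
    {z : G.minusSpace.Sym} (hx : x ∈ W) (hz : z ∈ U) : x ⊗ₜ[𝕜] z ∈ G.tp W U :=
  Submodule.apply_mem_map₂ _ hx hz

variable {G} in
theorem tp_mono {W W' : Submodule 𝕜 g} {U U' : Submodule 𝕜 G.minusSpace.Sym} (h : W ≤ W')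
    (h' : U ≤ U') : G.tp W U ≤ G.tp W' U' := Submodule.map₂_le_map₂ h h'

theorem tp_bot (U : Submodule 𝕜 G.minusSpace.Sym) : G.tp ⊥ U = ⊥ := Submodule.map₂_bot_left _ _

theorem mem_tp_eq {M : Type*} [AddCommGroup M] [Module 𝕜 M]
    {W : Submodule 𝕜 g} {U : Submodule 𝕜 G.minusSpace.Sym}
    {f f' : g ⊗[𝕜] G.minusSpace.Sym →ₗ[𝕜] M}
    (h : ∀ x ∈ W, ∀ z ∈ U, f (x ⊗ₜ z) = f' (x ⊗ₜ z)) {w : g ⊗[𝕜] G.minusSpace.Sym}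
    (hw : w ∈ G.tp W U) : f w = f' w :=
  (tp_le (N := LinearMap.eqLocus f f')).mpr h hw

/-- An operator on `g ⊗ S(g_-)` is lowering if it lowers the filtration of `g`. -/
def Lowering (A : Module.End 𝕜 (g ⊗[𝕜] G.minusSpace.Sym)) : Prop :=
  ∀ m, ∀ w ∈ G.tp (G.grLE m) ⊤, A w ∈ G.tp (G.grLE (m - 1)) ⊤

variable {G} in
theorem Lowering.pow_mem {A : Module.End 𝕜 (g ⊗[𝕜] G.minusSpace.Sym)} (hA : G.Lowering A)
    (n : ℕ) {m : ℤ} {w : g ⊗[𝕜] G.minusSpace.Sym} (hw : w ∈ G.tp (G.grLE m) ⊤) :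
    (A ^ n) w ∈ G.tp (G.grLE (m - n)) ⊤ := by
  induction n with
  | zero => simpa using hw
  | succ n ih =>
    rw [pow_succ', Module.End.mul_apply, Nat.cast_succ, ← sub_sub]
    exact hA _ _ ih

variable {G} in
-- The exponent is the length of the filtration of g, hence the same for all lowering operators. It
-- serves both the shift operator and the operator `straighten`.
theorem Lowering.exists_pow [FiniteDimensional 𝕜 g] :
    ∃ N : ℕ, ∀ A : Module.End 𝕜 (g ⊗[𝕜] G.minusSpace.Sym), G.Lowering A → A ^ N = 0 := by
  obtain ⟨a, N, ha, hN⟩ := G.exists_grLE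
  refine ⟨N, fun A hA => ?_⟩
  ext1
  refine LinearMap.ext fun x => LinearMap.ext fun z => ?_
  have h : (A ^ N) (x ⊗ₜ z) ∈ G.tp (G.grLE (a - N)) ⊤ :=
    hA.pow_mem N (tmul_mem_tp (by rw [ha]; trivial) trivial)
  rw [hN _ (by omega), tp_bot] at h
  simpa using h

variable {I : Type*} [Fintype I] (X : Module.Basis I 𝕜 G.minus) (d : I → ZMod 2)

/-- The operator `∑ i, adTilde X_i ⊗ ∂^i` on `g ⊗ S(g_-)`. -/
def shift : Module.End 𝕜 (g ⊗[𝕜] G.minusSpace.Sym) :=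
  ∑ i, TensorProduct.map (G.adTilde (X i)) (G.minusSpace.pd X d i)

theorem shift_tmul (x : g) (z : G.minusSpace.Sym) :
    G.shift X d (x ⊗ₜ z) = ∑ i, L.bracket x (X i) ⊗ₜ G.minusSpace.pd X d i z := by
  simp [shift, adTilde]

/-- The operator `x ⊗ z ↦ ± x ⊗ ∂^i z`, where the sign is that of exchanging `x` and `X_i`. -/
def signedPd (i : I) : Module.End 𝕜 (g ⊗[𝕜] G.minusSpace.Sym) :=
  TensorProduct.map (L.sgn (d i)) (G.minusSpace.pd X d i)

omit [Fintype I] in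
theorem signedPd_tmul (i : I) (x : g) (z : G.minusSpace.Sym) :
    G.signedPd X d i (x ⊗ₜ z) = L.sgn (d i) x ⊗ₜ G.minusSpace.pd X d i z := rfl

/-- Exchanging ∂^i and ∂^j costs the same sign as replacing `x` by [x, X_j] under `sgn`, and the two
cancel. This is what lets power series in the shift operator pass through `average`. -/
theorem signedPd_shift (hX : ∀ i, X i ∈ G.minusSpace.par (d i)) (i : I) :
    Commute (G.signedPd X d i) (G.shift X d) := by
  refine TensorProduct.ext' fun x z => ?_
  simp only [Module.End.mul_apply, shift_tmul, signedPd_tmul, map_sum]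
  refine Finset.sum_congr rfl fun j _ => ?_
  have hj : (X j : g) ∈ L.par (d j) := hX j
  rw [sgn_bracket _ _ hj, G.minusSpace.pd_pd, TensorProduct.smul_tmul, smul_smul,
    koszul_mul_self, one_smul]

theorem lowering_shift : G.Lowering (G.shift X d) := by
  intro m
  suffices h : G.tp (G.grLE m) ⊤ ≤ (G.tp (G.grLE (m - 1)) ⊤).comap (G.shift X d) from
    fun w hw => h hw
  refine tp_le.mpr fun x hx z _ => ?_
  rw [Submodule.mem_comap, shift_tmul]
  exact Submodule.sum_mem _ fun i _ => tmul_mem_tp (G.adTilde_mem_grLE (X i) hx) trivial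

theorem shift_mem_succ {W : Submodule 𝕜 g} (hW : ∀ Z, ∀ x ∈ W, G.adTilde Z x ∈ W) {n : ℕ}
    {w : g ⊗[𝕜] G.minusSpace.Sym} (hw : w ∈ G.tp W (G.minusSpace.symDeg (n + 1))) :
    G.shift X d w ∈ G.tp W (G.minusSpace.symDeg n) := by
  suffices h : G.tp W (G.minusSpace.symDeg (n + 1)) ≤
      (G.tp W (G.minusSpace.symDeg n)).comap (G.shift X d) from h hw
  refine tp_le.mpr fun x hx z hz => ?_
  rw [Submodule.mem_comap, shift_tmul]
  exact Submodule.sum_mem _ fun i _ => tmul_mem_tp (hW _ x hx) (G.minusSpace.pd_mem_symDeg X d i hz)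

theorem shift_zero {w : g ⊗[𝕜] G.minusSpace.Sym} (hw : w ∈ G.tp ⊤ (G.minusSpace.symDeg 0)) :
    G.shift X d w = 0 := by
  refine G.mem_tp_eq (f' := 0) (fun x _ z hz => ?_) hw
  simp [shift_tmul, G.minusSpace.pd_symDeg_zero X d _ hz]

theorem shift_pow_zero {n k : ℕ} (h : n < k) {w : g ⊗[𝕜] G.minusSpace.Sym}
    (hw : w ∈ G.tp ⊤ (G.minusSpace.symDeg n)) : (G.shift X d ^ k) w = 0 := by
  induction n generalizing k w with
  | zero =>
    obtain ⟨k, rfl⟩ := Nat.exists_eq_succ_of_ne_zero (by omega : k ≠ 0)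
    rw [pow_succ, Module.End.mul_apply, G.shift_zero X d hw, map_zero]
  | succ n ih =>
    obtain ⟨k, rfl⟩ := Nat.exists_eq_succ_of_ne_zero (by omega : k ≠ 0)
    rw [pow_succ, Module.End.mul_apply]
    exact ih (by omega) (G.shift_mem_succ X d (by simp) hw)

theorem shift_pow_mem {W : Submodule 𝕜 g} (hW : ∀ Z, ∀ x ∈ W, G.adTilde Z x ∈ W) {n k : ℕ}
    {w : g ⊗[𝕜] G.minusSpace.Sym} (hw : w ∈ G.tp W (G.minusSpace.symDeg (n + k))) :
    (G.shift X d ^ k) w ∈ G.tp W (G.minusSpace.symDeg n) := by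
  induction k generalizing w with
  | zero => simpa using hw
  | succ k ih =>
    rw [pow_succ, Module.End.mul_apply]
    exact ih (G.shift_mem_succ X d hW hw)

/-! ### The averaging identity -/

section Averaging

variable {W : Type*} [AddCommGroup W] [Module 𝕜 W]

/-- The linear map `x ⊗ z ↦ ∑ i, ± A_i Ψ (x ⊗ ∂^i z)`. -/
def average (A : I → Module.End 𝕜 W) (Ψ : g ⊗[𝕜] G.minusSpace.Sym →ₗ[𝕜] W) :
    g ⊗[𝕜] G.minusSpace.Sym →ₗ[𝕜] W :=
  ∑ i, A i ∘ₗ Ψ ∘ₗ G.signedPd X d i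

theorem average_tmul (A : I → Module.End 𝕜 W) (Ψ : g ⊗[𝕜] G.minusSpace.Sym →ₗ[𝕜] W) (x : g)
    (z : G.minusSpace.Sym) : G.average X d A Ψ (x ⊗ₜ z) =
      ∑ i, A i (Ψ (L.sgn (d i) x ⊗ₜ G.minusSpace.pd X d i z)) := by
  simp [average, signedPd_tmul]

theorem average_comp (A : I → Module.End 𝕜 W)
    (Ψ : g ⊗[𝕜] G.minusSpace.Sym →ₗ[𝕜] W) {B : Module.End 𝕜 (g ⊗[𝕜] G.minusSpace.Sym)}
    (hB : ∀ i, Commute (G.signedPd X d i) B) (w : g ⊗[𝕜] G.minusSpace.Sym) :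
    G.average X d A (Ψ ∘ₗ B) w = G.average X d A Ψ (B w) := by
  simp only [average, LinearMap.sum_apply, LinearMap.comp_apply]
  refine Finset.sum_congr rfl fun i _ => ?_
  have := LinearMap.congr_fun (hB i).eq w
  simp only [Module.End.mul_apply] at this
  rw [this]

/-- Every summand of the correction measures the failure of the averaging identity, in degree n - k,
at the k-th power of the shift. Once the identity is known there, only the first line survives. -/
theorem average_symSeries [CharZero 𝕜] {N : ℕ} (hN : G.shift X d ^ N = 0)
    (A : I → Module.End 𝕜 W) (Ψ : g ⊗[𝕜] G.minusSpace.Sym →ₗ[𝕜] W) (n : 𝕜)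
    (w : g ⊗[𝕜] G.minusSpace.Sym) :
    G.average X d A Ψ (nilEval N (G.shift X d) (symSeries 𝕜) w) =
      (n + 1) • Ψ (nilEval N (G.shift X d) (symSeries 𝕜) w) - Ψ w +
      ∑ k ∈ Finset.range N, PowerSeries.coeff k (symSeries 𝕜) •
        (G.average X d A Ψ ((G.shift X d ^ k) w) -
          ((n - k) • Ψ ((G.shift X d ^ k) w) - Ψ ((G.shift X d ^ (k + 1)) w))) := by
  have h := sum_symSeries 𝕜 n (fun k => Ψ ((G.shift X d ^ k) w)) N
  simp only [hN, pow_zero, Module.End.one_apply, LinearMap.zero_apply, map_zero, smul_zero,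
    add_zero] at h
  simp only [nilEval, LinearMap.sum_apply, LinearMap.smul_apply, map_sum, map_smul]
  rw [← h]
  simp only [smul_sub _ (G.average X d A Ψ _), Finset.sum_sub_distrib]
  abel

end Averaging

end ZGrading

end LieSuperalgebra

/-! ### Compatibility of signs and λ with the splitting g = g_- ⊕ k -/

namespace LieSuperalgebra

variable {𝕜 : Type u} {g : Type v} [Field 𝕜] [AddCommGroup g] [Module 𝕜 g]
variable {L : LieSuperalgebra 𝕜 g}

namespace ZGrading

variable (G : L.ZGrading)

theorem mem_tp_cases {M : Type*} [AddCommGroup M] [Module 𝕜 M]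
    {U : Submodule 𝕜 G.minusSpace.Sym} {f f' : g ⊗[𝕜] G.minusSpace.Sym →ₗ[𝕜] M}
    (hm : ∀ x ∈ G.minus, ∀ z ∈ U, f (x ⊗ₜ z) = f' (x ⊗ₜ z))
    (hk : ∀ x ∈ G.nonneg, ∀ z ∈ U, f (x ⊗ₜ z) = f' (x ⊗ₜ z))
    {w : g ⊗[𝕜] G.minusSpace.Sym} (hw : w ∈ G.tp ⊤ U) : f w = f' w := by
  refine G.mem_tp_eq (fun x _ z hz => ?_) hw
  rw [← G.toMinus_add_projNonneg x, TensorProduct.add_tmul, map_add, map_add,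
    hm _ (G.toMinus x).2 z hz, hk _ (G.projNonneg_mem x) z hz]

theorem coe_sgn (a : ZMod 2) (x : G.minus) : (G.minusSpace.sgn a x : g) = L.sgn a x := by
  have : G.minus.subtype ∘ₗ G.minusSpace.sgn a = L.sgn a ∘ₗ G.minus.subtype := by
    refine G.minusSpace.linearMap_ext_par fun b x hx => ?_
    have hx' : (x : g) ∈ L.par b := hx
    simp [G.minusSpace.sgn_of_mem a hx, L.sgn_of_mem a hx']
  exact LinearMap.congr_fun this x

theorem sgn_mem_nonneg (a : ZMod 2) {x : g} (hx : x ∈ G.nonneg) : L.sgn a x ∈ G.nonneg :=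
  Submodule.add_mem _ (G.proj_mem_iSup _ _ _ hx)
    (zsmul_mem (G.proj_mem_iSup _ _ _ hx) _)

variable {G} in
theorem Character.ext_minus (lam : G.Character) {x : g} (hx : x ∈ G.minus) : lam.ext x = 0 := by
  induction hx using Submodule.iSup_induction' with
  | mem i x hx => simp [Character.ext, G.toZero_of_mem_ne hx i.2.ne]
  | zero => simp
  | add x y _ _ hx hy => simp [hx, hy]

variable {G} in
theorem Character.ext_sgn (lam : G.Character) (a : ZMod 2) {x : g} (hx : x ∈ G.nonneg) :
    lam.ext (L.sgn a x) = lam.ext x := by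
  have h1 : lam.ext (L.proj 1 x) = 0 :=
    lam.ext_odd (G.proj_mem_iSup _ 1 _ hx) (L.toSuperSpace.proj_mem 1 x)
  have h2 := congrArg lam.ext (L.toSuperSpace.proj_zero_add_proj_one x)
  rw [map_add, h1, add_zero] at h2
  simp [SuperSpace.sgn, h1, h2]

theorem sum_coord_apply {I : Type*} [Fintype I] (X : Module.Basis I 𝕜 G.minus) {W : Type*}
    [AddCommGroup W] [Module 𝕜 W] (A : g →ₗ[𝕜] Module.End 𝕜 W) (x : G.minus) (v : W) :
    ∑ i, A (X i) (X.coord i x • v) = A x v := by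
  have h := congrArg (fun y : G.minus => A y v) (X.sum_repr x)
  simp only [Submodule.coe_sum, Submodule.coe_smul, map_sum, map_smul, LinearMap.sum_apply,
    LinearMap.smul_apply] at h
  simpa only [map_smul, Module.Basis.coord_apply] using h

/-! ### The model of the module on `S(g_-)` -/

variable [FiniteDimensional 𝕜 g]

/-- A number such that powers of lowering operators with this exponent vanish. -/
def nilBound : ℕ := Classical.choose (Lowering.exists_pow (G := G)) + 1

variable {G} in
theorem Lowering.pow_nilBound {A : Module.End 𝕜 (g ⊗[𝕜] G.minusSpace.Sym)}
    (hA : G.Lowering A) : A ^ G.nilBound = 0 :=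
  pow_eq_zero_of_le (Nat.le_succ _) (Classical.choose_spec (Lowering.exists_pow (G := G)) A hA)

variable {I : Type*} [Fintype I] (X : Module.Basis I 𝕜 G.minus) (d : I → ZMod 2)

/-- The value of a power series at the shift operator. -/
def ev (φ : PowerSeries 𝕜) : Module.End 𝕜 (g ⊗[𝕜] G.minusSpace.Sym) :=
  nilEval G.nilBound (G.shift X d) φ

theorem shift_pow_nilBound : G.shift X d ^ G.nilBound = 0 := (G.lowering_shift X d).pow_nilBound

theorem ev_mul (φ ψ : PowerSeries 𝕜) : G.ev X d (φ * ψ) = G.ev X d φ * G.ev X d ψ :=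
  nilEval_mul (G.shift_pow_nilBound X d) φ ψ

theorem ev_apply (φ : PowerSeries 𝕜) (w : g ⊗[𝕜] G.minusSpace.Sym) : G.ev X d φ w =
    ∑ k ∈ Finset.range G.nilBound, PowerSeries.coeff k φ • (G.shift X d ^ k) w := by
  simp [ev, nilEval]

/-- The sum may be extended by the vanishing power `nilBound`; then the constant term is split off,
leaving a range of the same length. -/
theorem ev_apply' (φ : PowerSeries 𝕜) (w : g ⊗[𝕜] G.minusSpace.Sym) : G.ev X d φ w =
    PowerSeries.coeff 0 φ • w + ∑ k ∈ Finset.range G.nilBound,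
      PowerSeries.coeff (k + 1) φ • (G.shift X d ^ (k + 1)) w := by
  have h : (PowerSeries.coeff G.nilBound φ • (G.shift X d ^ G.nilBound) w) = 0 := by
    rw [G.shift_pow_nilBound, LinearMap.zero_apply, smul_zero]
  have h2 := Finset.sum_range_succ
    (fun k => PowerSeries.coeff k φ • (G.shift X d ^ k) w) G.nilBound
  rw [h, add_zero, ← ev_apply, Finset.sum_range_succ'] at h2
  rw [← h2, add_comm]; simp

theorem ev_of_shift_eq_zero (φ : PowerSeries 𝕜) {w : g ⊗[𝕜] G.minusSpace.Sym}
    (hw : G.shift X d w = 0) : G.ev X d φ w = PowerSeries.coeff 0 φ • w := by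
  rw [ev_apply']
  simp [pow_succ, hw]

theorem average_ev {W : Type*} [AddCommGroup W] [Module 𝕜 W]
    (hX : ∀ i, X i ∈ G.minusSpace.par (d i)) (A : I → Module.End 𝕜 W)
    (Ψ : g ⊗[𝕜] G.minusSpace.Sym →ₗ[𝕜] W) (φ : PowerSeries 𝕜) (w : g ⊗[𝕜] G.minusSpace.Sym) :
    G.average X d A Ψ (G.ev X d φ w) = G.average X d A (Ψ ∘ₗ G.ev X d φ) w :=
  (G.average_comp X d A Ψ (fun i => nilEval_commute (G.signedPd_shift X d hX i) _ _) w).symm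

theorem average_ev_symSeries [CharZero 𝕜] {W : Type*} [AddCommGroup W] [Module 𝕜 W]
    (A : I → Module.End 𝕜 W) (Ψ : g ⊗[𝕜] G.minusSpace.Sym →ₗ[𝕜] W) (n : 𝕜)
    (w : g ⊗[𝕜] G.minusSpace.Sym) :
    G.average X d A Ψ (G.ev X d (symSeries 𝕜) w) =
      (n + 1) • Ψ (G.ev X d (symSeries 𝕜) w) - Ψ w +
      ∑ k ∈ Finset.range G.nilBound, PowerSeries.coeff k (symSeries 𝕜) •
        (G.average X d A Ψ ((G.shift X d ^ k) w) -
          ((n - k) • Ψ ((G.shift X d ^ k) w) - Ψ ((G.shift X d ^ (k + 1)) w))) :=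
  G.average_symSeries X d (G.shift_pow_nilBound X d) A Ψ n w

variable {G} (lam : G.Character)

/-- The map `x ⊗ z ↦ λ(x) z`. -/
def lamMap : g ⊗[𝕜] G.minusSpace.Sym →ₗ[𝕜] G.minusSpace.Sym :=
  TensorProduct.lift (LinearMap.lsmul 𝕜 G.minusSpace.Sym ∘ₗ lam.ext)

omit [FiniteDimensional 𝕜 g] in
theorem lamMap_tmul (x : g) (z : G.minusSpace.Sym) : lamMap lam (x ⊗ₜ z) = lam.ext x • z := by
  simp [lamMap]

variable (G) in
/-- The map that multiplies the component in `g_-` of the first factor with the second factor. -/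
def mulMap : g ⊗[𝕜] G.minusSpace.Sym →ₗ[𝕜] G.minusSpace.Sym :=
  TensorProduct.lift (G.mulOp ∘ₗ G.toMinus)

omit [FiniteDimensional 𝕜 g] in
theorem mulMap_tmul (x : g) (z : G.minusSpace.Sym) :
    G.mulMap (x ⊗ₜ z) = G.minusSpace.ι (G.toMinus x) * z := by
  simp [mulMap, mulOp]

variable (G) in
/-- The projection of `g ⊗ S(g_-)` onto `k ⊗ S(g_-)`. -/
def nonnegPart : Module.End 𝕜 (g ⊗[𝕜] G.minusSpace.Sym) :=
  TensorProduct.map G.projNonneg LinearMap.id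

variable (G) in
/-- The operator that is the identity on `g_- ⊗ S(g_-)` and the value of `t / (exp t - 1)` at the
shift operator on `k ⊗ S(g_-)`. -/
def straighten [CharZero 𝕜] : Module.End 𝕜 (g ⊗[𝕜] G.minusSpace.Sym) :=
  1 + (G.ev X d (bernSeries 𝕜) - 1) * G.nonnegPart

variable [CharZero 𝕜]

/-- The series t/(e^t - 1) has constant coefficient 1, so after subtracting the identity only
positive powers of the shift remain. -/
theorem lowering_straighten_sub_one :
    G.Lowering ((G.ev X d (bernSeries 𝕜) - 1) * G.nonnegPart) := by
  intro m w hw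
  have h1 : G.nonnegPart w ∈ G.tp (G.grLE m) ⊤ := by
    have : G.tp (G.grLE m) ⊤ ≤ (G.tp (G.grLE m) ⊤).comap G.nonnegPart :=
      tp_le.mpr fun x hx z _ => tmul_mem_tp (G.projNonneg_mem_grLE hx) trivial
    exact this hw
  rw [Module.End.mul_apply, LinearMap.sub_apply, ev_apply', coeff_zero_bernSeries, one_smul,
    Module.End.one_apply, add_sub_cancel_left]
  refine Submodule.sum_mem _ fun k _ => Submodule.smul_mem _ _ ?_
  refine tp_mono (G.grLE_mono ?_) le_rfl ((G.lowering_shift X d).pow_mem (k + 1) h1)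
  push_cast; omega

theorem isUnit_straighten : IsUnit (G.straighten X d) := by
  refine IsNilpotent.isUnit_one_add ⟨G.nilBound, ?_⟩
  exact (lowering_straighten_sub_one X d).pow_nilBound

/-- The linear map `Q` from `g ⊗ S(g_-)` to `S(g_-)` which is multiplication on `g_- ⊗ S(g_-)` and
for which `Q (t / (exp t - 1))`, taken at the shift operator, is `λ` on `k ⊗ S(g_-)`. -/
def symAct : g ⊗[𝕜] G.minusSpace.Sym →ₗ[𝕜] G.minusSpace.Sym :=
  -- `mulMap` vanishes on k ⊗ S(g_-) and `lamMap` on g_- ⊗ S(g_-), so the sum prescribes both values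
  -- at once. By `isUnit_straighten` the junk value of `Ring.inverse` does not occur.
  (G.mulMap + lamMap lam) ∘ₗ Ring.inverse (G.straighten X d)

theorem symAct_straighten (w : g ⊗[𝕜] G.minusSpace.Sym) :
    symAct X d lam (G.straighten X d w) = G.mulMap w + lamMap lam w := by
  rw [symAct, LinearMap.comp_apply, ← Module.End.mul_apply,
    Ring.inverse_mul_cancel _ (isUnit_straighten X d)]
  rfl

theorem straighten_minus {w : g ⊗[𝕜] G.minusSpace.Sym} (hw : w ∈ G.tp G.minus ⊤) :
    G.straighten X d w = w := by
  have : G.nonnegPart w = 0 := by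
    refine G.mem_tp_eq (f' := 0) (fun x hx z _ => ?_) hw
    simp [nonnegPart, G.projNonneg_of_mem_minus hx]
  simp [straighten, this]

theorem straighten_nonneg {w : g ⊗[𝕜] G.minusSpace.Sym} (hw : w ∈ G.tp G.nonneg ⊤) :
    G.straighten X d w = G.ev X d (bernSeries 𝕜) w := by
  have : G.nonnegPart w = w := by
    refine G.mem_tp_eq (f' := LinearMap.id) (fun x hx z _ => ?_) hw
    simp [nonnegPart, G.projNonneg_of_mem_nonneg hx]
  simp [straighten, this]

theorem symAct_minus {w : g ⊗[𝕜] G.minusSpace.Sym} (hw : w ∈ G.tp G.minus ⊤) :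
    symAct X d lam w = G.mulMap w := by
  have h := symAct_straighten X d lam w
  rw [straighten_minus X d hw] at h
  rw [h, G.mem_tp_eq (f := lamMap lam) (f' := 0) (fun x hx z _ => ?_) hw, LinearMap.zero_apply,
    add_zero]
  simp [lamMap_tmul, lam.ext_minus hx]

theorem symAct_minus_tmul (x : G.minus) (z : G.minusSpace.Sym) :
    symAct X d lam ((x : g) ⊗ₜ z) = G.minusSpace.ι x * z := by
  rw [symAct_minus X d lam (tmul_mem_tp x.2 trivial), mulMap_tmul, G.toMinus_of_mem]

theorem symAct_nonneg {w : g ⊗[𝕜] G.minusSpace.Sym} (hw : w ∈ G.tp G.nonneg ⊤) :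
    symAct X d lam (G.ev X d (bernSeries 𝕜) w) = lamMap lam w := by
  rw [← straighten_nonneg X d hw, symAct_straighten,
    G.mem_tp_eq (f := G.mulMap) (f' := 0) (fun x hx z _ => ?_) hw, LinearMap.zero_apply, zero_add]
  simp [mulMap_tmul, G.toMinus_of_nonneg hx]

/-- The action of `g` on `S(g_-)`, as a map from `g ⊗ S(g_-)` to `S(g_-)`. -/
def actMap : g ⊗[𝕜] G.minusSpace.Sym →ₗ[𝕜] G.minusSpace.Sym :=
  symAct X d lam ∘ₗ G.ev X d (bernSeries' 𝕜)

/-- The two series are reciprocal: Q is the symmetrised product belonging to the action. -/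
theorem actMap_symSeries (w : g ⊗[𝕜] G.minusSpace.Sym) :
    actMap X d lam (G.ev X d (symSeries 𝕜) w) = symAct X d lam w := by
  rw [actMap, LinearMap.comp_apply, ← Module.End.mul_apply, ← ev_mul, bernSeries'_mul_symSeries,
    ev, nilEval_one (G.shift_pow_nilBound X d), Module.End.one_apply]

theorem actMap_comp_symSeries :
    actMap X d lam ∘ₗ G.ev X d (symSeries 𝕜) = symAct X d lam :=
  LinearMap.ext (actMap_symSeries X d lam)

variable (G) in
theorem ev_bernSeries' (w : g ⊗[𝕜] G.minusSpace.Sym) :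
    G.ev X d (bernSeries' 𝕜) w = G.ev X d (bernSeries 𝕜) w + G.shift X d w := by
  rw [bernSeries'_eq_add, ev, nilEval_add, nilEval_X (G.shift_pow_nilBound X d)]; rfl

/-- By t/(1 - e^{-t}) = t/(e^t - 1) + t; the first summand contributes λ by the choice of Q. -/
theorem actMap_nonneg {w : g ⊗[𝕜] G.minusSpace.Sym} (hw : w ∈ G.tp G.nonneg ⊤) :
    actMap X d lam w = lamMap lam w + symAct X d lam (G.shift X d w) := by
  rw [actMap, LinearMap.comp_apply, ev_bernSeries', map_add, symAct_nonneg X d lam hw]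

/-- The action of `g` on `S(g_-)`. -/
def act : g →ₗ[𝕜] Module.End 𝕜 G.minusSpace.Sym := TensorProduct.curry (actMap X d lam)

theorem act_apply (x : g) (z : G.minusSpace.Sym) :
    act X d lam x z = actMap X d lam (x ⊗ₜ z) := rfl

variable (G) in
omit [FiniteDimensional 𝕜 g] in
-- [X_i, X_j] is super antisymmetric while the second derivatives are super symmetric, so the double
-- sum equals its own negative.
theorem shift_sum_basis (hX : ∀ i, X i ∈ G.minusSpace.par (d i)) (z : G.minusSpace.Sym) :
    G.shift X d (∑ i, (X i : g) ⊗ₜ G.minusSpace.pd X d i z) = 0 := by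
  have h : ∀ i j, L.bracket (X i) (X j) ⊗ₜ[𝕜] G.minusSpace.pd X d j (G.minusSpace.pd X d i z) =
      -(L.bracket (X j) (X i) ⊗ₜ[𝕜] G.minusSpace.pd X d i (G.minusSpace.pd X d j z)) := by
    intro i j
    have hi : (X i : g) ∈ L.par (d i) := hX i
    have hj : (X j : g) ∈ L.par (d j) := hX j
    rw [L.skew hi hj, G.minusSpace.pd_pd X d j i, TensorProduct.neg_tmul, TensorProduct.smul_tmul,
      smul_smul, koszul_comm, koszul_mul_self, one_smul]
  simp only [map_sum, shift_tmul]
  set s := ∑ i, ∑ j, L.bracket (X i) (X j) ⊗ₜ[𝕜]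
    G.minusSpace.pd X d j (G.minusSpace.pd X d i z) with hs
  have hs' : s = -s := by
    conv_rhs => rw [hs, Finset.sum_comm, ← Finset.sum_neg_distrib]
    refine Finset.sum_congr rfl fun i _ => ?_
    rw [← Finset.sum_neg_distrib]
    exact Finset.sum_congr rfl fun j _ => h _ _
  have h2 : (2 : 𝕜) • s = 0 := by rw [two_smul]; nth_rw 1 [hs']; exact neg_add_cancel s
  exact (smul_eq_zero.mp h2).resolve_left two_ne_zero

/-- The shift operator kills ∑ X_i ⊗ ∂^i z, so the action reduces to multiplication there and
Euler's identity in S(g_-) applies. -/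
theorem sum_act_pd (hX : ∀ i, X i ∈ G.minusSpace.par (d i)) {n : ℕ} {z : G.minusSpace.Sym}
    (hz : z ∈ G.minusSpace.symDeg n) :
    ∑ i, act X d lam (X i) (G.minusSpace.pd X d i z) = (n : 𝕜) • z := by
  simp only [act_apply]
  rw [← map_sum, actMap, LinearMap.comp_apply,
    ev_of_shift_eq_zero _ _ _ _ (G.shift_sum_basis X d hX z), coeff_zero_bernSeries', one_smul,
    map_sum, ← G.minusSpace.sum_ι_mul_pd X d hX hz]
  exact Finset.sum_congr rfl fun i _ => symAct_minus_tmul X d lam _ _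

/-- The averaging identity for the action of `g` on `S(g_-)`. -/
theorem average_act (hX : ∀ i, X i ∈ G.minusSpace.par (d i)) (n : ℕ)
    {w : g ⊗[𝕜] G.minusSpace.Sym} (hw : w ∈ G.tp ⊤ (G.minusSpace.symDeg n)) :
    G.average X d (fun i => act X d lam (X i)) (actMap X d lam) w =
      (n : 𝕜) • actMap X d lam w - actMap X d lam (G.shift X d w) := by
  induction n using Nat.strong_induction_on generalizing w with
  | _ n ih =>
    -- Positive powers of the shift drop the degree below `n`, so the induction hypothesis covers
    -- them; powers beyond `n` vanish.
    have low : ∀ w ∈ G.tp ⊤ (G.minusSpace.symDeg n), ∀ k : ℕ, 1 ≤ k →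
        G.average X d (fun i => act X d lam (X i)) (actMap X d lam) ((G.shift X d ^ k) w) -
          (((n : 𝕜) - k) • actMap X d lam ((G.shift X d ^ k) w) -
            actMap X d lam ((G.shift X d ^ (k + 1)) w)) = 0 := by
      intro w hw k hk
      rcases lt_or_ge n k with h | h
      · rw [pow_succ', Module.End.mul_apply, G.shift_pow_zero X d h hw]; simp
      · rw [ih (n - k) (by omega) (G.shift_pow_mem X d (by simp) (by rwa [Nat.sub_add_cancel h])),
          pow_succ', Module.End.mul_apply, Nat.cast_sub h, sub_self]
    refine G.mem_tp_cases (f := G.average X d (fun i => act X d lam (X i)) (actMap X d lam))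
      (f' := (n : 𝕜) • actMap X d lam - actMap X d lam ∘ₗ G.shift X d) ?_ ?_ hw
    · intro x hx z hz
      set w := x ⊗ₜ[𝕜] z with hw'
      have hw : w ∈ G.tp ⊤ (G.minusSpace.symDeg n) := tmul_mem_tp trivial hz
      have h1 := G.average_ev_symSeries X d
        (fun i => act X d lam (X i)) (actMap X d lam) n w
      have h2 : ∑ k ∈ Finset.range G.nilBound, PowerSeries.coeff k (symSeries 𝕜) •
          (G.average X d (fun i => act X d lam (X i)) (actMap X d lam) ((G.shift X d ^ k) w) -
          (((n : 𝕜) - k) • actMap X d lam ((G.shift X d ^ k) w) -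
            actMap X d lam ((G.shift X d ^ (k + 1)) w))) =
          G.average X d (fun i => act X d lam (X i)) (actMap X d lam) w -
            ((n : 𝕜) • actMap X d lam w - actMap X d lam (G.shift X d w)) := by
        rw [Finset.sum_eq_single 0]
        · simp [coeff_zero_symSeries]
        · intro k _ hk
          rw [low w hw k (Nat.one_le_iff_ne_zero.mpr hk), smul_zero]
        -- `nilBound` is a successor, so the index 0 belongs to the range.
        · intro h; exact absurd (Finset.mem_range.mpr (Nat.succ_pos _)) h
      -- On g_- the composite with the series is multiplication, so the average is ∑ X_i · (± x ∂^i
      -- z). Leibniz and Euler for x z, of degree n + 1, evaluate it as (n + 1) x z - x · z.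
      have h3 : G.average X d (fun i => act X d lam (X i)) (actMap X d lam)
          (G.ev X d (symSeries 𝕜) w) =
          ((n : 𝕜) + 1) • symAct X d lam w - actMap X d lam w := by
        rw [G.average_ev X d hX, actMap_comp_symSeries]
        have h4 := sum_act_pd X d lam hX (G.minusSpace.ι_mul_mem_symDeg ⟨x, hx⟩ hz)
        have h5 := G.sum_coord_apply X (act X d lam) ⟨x, hx⟩ z
        rw [hw', average_tmul, symAct_minus_tmul X d lam ⟨x, hx⟩ z]
        simp only [G.minusSpace.pd_ι_mul' X d hX, map_add, Finset.sum_add_distrib, h5] at h4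
        rw [← Nat.cast_succ, ← h4, act_apply, add_sub_cancel_left]
        refine Finset.sum_congr rfl fun i _ => ?_
        rw [← G.coe_sgn (d i) ⟨x, hx⟩, symAct_minus_tmul]
      rw [h2] at h1
      rw [h3, actMap_symSeries, eq_comm, add_eq_left, sub_eq_zero] at h1
      simpa using h1
    · intro x hx z hz
      have hxz : x ⊗ₜ[𝕜] z ∈ G.tp ⊤ (G.minusSpace.symDeg n) := tmul_mem_tp trivial hz
      -- For `x` in k the action is λ + Q D. Euler handles the λ part, and the Q part is an average
      -- at D(x ⊗ z), one degree lower.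
      have h1 : G.average X d (fun i => act X d lam (X i)) (actMap X d lam) (x ⊗ₜ z) =
          lam.ext x • ((n : 𝕜) • z) + G.average X d (fun i => act X d lam (X i))
            (actMap X d lam) (G.ev X d (symSeries 𝕜) (G.shift X d (x ⊗ₜ z))) := by
        rw [G.average_ev X d hX, actMap_comp_symSeries]
        rw [← G.average_comp X d _ _ (G.signedPd_shift X d hX), average_tmul, average_tmul,
          ← sum_act_pd X d lam hX hz, Finset.smul_sum, ← Finset.sum_add_distrib]
        refine Finset.sum_congr rfl fun i _ => ?_
        rw [actMap_nonneg X d lam (tmul_mem_tp (G.sgn_mem_nonneg _ hx) trivial), map_add,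
          lamMap_tmul, lam.ext_sgn _ hx, map_smul, LinearMap.comp_apply]
      have h2 : actMap X d lam (x ⊗ₜ z) = lam.ext x • z +
          symAct X d lam (G.shift X d (x ⊗ₜ z)) := by
        rw [actMap_nonneg X d lam (tmul_mem_tp hx trivial), lamMap_tmul]
      rw [LinearMap.sub_apply, LinearMap.smul_apply, LinearMap.comp_apply, h1, h2]
      cases n with
      | zero => simp [G.shift_zero X d hxz]
      | succ n =>
        have hs := G.shift_mem_succ X d (by simp) hxz
        have h3 := G.average_ev_symSeries X d
          (fun i => act X d lam (X i)) (actMap X d lam) n (G.shift X d (x ⊗ₜ z))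
        -- Every correction term involves a power D^(k+1) of x ⊗ z, hence lower degree, and vanishes
        -- by `low`.
        rw [Finset.sum_eq_zero (fun k _ => ?_), add_zero] at h3
        · rw [h3, actMap_symSeries, Nat.cast_succ]
          module
        · have := low _ hxz (k + 1) (by omega)
          simp only [pow_succ _ k, pow_succ _ (k + 1), Module.End.mul_apply] at this ⊢
          rw [Nat.cast_succ, Nat.cast_succ, add_sub_add_right_eq_sub] at this
          rw [this, smul_zero]

end ZGrading

end LieSuperalgebra

/-! ### The model is a representation: degree estimates and vanishing curvature -/

namespace LieSuperalgebra

variable {𝕜 : Type u} {g : Type v} [Field 𝕜] [AddCommGroup g] [Module 𝕜 g]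
variable {L : LieSuperalgebra 𝕜 g}

namespace ZGrading

variable {G : L.ZGrading} [FiniteDimensional 𝕜 g] [CharZero 𝕜]
variable {I : Type*} [Fintype I] (X : Module.Basis I 𝕜 G.minus) (d : I → ZMod 2)
variable (lam : G.Character)

variable (G) in
omit [FiniteDimensional 𝕜 g] [CharZero 𝕜] in
/-- The part of the filtration of `S(g_-)` in degrees less than `n`. -/
def symLT (n : ℕ) : Submodule 𝕜 G.minusSpace.Sym :=
  ⨆ m : {m : ℕ // m < n}, G.minusSpace.symDeg m

omit [FiniteDimensional 𝕜 g] [CharZero 𝕜] in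
theorem symDeg_le_symLT {m n : ℕ} (h : m < n) : G.minusSpace.symDeg m ≤ G.symLT n :=
  le_iSup (fun m : {m : ℕ // m < n} => G.minusSpace.symDeg m) ⟨m, h⟩

omit [FiniteDimensional 𝕜 g] [CharZero 𝕜] in
theorem symLT_mono {m n : ℕ} (h : m ≤ n) : G.symLT m ≤ G.symLT n :=
  iSup_le fun i => symDeg_le_symLT (i.2.trans_le h)

/-- On k ⊗ S(g_-) the defining equation expresses Q as λ minus terms Q D^(k+1). Each D lowers the
degree by one and Q raises it by at most one, so on this part Q does not raise the degree; on g_- it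
is multiplication. -/
theorem symAct_mem (n : ℕ) :
    (∀ w ∈ G.tp ⊤ (G.minusSpace.symDeg n), symAct X d lam w ∈ G.symLT (n + 2)) ∧
    (∀ w ∈ G.tp G.nonneg (G.minusSpace.symDeg n), symAct X d lam w ∈ G.symLT (n + 1)) := by
  induction n using Nat.strong_induction_on with
  | _ n ih =>
    have hk : ∀ w ∈ G.tp G.nonneg (G.minusSpace.symDeg n),
        symAct X d lam w ∈ G.symLT (n + 1) := by
      intro w hw
      have hw' : w ∈ G.tp ⊤ (G.minusSpace.symDeg n) := tp_mono le_top le_rfl hw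
      have h := symAct_nonneg X d lam (tp_mono le_rfl le_top hw)
      rw [ev_apply', coeff_zero_bernSeries, one_smul, map_add, map_sum] at h
      rw [eq_sub_of_add_eq h]
      refine Submodule.sub_mem _ ?_ (Submodule.sum_mem _ fun k _ => ?_)
      · have : G.tp G.nonneg (G.minusSpace.symDeg n) ≤ (G.symLT (n + 1)).comap (lamMap lam) := by
          refine tp_le.mpr fun x _ z hz => ?_
          rw [Submodule.mem_comap, lamMap_tmul]
          exact Submodule.smul_mem _ _ (symDeg_le_symLT n.lt_succ_self hz)
        exact this hw
      · rw [map_smul]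
        refine Submodule.smul_mem _ _ ?_
        rcases lt_or_ge n (k + 1) with hkn | hkn
        · rw [G.shift_pow_zero X d hkn hw', map_zero]; exact Submodule.zero_mem _
        · refine symLT_mono (by omega) ((ih (n - (k + 1)) (by omega)).1 _ (G.shift_pow_mem X d
            (k := k + 1) (by simp) (by rwa [Nat.sub_add_cancel hkn])))
    refine ⟨?_, hk⟩
    suffices h : G.tp ⊤ (G.minusSpace.symDeg n) ≤ (G.symLT (n + 2)).comap (symAct X d lam) from
      fun w hw => h hw
    refine tp_le.mpr fun x _ z hz => ?_
    rw [Submodule.mem_comap, ← G.toMinus_add_projNonneg x, TensorProduct.add_tmul, map_add]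
    refine Submodule.add_mem _ ?_ (symLT_mono (by omega)
      (hk _ (tmul_mem_tp (G.projNonneg_mem x) hz)))
    rw [symAct_minus_tmul]
    exact symDeg_le_symLT (by omega) (G.minusSpace.ι_mul_mem_symDeg _ hz)

theorem act_nonneg_mem {x : g} (hx : x ∈ G.nonneg) {n : ℕ} {z : G.minusSpace.Sym}
    (hz : z ∈ G.minusSpace.symDeg n) : act X d lam x z ∈ G.symLT (n + 1) := by
  have hxz : x ⊗ₜ[𝕜] z ∈ G.tp ⊤ (G.minusSpace.symDeg n) := tmul_mem_tp trivial hz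
  rw [act_apply, actMap_nonneg X d lam (tmul_mem_tp hx trivial), lamMap_tmul]
  refine Submodule.add_mem _ (Submodule.smul_mem _ _ (symDeg_le_symLT n.lt_succ_self hz)) ?_
  cases n with
  | zero => rw [G.shift_zero X d hxz, map_zero]; exact Submodule.zero_mem _
  | succ n => exact (symAct_mem X d lam n).1 _ (G.shift_mem_succ X d (by simp) hxz)

/-- Only the constant term of the series yields the top degree; a term with D^(k+1) loses at least
the one degree that Q may gain. -/
theorem act_minus_sub_mem (x : G.minus) {n : ℕ} {z : G.minusSpace.Sym}
    (hz : z ∈ G.minusSpace.symDeg n) :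
    act X d lam x z - G.minusSpace.ι x * z ∈ G.symLT (n + 1) := by
  have hxz : (x : g) ⊗ₜ[𝕜] z ∈ G.tp ⊤ (G.minusSpace.symDeg n) := tmul_mem_tp trivial hz
  rw [act_apply, actMap, LinearMap.comp_apply, ev_apply', coeff_zero_bernSeries', one_smul,
    map_add, symAct_minus_tmul, add_sub_cancel_left, map_sum]
  refine Submodule.sum_mem _ fun k _ => ?_
  rw [map_smul]
  refine Submodule.smul_mem _ _ ?_
  rcases lt_or_ge n (k + 1) with hkn | hkn
  · rw [G.shift_pow_zero X d hkn hxz, map_zero]; exact Submodule.zero_mem _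
  · exact symLT_mono (by omega) ((symAct_mem X d lam (n - (k + 1))).1 _ (G.shift_pow_mem X d
      (k := k + 1) (by simp) (by rwa [Nat.sub_add_cancel hkn])))

/-- The failure of the action on `S(g_-)` to be compatible with the bracket, for `x` of parity `a`
and `y` of parity `b`. -/
def curv (a b : ZMod 2) (x y : g) : Module.End 𝕜 G.minusSpace.Sym :=
  act X d lam x * act X d lam y - koszul a b • (act X d lam y * act X d lam x) -
    act X d lam (L.bracket x y)

theorem curv_add_left (a b : ZMod 2) (x x' y : g) :
    curv X d lam a b (x + x') y = curv X d lam a b x y + curv X d lam a b x' y := by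
  simp only [curv, map_add, add_mul, mul_add, smul_add, LinearMap.add_apply]; abel

theorem curv_add_right (a b : ZMod 2) (x y y' : g) :
    curv X d lam a b x (y + y') = curv X d lam a b x y + curv X d lam a b x y' := by
  simp only [curv, map_add, add_mul, mul_add, smul_add]; abel

theorem curv_swap {a b : ZMod 2} {x y : g} (hx : x ∈ L.par a) (hy : y ∈ L.par b) :
    curv X d lam b a y x = -(koszul a b • curv X d lam a b x y) := by
  simp only [curv, L.skew hy hx, smul_sub, map_neg, map_zsmul, koszul_comm b a, smul_smul,
    koszul_mul_self, one_smul]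
  abel

/-- The averaged curvature vanishes. -/
theorem sum_curv_pd (hX : ∀ i, X i ∈ G.minusSpace.par (d i)) {a : ZMod 2} {x : g}
    (hx : x ∈ L.par a) {n : ℕ} {z : G.minusSpace.Sym} (hz : z ∈ G.minusSpace.symDeg n) :
    ∑ i, curv X d lam a (d i) x (X i) (G.minusSpace.pd X d i z) = 0 := by
  have h := average_act X d lam hX n (w := x ⊗ₜ z) (tmul_mem_tp trivial hz)
  rw [average_tmul, shift_tmul, map_sum] at h
  simp only [curv, LinearMap.sub_apply, LinearMap.smul_apply, Module.End.mul_apply,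
    Finset.sum_sub_distrib]
  -- The terms x · (X_i · ∂^i z) add up to n x · z by Euler; the rest is the averaging identity.
  rw [← map_sum, sum_act_pd X d lam hX hz, map_smul]
  have h2 : ∑ i, koszul a (d i) • act X d lam (X i) (act X d lam x (G.minusSpace.pd X d i z)) =
      ∑ i, act X d lam (X i) (actMap X d lam (L.sgn (d i) x ⊗ₜ G.minusSpace.pd X d i z)) := by
    refine Finset.sum_congr rfl fun i _ => ?_
    rw [L.sgn_of_mem _ hx, koszul_comm, ← TensorProduct.smul_tmul', map_zsmul, map_zsmul, act_apply _ _ _ x]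
  rw [h2, h, act_apply]
  simp only [act_apply]
  abel

/-- The Bianchi identity, on an element on which the curvature vanishes. -/
theorem curv_bianchi {a b c : ZMod 2} {x y z : g} (hx : x ∈ L.par a) (hy : y ∈ L.par b)
    (hz : z ∈ L.par c) {q : G.minusSpace.Sym}
    (hq : ∀ a b x y, x ∈ L.par a → y ∈ L.par b → curv X d lam a b x y q = 0) :
    curv X d lam a b x y (act X d lam z q) =
      koszul b c • curv X d lam a c x z (act X d lam y q) -
      (koszul a b * koszul a c) • curv X d lam b c y z (act X d lam x q) := by
  have e : ∀ {a b x y}, x ∈ L.par a → y ∈ L.par b →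
      act X d lam (L.bracket x y) q = act X d lam x (act X d lam y q) -
        koszul a b • act X d lam y (act X d lam x q) := by
    intro a b x y hx hy
    have := hq a b x y hx hy
    simp only [curv, LinearMap.sub_apply, LinearMap.smul_apply, Module.End.mul_apply] at this
    exact (sub_eq_zero.mp this).symm
  have hj := congrArg (fun t => act X d lam t q) (L.jacobi z hx hy)
  simp only [map_add, map_zsmul, LinearMap.add_apply, LinearMap.smul_apply] at hj
  -- The Jacobi identity is applied to `q`, where all brackets act as supercommutators. Brackets
  -- acting on vectors such as y · q stay unexpanded and form the three curvatures.
  rw [e hx (L.bracket_mem hy hz), e (L.bracket_mem hx hy) hz, e hy (L.bracket_mem hx hz),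
    e hy hz, e hx hz, e hx hy] at hj
  simp only [curv, LinearMap.sub_apply, LinearMap.smul_apply, Module.End.mul_apply,
    koszul_add_right, koszul_add_left, koszul_comm b a, map_sub, map_zsmul, smul_sub,
    smul_smul] at hj ⊢
  have hs : ∀ s t : ZMod 2, koszul s t = 1 ∨ koszul s t = -1 := by unfold koszul; decide
  rw [← sub_eq_zero] at hj ⊢
  rw [← hj]
  rcases hs a b with h1 | h1 <;> rcases hs a c with h2 | h2 <;> rcases hs b c with h3 | h3 <;>
    simp only [h1, h2, h3, one_smul, neg_smul, mul_one, mul_neg, neg_neg] <;>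
    abel

omit [FiniteDimensional 𝕜 g] [CharZero 𝕜] in
theorem coe_toMinus_mem_par {a : ZMod 2} {x : g} (hx : x ∈ L.par a) :
    (G.toMinus x : g) ∈ L.par a := by
  have h1 : L.proj a (G.toMinus x) ∈ G.minus := G.proj_mem_iSup _ a _ (G.toMinus x).2
  have h2 : L.proj a (G.projNonneg x) ∈ G.nonneg := G.proj_mem_iSup _ a _ (G.projNonneg_mem x)
  have h3 : G.toMinus x = G.toMinus (L.proj a (G.toMinus x) + L.proj a (G.projNonneg x)) := by
    rw [← map_add, G.toMinus_add_projNonneg, L.proj_of_mem hx]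
  rw [map_add, G.toMinus_of_nonneg h2, add_zero] at h3
  rw [h3, G.toMinus_of_mem_minus h1]
  exact L.toSuperSpace.proj_mem a _

omit [FiniteDimensional 𝕜 g] [CharZero 𝕜] in
theorem projNonneg_mem_par {a : ZMod 2} {x : g} (hx : x ∈ L.par a) :
    G.projNonneg x ∈ L.par a :=
  Submodule.sub_mem _ hx (coe_toMinus_mem_par hx)

theorem curv_symLT {n : ℕ} (h : ∀ m < n, ∀ a b x y, x ∈ L.par a → y ∈ L.par b →
      ∀ z ∈ G.minusSpace.symDeg m, curv X d lam a b x y z = 0) {a b : ZMod 2} {x y : g}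
    (hx : x ∈ L.par a) (hy : y ∈ L.par b) {z : G.minusSpace.Sym} (hz : z ∈ G.symLT n) :
    curv X d lam a b x y z = 0 := by
  have : G.symLT n ≤ LinearMap.ker (curv X d lam a b x y) :=
    iSup_le fun m z hz => h m m.2 a b x y hx hy z hz
  exact this hz

/-- The sum of the curvatures with one argument differentiated, for `y` in `g_-`. -/
theorem sum_curv_minus (hX : ∀ i, X i ∈ G.minusSpace.par (d i)) {n : ℕ}
    (h : ∀ m < n, ∀ a b x y, x ∈ L.par a → y ∈ L.par b →
      ∀ z ∈ G.minusSpace.symDeg m, curv X d lam a b x y z = 0) {a b : ZMod 2} {x : g}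
    (y : G.minus) (hx : x ∈ L.par a) (hy : (y : g) ∈ L.par b) {z : G.minusSpace.Sym}
    (hz : z ∈ G.minusSpace.symDeg n) :
    ∑ i, koszul b (d i) • curv X d lam a (d i) x (X i) (act X d lam y (G.minusSpace.pd X d i z)) =
      -curv X d lam a b x y z := by
  have hy' : y ∈ G.minusSpace.par b := hy
  have h1 := sum_curv_pd X d lam hX hx (G.minusSpace.ι_mul_mem_symDeg y hz)
  -- Acting by `y` and multiplying by `y` differ on ∂^i z by terms of degree below `n`, which the
  -- curvature kills by hypothesis.
  have h2 : ∀ i, curv X d lam a (d i) x (X i) (act X d lam y (G.minusSpace.pd X d i z)) =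
      curv X d lam a (d i) x (X i) (G.minusSpace.ι y * G.minusSpace.pd X d i z) := by
    intro i
    rw [← sub_eq_zero, ← map_sub]
    cases n with
    | zero => simp [G.minusSpace.pd_symDeg_zero X d i hz]
    | succ n =>
      exact curv_symLT X d lam h hx (hX i)
        (act_minus_sub_mem X d lam y (G.minusSpace.pd_mem_symDeg X d i hz))
  have h3 : ∑ i, curv X d lam a (d i) x (X i) (X.coord i y • z) = curv X d lam a b x y z := by
    -- The coordinate is zero unless X_i has the parity of `y`. So the parity label can be fixed as
    -- `b`, which makes the curvature linear in its second argument.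
    have hc : ∀ i, curv X d lam a (d i) x (X i) (X.coord i y • z) =
        X.coord i y • curv X d lam a b x (X i) z := by
      intro i
      by_cases hi : d i = b
      · rw [map_smul, hi]
      · rw [← G.minusSpace.coord_proj X d hX, G.minusSpace.proj_of_mem_ne hy' hi]; simp
    let A : g →ₗ[𝕜] Module.End 𝕜 G.minusSpace.Sym :=
      { toFun := fun y => curv X d lam a b x y
        map_add' := fun y y' => curv_add_right X d lam a b x y y'
        map_smul' := fun c y => by
          simp only [curv, map_smul, mul_smul_comm, smul_mul_assoc, RingHom.id_apply, smul_sub]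
          rw [smul_comm c] }
    have := G.sum_coord_apply X A y z
    simp only [map_smul] at this
    simp only [hc]
    exact this
  simp only [G.minusSpace.pd_ι_mul X d _ hy', G.minusSpace.coord_proj X d hX, map_add,
    Finset.sum_add_distrib, h3, map_zsmul] at h1
  simp only [h2]
  simp only [koszul_comm b]
  exact eq_neg_of_add_eq_zero_right h1

/-- Elements of k do not raise the degree, so all vectors fed to the curvature have degree below
`n`. -/
theorem sum_curv_nonneg (hX : ∀ i, X i ∈ G.minusSpace.par (d i)) {n : ℕ}
    (h : ∀ m < n, ∀ a b x y, x ∈ L.par a → y ∈ L.par b →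
      ∀ z ∈ G.minusSpace.symDeg m, curv X d lam a b x y z = 0) {a b : ZMod 2} {x y : g}
    (hx : x ∈ L.par a) (hy : y ∈ G.nonneg) {z : G.minusSpace.Sym}
    (hz : z ∈ G.minusSpace.symDeg n) :
    ∑ i, koszul b (d i) • curv X d lam a (d i) x (X i) (act X d lam y (G.minusSpace.pd X d i z)) =
      0 := by
  refine Finset.sum_eq_zero fun i _ => ?_
  cases n with
  | zero => simp [G.minusSpace.pd_symDeg_zero X d i hz]
  | succ n =>
    have hi : (X i : g) ∈ L.par (d i) := hX i
    rw [curv_symLT X d lam h hx hi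
      (act_nonneg_mem X d lam hy (G.minusSpace.pd_mem_symDeg X d i hz)), smul_zero]

theorem act_nonneg_one {x : g} (hx : x ∈ G.nonneg) : act X d lam x 1 = lam.ext x • 1 := by
  rw [act_apply, actMap_nonneg X d lam (tmul_mem_tp hx trivial), lamMap_tmul,
    G.shift_zero X d (tmul_mem_tp trivial G.minusSpace.one_mem_symDeg), map_zero, add_zero]

/-- The action of `g` on `S(g_-)` is compatible with the bracket, in each degree. -/
theorem curv_symDeg (hX : ∀ i, X i ∈ G.minusSpace.par (d i)) (n : ℕ) :
    ∀ a b x y, x ∈ L.par a → y ∈ L.par b →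
      ∀ z ∈ G.minusSpace.symDeg n, curv X d lam a b x y z = 0 := by
  induction n using Nat.strong_induction_on with
  | _ n ih =>
    -- Bianchi with third argument X_i at ∂^i z, where the curvature already vanishes; summing over
    -- `i` turns the left side into `n` times the curvature by Euler.
    have main : ∀ a b x y, x ∈ L.par a → y ∈ L.par b → ∀ z ∈ G.minusSpace.symDeg n,
        (n : 𝕜) • curv X d lam a b x y z =
        ∑ i, koszul b (d i) •
          curv X d lam a (d i) x (X i) (act X d lam y (G.minusSpace.pd X d i z)) -
        koszul a b • ∑ i, koszul a (d i) •
          curv X d lam b (d i) y (X i) (act X d lam x (G.minusSpace.pd X d i z)) := by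
      intro a b x y hx hy z hz
      rw [← map_smul, ← sum_act_pd X d lam hX hz, map_sum, Finset.smul_sum,
        ← Finset.sum_sub_distrib]
      refine Finset.sum_congr rfl fun i _ => ?_
      rw [smul_smul]
      refine curv_bianchi X d lam hx hy (hX i) fun a b x y hx hy => ?_
      cases n with
      | zero => rw [G.minusSpace.pd_symDeg_zero X d i hz, map_zero]
      | succ n => exact ih n n.lt_succ_self a b x y hx hy _ (G.minusSpace.pd_mem_symDeg X d i hz)
    have key : ∀ (c : ℕ) (v : G.minusSpace.Sym), (n : 𝕜) • v = -((c : 𝕜) • v) → n + c ≠ 0 →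
        v = 0 := by
      intro c v hv hc
      rw [eq_neg_iff_add_eq_zero, ← add_smul, ← Nat.cast_add] at hv
      exact (smul_eq_zero.mp hv).resolve_left (Nat.cast_ne_zero.mpr hc)
    have hsw : ∀ {a b x y}, x ∈ L.par a → y ∈ L.par b → ∀ z : G.minusSpace.Sym,
        koszul a b • -curv X d lam b a y x z = curv X d lam a b x y z := by
      intro a b x y hx hy z
      rw [curv_swap X d lam hx hy, LinearMap.neg_apply, neg_neg, LinearMap.smul_apply, smul_smul,
        koszul_mul_self, one_smul]
    intro a b x y hx hy z hz
    rw [← G.toMinus_add_projNonneg x, ← G.toMinus_add_projNonneg y, curv_add_left,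
      curv_add_right, curv_add_right]
    have hx1 := coe_toMinus_mem_par (G := G) hx
    have hx2 := projNonneg_mem_par (G := G) hx
    have hy1 := coe_toMinus_mem_par (G := G) hy
    have hy2 := projNonneg_mem_par (G := G) hy
    have hxk := G.projNonneg_mem x
    have hyk := G.projNonneg_mem y
    -- Each argument in g_- contributes one negative copy of the curvature, so the factor is 2 here,
    -- 1 in the mixed cases and 0 for two arguments in k.
    have e1 : curv X d lam a b (G.toMinus x) (G.toMinus y) z = 0 := by
      refine key 2 _ ?_ (by omega)
      rw [main _ _ _ _ hx1 hy1 z hz, sum_curv_minus X d lam hX ih _ hx1 hy1 hz,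
        sum_curv_minus X d lam hX ih _ hy1 hx1 hz, hsw hx1 hy1, Nat.cast_two, two_smul, neg_add,
        sub_eq_add_neg]
    have e2 : curv X d lam a b (G.toMinus x) (G.projNonneg y) z = 0 := by
      refine key 1 _ ?_ (by omega)
      rw [main _ _ _ _ hx1 hy2 z hz, sum_curv_nonneg X d lam hX ih hx1 hyk hz,
        sum_curv_minus X d lam hX ih _ hy2 hx1 hz, hsw hx1 hy2, Nat.cast_one, one_smul, zero_sub]
    have e3 : curv X d lam a b (G.projNonneg x) (G.toMinus y) z = 0 := by
      refine key 1 _ ?_ (by omega)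
      rw [main _ _ _ _ hx2 hy1 z hz, sum_curv_minus X d lam hX ih _ hx2 hy1 hz,
        sum_curv_nonneg X d lam hX ih hy1 hxk hz, smul_zero, Nat.cast_one, one_smul, sub_zero]
    have e4 : curv X d lam a b (G.projNonneg x) (G.projNonneg y) z = 0 := by
      -- In degree zero the relation is empty for two arguments in k. They act on constants by
      -- scalars, which supercommute because λ is even and kills brackets.
      rcases Nat.eq_zero_or_pos n with rfl | hn
      · obtain ⟨c, rfl⟩ := G.minusSpace.mem_symDeg_zero hz
        rw [map_smul]
        have hb := G.nonneg_bracket _ hxk _ hyk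
        simp only [curv, LinearMap.sub_apply, LinearMap.smul_apply, Module.End.mul_apply,
          act_nonneg_one X d lam hxk, act_nonneg_one X d lam hyk, act_nonneg_one X d lam hb,
          map_smul, lam.ext_bracket hxk hyk, zero_smul, sub_zero]
        by_cases h : a = 1 ∧ b = 1
        · rw [lam.ext_odd hxk (h.1 ▸ hx2)]; simp
        · rw [koszul, if_neg h, one_smul, smul_comm, sub_self, smul_zero]
      · refine key 0 _ ?_ (by omega)
        rw [main _ _ _ _ hx2 hy2 z hz, sum_curv_nonneg X d lam hX ih hx2 hyk hz,
          sum_curv_nonneg X d lam hX ih hy2 hxk hz]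
        simp
    simp only [LinearMap.add_apply, e1, e2, e3, e4, add_zero]

theorem act_mul_act (hX : ∀ i, X i ∈ G.minusSpace.par (d i)) ⦃a b : ZMod 2⦄ ⦃x y : g⦄
    (hx : x ∈ L.par a) (hy : y ∈ L.par b) : act X d lam x * act X d lam y =
      koszul a b • (act X d lam y * act X d lam x) + act X d lam (L.bracket x y) := by
  have : curv X d lam a b x y = 0 :=
    G.minusSpace.sym_linearMap_ext fun n z hz => by
      rw [curv_symDeg X d lam hX n a b x y hx hy z hz, LinearMap.zero_apply]
  rw [curv, sub_sub, sub_eq_zero] at this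
  exact this

end ZGrading

end LieSuperalgebra

/-! ### The enveloping algebra and bijectivity of the map to the Verma module -/

namespace LieSuperalgebra

variable {𝕜 : Type u} {g : Type v} [Field 𝕜] [AddCommGroup g] [Module 𝕜 g]

section Env

variable (L : LieSuperalgebra 𝕜 g)

theorem envLift_envι {A : Type w} [Ring A] [Algebra 𝕜 A] (f : g →ₗ[𝕜] A)
    (hf : ∀ ⦃a b : ZMod 2⦄ ⦃x y : g⦄, x ∈ L.par a → y ∈ L.par b →
      f x * f y = koszul a b • (f y * f x) + f (L.bracket x y)) (x : g) :
    L.envLift f hf (L.envι x) = f x := by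
  have h := RingQuot.liftAlgHom_mkAlgHom_apply 𝕜 (TensorAlgebra.lift 𝕜 f)
    (s := L.EnvRel) (by rintro _ _ ⟨hx, hy⟩; simpa using hf hx hy) (TensorAlgebra.ι 𝕜 x)
  rw [TensorAlgebra.lift_ι_apply] at h
  exact h

theorem env_induction {p : L.Env → Prop} (h1 : ∀ r, p (algebraMap 𝕜 L.Env r))
    (hι : ∀ x, p (L.envι x)) (hadd : ∀ x y, p x → p y → p (x + y))
    (hmul : ∀ x y, p x → p y → p (x * y)) (z : L.Env) : p z := by
  obtain ⟨t, rfl⟩ : ∃ t, L.envMk t = z := RingQuot.mkAlgHom_surjective 𝕜 L.EnvRel z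
  induction t using TensorAlgebra.induction with
  | algebraMap r => rw [AlgHom.commutes]; exact h1 r
  | ι x => exact hι x
  | mul s t hs ht => rw [map_mul]; exact hmul _ _ hs ht
  | add s t hs ht => rw [map_add]; exact hadd _ _ hs ht

end Env

variable {L : LieSuperalgebra 𝕜 g}

namespace ZGrading

variable {G : L.ZGrading}

theorem Character.envIncl_envι (x : G.nonneg) :
    Character.envIncl G (G.nonnegAlgebra.envι x) = L.envι x :=
  envLift_envι _ _ _ x

theorem Character.envChar_envι (lam : G.Character) (x : G.nonneg) :
    lam.envChar (G.nonnegAlgebra.envι x) = lam.ext x :=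
  envLift_envι _ _ _ x

variable {I : Type*} [Fintype I] (X : Module.Basis I 𝕜 G.minus) (d : I → ZMod 2)
variable (lam : G.Character) (hX : ∀ i, X i ∈ G.minusSpace.par (d i))

theorem tmul_mem_tp_top (x : g) {U : Submodule 𝕜 G.minusSpace.Sym} {z : G.minusSpace.Sym}
    (hz : z ∈ U) : x ⊗ₜ[𝕜] z ∈ G.tp ⊤ U := tmul_mem_tp trivial hz

theorem tensor_linearMap_ext {M : Type*} [AddCommGroup M] [Module 𝕜 M]
    {f f' : g ⊗[𝕜] G.minusSpace.Sym →ₗ[𝕜] M}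
    (hm : ∀ x ∈ G.minus, ∀ n, ∀ z ∈ G.minusSpace.symDeg n, f (x ⊗ₜ z) = f' (x ⊗ₜ z))
    (hk : ∀ x ∈ G.nonneg, ∀ n, ∀ z ∈ G.minusSpace.symDeg n, f (x ⊗ₜ z) = f' (x ⊗ₜ z)) :
    f = f' := by
  refine TensorProduct.ext (LinearMap.ext fun x => ?_)
  refine G.minusSpace.sym_linearMap_ext fun n z hz => ?_
  exact G.mem_tp_cases (fun x hx z hz => hm x hx n z hz) (fun x hx z hz => hk x hx n z hz)
    (tmul_mem_tp trivial hz)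

/-! ### Injectivity -/

section Injectivity

variable [FiniteDimensional 𝕜 g] [CharZero 𝕜]

/-- The action of `U(g)` on `S(g_-)`. -/
def envAct : L.Env →ₐ[𝕜] Module.End 𝕜 G.minusSpace.Sym :=
  L.envLift (act X d lam) (act_mul_act X d lam hX)

theorem envAct_envι (x : g) : envAct X d lam hX (L.envι x) = act X d lam x :=
  envLift_envι _ _ _ x

theorem envAct_envIncl (z : G.nonnegAlgebra.Env) :
    envAct X d lam hX (Character.envIncl G z) 1 = lam.envChar z • 1 := by
  induction z using G.nonnegAlgebra.env_induction with
  | h1 r =>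
    rw [AlgHom.commutes, AlgHom.commutes, AlgHom.commutes, Module.algebraMap_end_apply]
    rfl
  | hι x =>
    rw [Character.envIncl_envι, envAct_envι, act_nonneg_one X d lam x.2, lam.envChar_envι]
  | hadd x y hx hy => simp only [map_add, LinearMap.add_apply, hx, hy, add_smul]
  | hmul x y hx hy =>
    simp only [map_mul, Module.End.mul_apply, hy, map_smul, hx, smul_smul]
    rw [mul_comm]

/-- The map `u ⊗ c ↦ c u 1` from `U(g) ⊗ 𝕜` to `S(g_-)`. -/
def evalOne : L.Env ⊗[𝕜] 𝕜 →ₗ[𝕜] G.minusSpace.Sym :=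
  LinearMap.applyₗ 1 ∘ₗ (envAct X d lam hX).toLinearMap ∘ₗ
    (TensorProduct.rid 𝕜 L.Env).toLinearMap

theorem evalOne_tmul (u : L.Env) (c : 𝕜) :
    evalOne X d lam hX (u ⊗ₜ c) = c • envAct X d lam hX u 1 := by
  simp [evalOne]

theorem evalOne_smul (u : L.Env) (t : L.Env ⊗[𝕜] 𝕜) :
    evalOne X d lam hX (u • t) = envAct X d lam hX u (evalOne X d lam hX t) := by
  induction t using TensorProduct.induction_on with
  | zero => simp
  | tmul v c =>
    rw [TensorProduct.smul_tmul', evalOne_tmul, evalOne_tmul, (envAct X d lam hX u).map_smul,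
      smul_eq_mul, map_mul, Module.End.mul_apply]
  | add s t hs ht => rw [smul_add, map_add, map_add, hs, ht, map_add]

theorem evalOne_balanced {t : L.Env ⊗[𝕜] 𝕜} (ht : t ∈ lam.balanced) :
    evalOne X d lam hX t = 0 := by
  refine Submodule.span_induction (p := fun t _ => evalOne X d lam hX t = 0) ?_ ?_ ?_ ?_ ht
  · rintro _ ⟨u, z, c, rfl⟩
    rw [map_sub, evalOne_tmul, evalOne_tmul, map_mul, Module.End.mul_apply, envAct_envIncl,
      map_smul, smul_smul, mul_comm c, sub_self]
  · simp
  · intro x y _ _ hx hy; rw [map_add, hx, hy, add_zero]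
  · intro u x _ hx; rw [evalOne_smul, hx, map_zero]

/-- Both sides satisfy the same recursion in the degree, `sum_mul_symmetrise_pd` for the
symmetrisation and Euler's identity for the action. -/
theorem envAct_symmetrise (z : G.minusSpace.Sym) :
    envAct X d lam hX (G.minusSpace.symmetrise (L.envι ∘ₗ G.minus.subtype) z) 1 = z := by
  suffices h : LinearMap.applyₗ 1 ∘ₗ (envAct X d lam hX).toLinearMap ∘ₗ
      G.minusSpace.symmetrise (L.envι ∘ₗ G.minus.subtype) = LinearMap.id from
    LinearMap.congr_fun h z
  refine G.minusSpace.sym_linearMap_ext fun n => ?_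
  induction n with
  | zero =>
    intro z hz
    obtain ⟨c, rfl⟩ := G.minusSpace.mem_symDeg_zero hz
    simp [SuperSpace.symmetrise_one]
  | succ n ih =>
    intro z hz
    have h := congrArg (fun u => envAct X d lam hX u 1)
      (G.minusSpace.sum_mul_symmetrise_pd X d hX (L.envι ∘ₗ G.minus.subtype) hz)
    simp only [map_sum, map_mul, map_smul, LinearMap.sum_apply, Module.End.mul_apply,
      LinearMap.smul_apply, LinearMap.comp_apply, Submodule.subtype_apply, envAct_envι] at h
    have hn : ((n + 1 : ℕ) : 𝕜) ≠ 0 := Nat.cast_ne_zero.mpr n.succ_ne_zero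
    refine smul_right_injective _ hn ?_
    change ((n + 1 : ℕ) : 𝕜) • envAct X d lam hX _ 1 = ((n + 1 : ℕ) : 𝕜) • z
    rw [← h, ← sum_act_pd X d lam hX hz]
    refine Finset.sum_congr rfl fun i _ => ?_
    congr 1
    exact ih _ (G.minusSpace.pd_mem_symDeg X d i hz)

omit [FiniteDimensional 𝕜 g] [CharZero 𝕜] in
theorem Character.vermaMap_apply (lam : G.Character) (z : G.minusSpace.Sym) : lam.vermaMap z =
    lam.balanced.mkQ (G.minusSpace.symmetrise (L.envι ∘ₗ G.minus.subtype) z ⊗ₜ 1) := rfl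

include hX in
-- Evaluation of U(g) at 1 kills the balancing relations, and by `envAct_symmetrise` it is a left
-- inverse.
theorem vermaMap_injective : Function.Injective lam.vermaMap := by
  rw [← LinearMap.ker_eq_bot, LinearMap.ker_eq_bot']
  intro z hz
  rw [Character.vermaMap_apply, Submodule.mkQ_apply, Submodule.Quotient.mk_eq_zero] at hz
  have h := evalOne_balanced X d lam hX hz
  rwa [evalOne_tmul, one_smul, envAct_symmetrise] at h

end Injectivity

/-! ### The action on the parabolic Verma module -/

/-- The action of `g` on the parabolic Verma module. -/
def vermaAct : g →ₗ[𝕜] Module.End 𝕜 lam.Verma :=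
  (Algebra.lsmul 𝕜 𝕜 lam.Verma).toLinearMap ∘ₗ L.envι

theorem vermaAct_apply (x : g) (v : lam.Verma) : vermaAct lam x v = L.envι x • v := rfl

theorem vermaAct_mul {a b : ZMod 2} {x y : g} (hx : x ∈ L.par a) (hy : y ∈ L.par b) :
    vermaAct lam x * vermaAct lam y = koszul a b • (vermaAct lam y * vermaAct lam x) +
      vermaAct lam (L.bracket x y) := by
  have h := congrArg (Algebra.lsmul 𝕜 𝕜 lam.Verma) (L.envι_mul_envι hx hy)
  simp only [map_mul, map_add, map_zsmul] at h
  exact h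

theorem mkQ_tmul (u : L.Env) (c : 𝕜) :
    lam.balanced.mkQ (u ⊗ₜ c) = c • u • lam.vermaMap 1 := by
  have h1 : u ⊗ₜ[𝕜] c = c • (u ⊗ₜ[𝕜] (1 : 𝕜)) := by
    rw [← TensorProduct.tmul_smul, smul_eq_mul, mul_one]
  have h2 : u ⊗ₜ[𝕜] (1 : 𝕜) = u • ((1 : L.Env) ⊗ₜ[𝕜] (1 : 𝕜)) := by
    rw [TensorProduct.smul_tmul', smul_eq_mul, mul_one]
  have h3 := (lam.balanced.mkQ.restrictScalars 𝕜).map_smul c (u ⊗ₜ[𝕜] (1 : 𝕜))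
  rw [LinearMap.restrictScalars_apply, LinearMap.restrictScalars_apply] at h3
  rw [h1, h3, h2, map_smul, Character.vermaMap_apply, SuperSpace.symmetrise_one]

theorem vermaAct_nonneg {x : g} (hx : x ∈ G.nonneg) :
    vermaAct lam x (lam.vermaMap 1) = lam.ext x • lam.vermaMap 1 := by
  have h : (1 * Character.envIncl G (G.nonnegAlgebra.envι ⟨x, hx⟩)) ⊗ₜ[𝕜] (1 : 𝕜) -
      1 ⊗ₜ[𝕜] (lam.envChar (G.nonnegAlgebra.envι ⟨x, hx⟩) * 1) ∈ lam.balanced :=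
    Submodule.subset_span ⟨_, _, _, rfl⟩
  rw [Character.envIncl_envι, lam.envChar_envι, one_mul, mul_one] at h
  have h2 := (Submodule.Quotient.eq _).mpr h
  change lam.balanced.mkQ _ = lam.balanced.mkQ _ at h2
  rwa [mkQ_tmul, mkQ_tmul, one_smul, one_smul] at h2

/-- The map `x ⊗ z ↦ x Φ(z)`, where `Φ` is the map from `S(g_-)` to the Verma module. -/
def vermaActMap : g ⊗[𝕜] G.minusSpace.Sym →ₗ[𝕜] lam.Verma :=
  TensorProduct.lift (LinearMap.lcomp 𝕜 lam.Verma lam.vermaMap ∘ₗ vermaAct lam)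

theorem vermaActMap_tmul (x : g) (z : G.minusSpace.Sym) :
    vermaActMap lam (x ⊗ₜ z) = vermaAct lam x (lam.vermaMap z) := by
  simp [vermaActMap]

variable [CharZero 𝕜]

include hX in
theorem sum_vermaAct_pd {n : ℕ} {z : G.minusSpace.Sym} (hz : z ∈ G.minusSpace.symDeg n) :
    ∑ i, vermaAct lam (X i) (lam.vermaMap (G.minusSpace.pd X d i z)) =
      (n : 𝕜) • lam.vermaMap z := by
  have h := congrArg (fun u => lam.balanced.mkQ (u ⊗ₜ (1 : 𝕜)))
    (G.minusSpace.sum_mul_symmetrise_pd X d hX (L.envι ∘ₗ G.minus.subtype) hz)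
  simp only [TensorProduct.sum_tmul, map_sum] at h
  rw [← map_smul, Character.vermaMap_apply, map_smul, ← h]
  refine Finset.sum_congr rfl fun i _ => ?_
  rw [vermaAct_apply, Character.vermaMap_apply, ← map_smul, TensorProduct.smul_tmul', smul_eq_mul]
  rfl

include hX in
-- In an actual module ± X_i x = x X_i - [x, X_i]; the first terms sum to n x Φ(z) by Euler and the
-- second give the shift.
theorem average_vermaAct {n : ℕ} {w : g ⊗[𝕜] G.minusSpace.Sym}
    (hw : w ∈ G.tp ⊤ (G.minusSpace.symDeg n)) :
    G.average X d (fun i => vermaAct lam (X i)) (vermaActMap lam) w =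
      (n : 𝕜) • vermaActMap lam w - vermaActMap lam (G.shift X d w) := by
  refine G.mem_tp_eq (f := G.average X d (fun i => vermaAct lam (X i)) (vermaActMap lam))
    (f' := (n : 𝕜) • vermaActMap lam - vermaActMap lam ∘ₗ G.shift X d) (fun x _ z hz => ?_) hw
  suffices H : ∀ a, ∀ x ∈ L.par a,
      G.average X d (fun i => vermaAct lam (X i)) (vermaActMap lam) (x ⊗ₜ z) =
      ((n : 𝕜) • vermaActMap lam - vermaActMap lam ∘ₗ G.shift X d) (x ⊗ₜ z) by
    rw [← L.proj_zero_add_proj_one x, TensorProduct.add_tmul, map_add, map_add,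
      H 0 _ (L.toSuperSpace.proj_mem 0 x), H 1 _ (L.toSuperSpace.proj_mem 1 x)]
  intro a x hx
  rw [average_tmul, LinearMap.sub_apply, LinearMap.smul_apply, LinearMap.comp_apply, shift_tmul,
    map_sum, vermaActMap_tmul, ← map_smul, ← sum_vermaAct_pd X d lam hX hz, map_sum,
    ← Finset.sum_sub_distrib]
  refine Finset.sum_congr rfl fun i _ => ?_
  have hi : (X i : g) ∈ L.par (d i) := hX i
  have h := LinearMap.congr_fun (vermaAct_mul lam hx hi)
    (lam.vermaMap (G.minusSpace.pd X d i z))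
  simp only [Module.End.mul_apply, LinearMap.add_apply, LinearMap.smul_apply] at h
  rw [h, vermaActMap_tmul, vermaActMap_tmul, add_sub_cancel_right, L.sgn_of_mem _ hx, map_zsmul,
    LinearMap.smul_apply, map_zsmul, koszul_comm]

variable [FiniteDimensional 𝕜 g]

include hX in
theorem average_vermaAct_symSeries {n : ℕ} {w : g ⊗[𝕜] G.minusSpace.Sym}
    (hw : w ∈ G.tp ⊤ (G.minusSpace.symDeg n)) :
    G.average X d (fun i => vermaAct lam (X i)) (vermaActMap lam)
      (G.ev X d (symSeries 𝕜) w) =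
      ((n : 𝕜) + 1) • vermaActMap lam (G.ev X d (symSeries 𝕜) w) - vermaActMap lam w := by
  rw [G.average_ev_symSeries X d _ _ (n : 𝕜), Finset.sum_eq_zero, add_zero]
  intro k _
  rcases lt_or_ge n k with h | h
  · rw [pow_succ', Module.End.mul_apply, G.shift_pow_zero X d h hw]; simp
  · rw [average_vermaAct X d lam hX (n := n - k)
      (G.shift_pow_mem X d (by simp) (by rwa [Nat.sub_add_cancel h])),
      pow_succ', Module.End.mul_apply, Nat.cast_sub h, sub_self, smul_zero]

/-- Symmetrised multiplication by elements of `g` on the parabolic Verma module. -/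
def vermaSym : g ⊗[𝕜] G.minusSpace.Sym →ₗ[𝕜] lam.Verma :=
  vermaActMap lam ∘ₗ G.ev X d (symSeries 𝕜)

include hX in
-- By averaging in degree n and Euler for x z in degree n + 1, both sides satisfy the same
-- recursion: n + 1 times either one is x Φ(z) plus the sum of X_i applied to the same expression
-- with derivatives of z.
theorem vermaSym_minus (n : ℕ) {x : g} (hx : x ∈ G.minus) {z : G.minusSpace.Sym}
    (hz : z ∈ G.minusSpace.symDeg n) :
    vermaSym X d lam (x ⊗ₜ z) = lam.vermaMap (G.minusSpace.ι ⟨x, hx⟩ * z) := by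
  induction n generalizing x z with
  | zero =>
    have hs := G.shift_zero X d (tmul_mem_tp_top x hz)
    have h := sum_vermaAct_pd X d lam hX (G.minusSpace.ι_mul_mem_symDeg ⟨x, hx⟩ hz)
    simp only [G.minusSpace.pd_ι_mul' X d hX, G.minusSpace.pd_symDeg_zero X d _ hz, mul_zero,
      add_zero] at h
    simp only [map_smul lam.vermaMap] at h
    rw [G.sum_coord_apply X (vermaAct lam) ⟨x, hx⟩] at h
    rw [vermaSym, LinearMap.comp_apply, ev_of_shift_eq_zero _ _ _ _ hs, coeff_zero_symSeries,
      one_smul, vermaActMap_tmul, h]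
    simp
  | succ n ih =>
    have h := sum_vermaAct_pd X d lam hX (G.minusSpace.ι_mul_mem_symDeg ⟨x, hx⟩ hz)
    simp only [G.minusSpace.pd_ι_mul' X d hX, map_add, map_smul lam.vermaMap,
      Finset.sum_add_distrib] at h
    rw [G.sum_coord_apply X (vermaAct lam) ⟨x, hx⟩] at h
    have h2 := average_vermaAct_symSeries X d lam hX
      (tmul_mem_tp_top x hz)
    rw [G.average_ev X d hX, average_tmul, vermaActMap_tmul, eq_sub_iff_add_eq'] at h2
    have h3 : ∀ i, (vermaActMap lam ∘ₗ G.ev X d (symSeries 𝕜))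
        (L.sgn (d i) x ⊗ₜ G.minusSpace.pd X d i z) = lam.vermaMap
          (G.minusSpace.ι (G.minusSpace.sgn (d i) ⟨x, hx⟩) * G.minusSpace.pd X d i z) := by
      intro i
      rw [← G.coe_sgn (d i) ⟨x, hx⟩]
      exact ih (G.minusSpace.sgn (d i) ⟨x, hx⟩).2 (G.minusSpace.pd_mem_symDeg X d i hz)
    simp only [h3] at h2
    rw [h2, ← Nat.cast_succ] at h
    exact smul_right_injective _ (Nat.cast_ne_zero.mpr (Nat.succ_ne_zero (n + 1))) h

include hX in
-- The averaging identity expresses (n + 1) x Φ(z) through the derivatives of z. Inserting the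
-- induction hypothesis, the λ parts add up by Euler, and the symmetrised parts are an average at
-- the shifted tensor, whose extra term cancels.
theorem vermaActMap_nonneg (n : ℕ) {x : g} (hx : x ∈ G.nonneg) {z : G.minusSpace.Sym}
    (hz : z ∈ G.minusSpace.symDeg n) : vermaActMap lam (x ⊗ₜ z) =
      lam.ext x • lam.vermaMap z + vermaSym X d lam (G.shift X d (x ⊗ₜ z)) := by
  have hxz := tmul_mem_tp_top x hz
  induction n generalizing x z with
  | zero =>
    rw [G.shift_zero X d hxz, map_zero, add_zero, vermaActMap_tmul]
    obtain ⟨c, rfl⟩ := G.minusSpace.mem_symDeg_zero hz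
    rw [map_smul, map_smul, vermaAct_nonneg lam hx, smul_comm]
  | succ n ih =>
    have h := average_vermaAct X d lam hX hxz
    have h2 := average_vermaAct_symSeries X d lam hX (G.shift_mem_succ X d (by simp) hxz)
    rw [G.average_ev X d hX] at h2
    change G.average X d _ (vermaSym X d lam) _ = _ • vermaSym X d lam _ - _ at h2
    rw [← G.average_comp X d _ _ (G.signedPd_shift X d hX), average_tmul] at h2
    have h3 := sum_vermaAct_pd X d lam hX hz
    have h4 : ∀ i, vermaActMap lam (L.sgn (d i) x ⊗ₜ G.minusSpace.pd X d i z) =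
        lam.ext x • lam.vermaMap (G.minusSpace.pd X d i z) + (vermaSym X d lam ∘ₗ G.shift X d)
          (L.sgn (d i) x ⊗ₜ G.minusSpace.pd X d i z) := by
      intro i
      have hz' := G.minusSpace.pd_mem_symDeg X d i hz
      rw [ih (G.sgn_mem_nonneg _ hx) hz' (tmul_mem_tp_top _ hz'), lam.ext_sgn _ hx]
      rfl
    rw [average_tmul] at h
    simp only [h4, map_add, Finset.sum_add_distrib, map_smul, ← Finset.smul_sum, h3] at h
    rw [h2] at h
    refine smul_right_injective _ (Nat.cast_ne_zero.mpr n.succ_ne_zero : ((n + 1 : ℕ) : 𝕜) ≠ 0) ?_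
    change ((n + 1 : ℕ) : 𝕜) • vermaActMap lam (x ⊗ₜ[𝕜] z) = ((n + 1 : ℕ) : 𝕜) • _
    rw [eq_sub_iff_add_eq] at h
    rw [← h, Nat.cast_succ]
    module

include hX in
-- The symmetrised product in the Verma module obeys the two conditions that define Q; inverting
-- `straighten` identifies it with Φ ∘ Q.
theorem vermaSym_comp_straighten :
    vermaSym X d lam ∘ₗ G.straighten X d = lam.vermaMap ∘ₗ (G.mulMap + lamMap lam) := by
  refine tensor_linearMap_ext (fun x hx n z hz => ?_) (fun x hx n z hz => ?_)
  · rw [LinearMap.comp_apply, straighten_minus X d (tmul_mem_tp hx trivial),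
      vermaSym_minus X d lam hX n hx hz, LinearMap.comp_apply, LinearMap.add_apply, mulMap_tmul,
      lamMap_tmul, lam.ext_minus hx, zero_smul, add_zero, G.toMinus_of_mem ⟨x, hx⟩]
  · rw [LinearMap.comp_apply, straighten_nonneg X d (tmul_mem_tp hx trivial),
      LinearMap.comp_apply, LinearMap.add_apply, mulMap_tmul, G.toMinus_of_nonneg hx, map_zero,
      zero_mul, zero_add, lamMap_tmul, map_smul,
      -- On k, t/(e^t - 1) is written as t/(1 - e^{-t}) - t; the first series cancels against the
      -- symmetrisation series.
      eq_sub_of_add_eq (G.ev_bernSeries' X d (x ⊗ₜ[𝕜] z)).symm, map_sub, vermaSym,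
      LinearMap.comp_apply, ← Module.End.mul_apply, ← ev_mul, mul_comm, bernSeries'_mul_symSeries,
      ev, nilEval_one (G.shift_pow_nilBound X d), Module.End.one_apply,
      vermaActMap_nonneg X d lam hX n hx hz]
    exact add_sub_cancel_right _ _

include hX in
theorem vermaActMap_eq (w : g ⊗[𝕜] G.minusSpace.Sym) :
    vermaActMap lam w = lam.vermaMap (actMap X d lam w) := by
  have h1 : vermaSym X d lam = lam.vermaMap ∘ₗ symAct X d lam := by
    have h := congrArg (fun f => f ∘ₗ Ring.inverse (G.straighten X d))
      (vermaSym_comp_straighten X d lam hX)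
    simp only [LinearMap.comp_assoc] at h
    rw [← Module.End.mul_eq_comp, Ring.mul_inverse_cancel _ (isUnit_straighten X d)] at h
    exact h
  have h2 := LinearMap.congr_fun h1 (G.ev X d (bernSeries' 𝕜) w)
  rwa [vermaSym, LinearMap.comp_apply, ← Module.End.mul_apply, ← ev_mul, mul_comm,
    bernSeries'_mul_symSeries, ev, nilEval_one (G.shift_pow_nilBound X d),
    Module.End.one_apply] at h2

include hX in
/-- The map from `S(g_-)` to the parabolic Verma module is equivariant. -/
theorem vermaAct_vermaMap (x : g) (z : G.minusSpace.Sym) :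
    vermaAct lam x (lam.vermaMap z) = lam.vermaMap (act X d lam x z) := by
  rw [← vermaActMap_tmul, vermaActMap_eq X d lam hX, act_apply]

include hX in
-- By equivariance the range is a U(g)-submodule, and it contains the generator Φ(1).
theorem vermaMap_surjective : Function.Surjective lam.vermaMap := by
  rw [← LinearMap.range_eq_top, Submodule.eq_top_iff']
  have h : ∀ (u : L.Env), ∀ v ∈ LinearMap.range lam.vermaMap,
      u • v ∈ LinearMap.range lam.vermaMap := by
    intro u
    induction u using L.env_induction with
    | h1 r => intro v hv; rw [algebraMap_smul]; exact Submodule.smul_mem _ _ hv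
    | hι x =>
      rintro _ ⟨z, rfl⟩
      exact ⟨_, (vermaAct_vermaMap X d lam hX x z).symm⟩
    | hadd x y hx hy => intro v hv; rw [add_smul]; exact Submodule.add_mem _ (hx v hv) (hy v hv)
    | hmul x y hx hy => intro v hv; rw [mul_smul]; exact hx _ (hy v hv)
  intro v
  obtain ⟨t, rfl⟩ := lam.balanced.mkQ_surjective v
  induction t using TensorProduct.induction_on with
  | zero => simp
  | tmul u c => rw [mkQ_tmul]; exact Submodule.smul_mem _ _ (h u _ ⟨1, rfl⟩)
  | add s t hs ht => rw [map_add]; exact Submodule.add_mem _ hs ht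

include hX in
theorem vermaMap_bijective : Function.Bijective lam.vermaMap :=
  ⟨vermaMap_injective X d lam hX, vermaMap_surjective X d lam hX⟩

include hX in
theorem realisation_eq (h : Function.Bijective lam.vermaMap) (x : g) :
    lam.realisation h x = act X d lam x := by
  ext z
  change (LinearEquiv.ofBijective lam.vermaMap h).symm (vermaAct lam x (lam.vermaMap z)) = _
  rw [LinearEquiv.symm_apply_eq, vermaAct_vermaMap X d lam hX]
  rfl

end ZGrading

end LieSuperalgebra

namespace SuperSpace

/-! ### Ordered monomials -/

/-- The sign of moving `y_i` to its place in the ordered monomial with exponents `K`. -/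
def crossSign {I : Type*} [DecidableEq I] (d : I → ZMod 2) (i : I) (K : I → ℕ) : List I → ℤ
  | [] => 1
  | j :: l => if j = i then 1 else koszul (d i) (d j) ^ K j * crossSign d i K l

theorem mul_pow_of_koszul {R : Type*} [Ring R] {x y : R} {a b : ZMod 2}
    (h : x * y = koszul a b • (y * x)) (k : ℕ) : x * y ^ k = koszul a b ^ k • (y ^ k * x) := by
  induction k with
  | zero => simp
  | succ k ih =>
    rw [pow_succ y, ← mul_assoc, ih, smul_mul_assoc, mul_assoc, h, mul_smul_comm, smul_smul,
      mul_assoc, pow_succ]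

theorem mul_prod_pow {I : Type*} [DecidableEq I] (d : I → ZMod 2) {R : Type*} [Ring R] (y : I → R)
    (hy : ∀ i j, y i * y j = koszul (d i) (d j) • (y j * y i)) (i : I) (K : I → ℕ) (l : List I)
    (hl : l.Nodup) (hi : i ∈ l) : y i * (l.map fun j => y j ^ K j).prod =
      crossSign d i K l • (l.map fun j => y j ^ (K + Pi.single i 1 : I → ℕ) j).prod := by
  induction l with
  | nil => simp at hi
  | cons j l ih =>
    rw [List.nodup_cons] at hl
    simp only [List.map_cons, List.prod_cons, crossSign]
    split_ifs with h
    · subst h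
      have : (l.map fun k => y k ^ (K + Pi.single j 1 : I → ℕ) k) = l.map fun k => y k ^ K k := by
        refine List.map_congr_left fun k hk => ?_
        have : k ≠ j := fun e => hl.1 (e ▸ hk)
        simp [this]
      rw [this, one_smul, ← mul_assoc, ← pow_succ']
      simp
    · have hi' : i ∈ l := (List.mem_cons.mp hi).resolve_left (Ne.symm h)
      rw [← mul_assoc, mul_pow_of_koszul (hy i j), smul_mul_assoc, mul_assoc, ih hl.2 hi',
        mul_smul_comm, smul_smul]
      simp [h]

variable {𝕜 : Type u} {V : Type v} [Field 𝕜] [AddCommGroup V] [Module 𝕜 V]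
variable (P : SuperSpace 𝕜 V)

theorem twist_ι_pow (a : ZMod 2) {b : ZMod 2} {x : V} (hx : x ∈ P.par b) (k : ℕ) :
    P.twist a (P.ι x ^ k) = koszul a b ^ k • P.ι x ^ k := by
  rw [map_pow, P.twist_ι a hx, smul_pow]

variable {I : Type*} [DecidableEq I] (X : Module.Basis I 𝕜 V) (d : I → ZMod 2)

theorem pd_pow (hX : ∀ i, X i ∈ P.par (d i)) (i : I) (k : ℕ) (hk : d i = 1 → k = 0) :
    P.pd X d i (P.ι (X i) ^ (k + 1)) = ((k + 1 : ℕ) : 𝕜) • P.ι (X i) ^ k := by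
  rcases zmod_two_cases (d i) with h | h
  · induction k with
    | zero =>
      have := P.pd_basis_mul X d hX i i 1
      simpa [pd_one] using this
    | succ k ih =>
      rw [pow_succ', P.pd_basis_mul X d hX, ih (fun h' => by rw [h] at h'; simp at h'), if_pos rfl, h,
        koszul_zero_right, one_smul, one_smul, mul_smul_comm, ← pow_succ']
      push_cast
      module
  · rw [hk h]
    have := P.pd_basis_mul X d hX i i 1
    simpa [pd_one] using this

theorem pd_pow_ne (hX : ∀ i, X i ∈ P.par (d i)) {i j : I} (h : i ≠ j) (k : ℕ) :
    P.pd X d i (P.ι (X j) ^ k) = 0 := by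
  induction k with
  | zero => rw [pow_zero, pd_one]
  | succ k ih => rw [pow_succ', P.pd_basis_mul X d hX, ih]; simp [h]

theorem pd_prod_of_notMem (hX : ∀ i, X i ∈ P.par (d i)) (i : I) (K : I → ℕ) (l : List I)
    (hi : i ∉ l) : P.pd X d i (l.map fun j => P.ι (X j) ^ K j).prod = 0 := by
  induction l with
  | nil => simp [pd_one]
  | cons j l ih =>
    rw [List.mem_cons, not_or] at hi
    rw [List.map_cons, List.prod_cons, pd_mul, ih hi.2, P.pd_pow_ne X d hX hi.1, zero_mul, mul_zero,
      add_zero]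

theorem pd_prod_pow (hX : ∀ i, X i ∈ P.par (d i)) (i : I) (K : I → ℕ) (hK : d i = 1 → K i = 0)
    (l : List I) (hl : l.Nodup) (hi : i ∈ l) :
    P.pd X d i (l.map fun j => P.ι (X j) ^ (K + Pi.single i 1 : I → ℕ) j).prod =
      crossSign d i K l • ((K i + 1 : ℕ) : 𝕜) • (l.map fun j => P.ι (X j) ^ K j).prod := by
  induction l with
  | nil => simp at hi
  | cons j l ih =>
    rw [List.nodup_cons] at hl
    simp only [List.map_cons, List.prod_cons, crossSign]
    rw [pd_mul]
    split_ifs with h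
    · subst h
      have : (l.map fun k => P.ι (X k) ^ (K + Pi.single j 1 : I → ℕ) k) =
          l.map fun k => P.ι (X k) ^ K k := by
        refine List.map_congr_left fun k hk => ?_
        have : k ≠ j := fun e => hl.1 (e ▸ hk)
        simp [this]
      rw [this, P.pd_prod_of_notMem X d hX j K l hl.1, mul_zero, add_zero, one_smul, Pi.add_apply,
        Pi.single_eq_same, P.pd_pow X d hX j _ hK, smul_mul_assoc]
    · have hi' : i ∈ l := (List.mem_cons.mp hi).resolve_left (Ne.symm h)
      have hj : (K + Pi.single i 1 : I → ℕ) j = K j := by simp [h]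
      rw [hj, P.pd_pow_ne X d hX (Ne.symm h), zero_mul, zero_add, ih hl.2 hi',
        P.twist_ι_pow _ (hX j), smul_mul_assoc, mul_smul_comm, mul_smul_comm, smul_smul]

variable {m : ℕ} (Y : Module.Basis (Fin m) 𝕜 V) (e : Fin m → ZMod 2)

/-- The ordered monomial with exponents `K`. -/
def xPow (K : Fin m → ℕ) : P.Sym := (List.ofFn fun i => P.ι (Y i) ^ K i).prod

/-- The ordered monomial in the partial derivatives with exponents `K`. -/
def pdPow (K : Fin m → ℕ) : Module.End 𝕜 P.Sym := (List.ofFn fun i => P.pd Y e i ^ K i).prod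

theorem xPow_eq (K : Fin m → ℕ) :
    P.xPow Y K = ((List.finRange m).map fun i => P.ι (Y i) ^ K i).prod := by
  rw [xPow, List.ofFn_eq_map]

theorem pdPow_eq (K : Fin m → ℕ) :
    P.pdPow Y e K = ((List.finRange m).map fun i => P.pd Y e i ^ K i).prod := by
  rw [pdPow, List.ofFn_eq_map]

theorem pd_xPow (hY : ∀ i, Y i ∈ P.par (e i)) (i : Fin m) (K : Fin m → ℕ)
    (hK : e i = 1 → K i = 0) : P.pd Y e i (P.xPow Y (K + Pi.single i 1)) =
      crossSign e i K (List.finRange m) • ((K i + 1 : ℕ) : 𝕜) • P.xPow Y K := by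
  rw [xPow_eq, xPow_eq]
  exact P.pd_prod_pow Y e hY i K hK _ (List.nodup_finRange m) (List.mem_finRange i)

theorem pd_xPow_zero (hY : ∀ i, Y i ∈ P.par (e i)) (i : Fin m) (K : Fin m → ℕ) (hK : K i = 0) :
    P.pd Y e i (P.xPow Y K) = 0 := by
  rw [xPow_eq]
  suffices h : ∀ l : List (Fin m), P.pd Y e i (l.map fun j => P.ι (Y j) ^ K j).prod = 0 from h _
  intro l
  induction l with
  | nil => simp [pd_one]
  | cons j l ih =>
    rw [List.map_cons, List.prod_cons, pd_mul, ih, mul_zero, add_zero]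
    by_cases h : i = j
    · rw [← h, hK, pow_zero, pd_one, zero_mul]
    · rw [P.pd_pow_ne Y e hY h, zero_mul]

/-- The sign depends only on parities, so it is the one in `pd_xPow`; in `shift_mul_shiftDiv` the
two multiply to 1. -/
theorem pd_mul_pdPow (i : Fin m) (K : Fin m → ℕ) : P.pd Y e i * P.pdPow Y e K =
    crossSign e i K (List.finRange m) • P.pdPow Y e (K + Pi.single i 1) := by
  rw [pdPow_eq, pdPow_eq]
  refine mul_prod_pow e (P.pd Y e) (fun i j => LinearMap.ext fun z => ?_) i K _
    (List.nodup_finRange m) (List.mem_finRange i)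
  exact P.pd_pd Y e i j z

theorem xPow_zero : P.xPow Y 0 = 1 := by
  simp [xPow]

theorem pdPow_zero : P.pdPow Y e 0 = 1 := by
  simp [pdPow]

theorem pd_sq [CharZero 𝕜] (i : Fin m) (hi : e i = 1) : P.pd Y e i * P.pd Y e i = 0 := by
  have h : P.pd Y e i * P.pd Y e i = -(P.pd Y e i * P.pd Y e i) := by
    have : P.pd Y e i * P.pd Y e i = koszul (e i) (e i) • (P.pd Y e i * P.pd Y e i) :=
      LinearMap.ext fun z => P.pd_pd Y e i i z
    rwa [hi, show koszul 1 1 = -1 from rfl, neg_smul, one_smul] at this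
  have h2 : (2 : 𝕜) • (P.pd Y e i * P.pd Y e i) = 0 := by
    rw [two_smul]; nth_rw 1 [h]; exact neg_add_cancel _
  exact (smul_eq_zero.mp h2).resolve_left two_ne_zero

theorem pdPow_eq_zero [CharZero 𝕜] (i : Fin m) (hi : e i = 1) (K : Fin m → ℕ) (hK : 2 ≤ K i) :
    P.pdPow Y e K = 0 := by
  rw [pdPow_eq]
  have h : P.pd Y e i ^ K i = 0 := by
    refine pow_eq_zero_of_le hK ?_
    rw [pow_two, P.pd_sq Y e i hi]
  refine List.prod_eq_zero (List.mem_map.mpr ⟨i, List.mem_finRange i, h⟩)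

theorem ι_pow_mem_symDeg (x : V) (k : ℕ) : P.ι x ^ k ∈ P.symDeg k := by
  induction k with
  | zero => simpa using P.one_mem_symDeg
  | succ k ih => rw [pow_succ']; exact P.ι_mul_mem_symDeg x ih

theorem xPow_mem_symDeg (K : Fin m → ℕ) : P.xPow Y K ∈ P.symDeg (∑ i, K i) := by
  rw [xPow, ← List.sum_ofFn]
  suffices h : ∀ l : List (Fin m),
      (l.map fun i => P.ι (Y i) ^ K i).prod ∈ P.symDeg (l.map K).sum by
    rw [List.ofFn_eq_map, List.ofFn_eq_map]; exact h _
  intro l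
  induction l with
  | nil => simpa using P.one_mem_symDeg
  | cons i l ih =>
    simp only [List.map_cons, List.prod_cons, List.sum_cons]
    exact P.mul_mem_symDeg (P.ι_pow_mem_symDeg _ _) ih

end SuperSpace

/-! ### Powers of the shift operator in terms of multi-indices -/

namespace LieSuperalgebra

variable {𝕜 : Type u} {g : Type v} [Field 𝕜] [AddCommGroup g] [Module 𝕜 g]
variable {L : LieSuperalgebra 𝕜 g}

namespace ZGrading

variable (G : L.ZGrading) {m : ℕ} (Y : Module.Basis (Fin m) 𝕜 G.minus) (e : Fin m → ZMod 2)

/-- The symmetrised product of the operators `adTilde Y_i` with exponents `K`. -/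
def symAd (K : Fin m → ℕ) : Module.End 𝕜 g :=
  G.minusSpace.symmetrise G.adTilde (G.minusSpace.xPow Y K)

/-- The `n`-th divided power of the shift operator, written with multi-indices. -/
def shiftDiv (n : ℕ) : Module.End 𝕜 (g ⊗[𝕜] G.minusSpace.Sym) :=
  ∑ K ∈ Finset.piAntidiag Finset.univ n, ((∏ i, (K i).factorial : ℕ) : 𝕜)⁻¹ •
    TensorProduct.map (G.symAd Y K) (G.minusSpace.pdPow Y e K)

theorem shiftDiv_zero : G.shiftDiv Y e 0 = 1 := by
  simp [shiftDiv, symAd, SuperSpace.xPow_zero, SuperSpace.pdPow_zero, SuperSpace.symmetrise_one]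

/-- The factor n + 1 = |K| is distributed over the possible first factors of the symmetrised
product, which differentiates the monomial. Raising the i-th exponent by one then matches the terms
with those of the left side. -/
theorem shift_mul_shiftDiv [CharZero 𝕜] (hY : ∀ i, Y i ∈ G.minusSpace.par (e i)) (n : ℕ) :
    G.shift Y e * G.shiftDiv Y e n = ((n + 1 : ℕ) : 𝕜) • G.shiftDiv Y e (n + 1) := by
  have hL : ((n + 1 : ℕ) : 𝕜) • G.shiftDiv Y e (n + 1) =
      ∑ i, ∑ K ∈ Finset.piAntidiag Finset.univ (n + 1), ((∏ i, (K i).factorial : ℕ) : 𝕜)⁻¹ •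
        TensorProduct.map (G.adTilde (Y i) * G.minusSpace.symmetrise G.adTilde
          (G.minusSpace.pd Y e i (G.minusSpace.xPow Y K))) (G.minusSpace.pdPow Y e K) := by
    rw [Finset.sum_comm, shiftDiv, Finset.smul_sum]
    refine Finset.sum_congr rfl fun K hK => ?_
    have hK' : ∑ i, K i = n + 1 := (Finset.mem_piAntidiag.mp hK).1
    have h := G.minusSpace.sum_mul_symmetrise_pd Y e hY G.adTilde (hK' ▸ G.minusSpace.xPow_mem_symDeg Y K)
    rw [smul_comm, ← Finset.smul_sum, ← TensorProduct.map_smul_left, symAd, ← h]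
    congr 1
    exact map_sum ((TensorProduct.mapBilinear (.id 𝕜) g G.minusSpace.Sym g G.minusSpace.Sym).flip _)
      _ _
  rw [hL, shift, Finset.sum_mul]
  refine Finset.sum_congr rfl fun i _ => ?_
  rw [shiftDiv, Finset.mul_sum]
  have hz : ∀ K ∈ Finset.piAntidiag (Finset.univ : Finset (Fin m)) (n + 1),
      ((∏ i, (K i).factorial : ℕ) : 𝕜)⁻¹ •
        TensorProduct.map (G.adTilde (Y i) * G.minusSpace.symmetrise G.adTilde
          (G.minusSpace.pd Y e i (G.minusSpace.xPow Y K))) (G.minusSpace.pdPow Y e K) ≠ 0 →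
      K i ≠ 0 := by
    intro K _ h hK
    rw [G.minusSpace.pd_xPow_zero Y e hY i K hK] at h
    simp at h
  rw [← Finset.sum_filter_of_ne hz]
  -- Truncated subtraction is harmless, since only multi-indices with K i ≠ 0 contribute.
  refine Finset.sum_nbij' (fun K => K + Pi.single i 1) (fun K => K - Pi.single i 1) ?_ ?_ ?_ ?_ ?_
  · intro K hK
    rw [Finset.mem_piAntidiag] at hK
    rw [Finset.mem_filter, Finset.mem_piAntidiag]
    simp [Finset.sum_add_distrib, hK.1]
  · intro K hK
    rw [Finset.mem_filter, Finset.mem_piAntidiag] at hK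
    rw [Finset.mem_piAntidiag]
    refine ⟨?_, by simp⟩
    have h1 : K = (K - Pi.single i 1) + Pi.single i 1 := by
      ext j
      by_cases h : j = i
      · subst h; simp; omega
      · simp [h]
    have h2 := hK.1.1
    rw [h1] at h2
    simp only [Pi.add_apply, Finset.sum_add_distrib, Finset.sum_pi_single', Finset.mem_univ,
      if_true] at h2
    simpa using h2
  · intro K _; ext j; simp
  · intro K hK
    rw [Finset.mem_filter] at hK
    ext j
    by_cases h : j = i
    · subst h; simp; omega
    · simp [h]
  · intro K _
    have hf : ∏ j, ((K + Pi.single i 1 : Fin m → ℕ) j).factorial = (K i + 1) * ∏ j, (K j).factorial := by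
      rw [← Finset.mul_prod_erase _ _ (Finset.mem_univ i),
        ← Finset.mul_prod_erase _ (fun j => (K j).factorial) (Finset.mem_univ i), ← mul_assoc,
        ← Nat.factorial_succ]
      congr 1
      · simp
      · refine Finset.prod_congr rfl fun j hj => ?_
        simp [Finset.ne_of_mem_erase hj]
    rw [mul_smul_comm, ← TensorProduct.map_mul, G.minusSpace.pd_mul_pdPow]
    -- If X_i is odd and already present, the derivative monomial with raised exponent is zero and
    -- both terms vanish.
    by_cases hv : e i = 1 ∧ 1 ≤ K i
    · have : G.minusSpace.pdPow Y e (K + Pi.single i 1) = 0 :=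
        G.minusSpace.pdPow_eq_zero Y e i hv.1 _ (by simpa using hv.2)
      simp [this]
    · have hK : e i = 1 → K i = 0 := fun h => by
        by_contra h'; exact hv ⟨h, Nat.one_le_iff_ne_zero.mpr h'⟩
      have hc : ((K i + 1 : ℕ) : 𝕜) ≠ 0 := Nat.cast_ne_zero.mpr (Nat.succ_ne_zero _)
      rw [G.minusSpace.pd_xPow Y e hY i K hK, hf, ← Int.cast_smul_eq_zsmul 𝕜,
        ← Int.cast_smul_eq_zsmul 𝕜, map_smul, map_smul, mul_smul_comm, mul_smul_comm,
        TensorProduct.map_smul_left, TensorProduct.map_smul_left, TensorProduct.map_smul_right,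
        Nat.cast_mul, smul_comm (_⁻¹ : 𝕜), smul_comm (_⁻¹ : 𝕜), mul_inv, mul_smul]
      congr 1
      rw [smul_comm (_⁻¹ : 𝕜) ((K i + 1 : ℕ) : 𝕜), inv_smul_smul₀ hc]
      rfl

theorem shift_pow_eq [CharZero 𝕜] (hY : ∀ i, Y i ∈ G.minusSpace.par (e i)) (n : ℕ) :
    G.shift Y e ^ n = (n.factorial : 𝕜) • G.shiftDiv Y e n := by
  induction n with
  | zero => simp [shiftDiv_zero]
  | succ n ih =>
    rw [pow_succ', ih, mul_smul_comm, G.shift_mul_shiftDiv Y e hY, smul_smul, Nat.factorial_succ,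
      Nat.cast_mul, mul_comm]

theorem shift_pow_tmul [CharZero 𝕜] (hY : ∀ i, Y i ∈ G.minusSpace.par (e i)) (n : ℕ) (x : g)
    (z : G.minusSpace.Sym) : (G.shift Y e ^ n) (x ⊗ₜ z) =
      ∑ K ∈ Finset.piAntidiag Finset.univ n,
        ((n.factorial : 𝕜) * ((∏ i, (K i).factorial : ℕ) : 𝕜)⁻¹) •
          (G.symAd Y K x ⊗ₜ[𝕜] G.minusSpace.pdPow Y e K z) := by
  rw [G.shift_pow_eq Y e hY, shiftDiv, Finset.smul_sum, LinearMap.sum_apply]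
  refine Finset.sum_congr rfl fun K _ => ?_
  rw [smul_smul, LinearMap.smul_apply, TensorProduct.map_tmul]

/-- The symmetrised products of the operators `adTilde` preserve any filtration that these
operators lower by one. -/
theorem symmetrise_adTilde_mem [CharZero 𝕜] (hY : ∀ i, Y i ∈ G.minusSpace.par (e i))
    {F : ℤ → Submodule 𝕜 g} (hF : ∀ m, ∀ x ∈ F m, ∀ y, G.adTilde y x ∈ F (m - 1)) {n : ℕ}
    {z : G.minusSpace.Sym} (hz : z ∈ G.minusSpace.symDeg n) {a : ℤ} {x : g} (hx : x ∈ F a) :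
    G.minusSpace.symmetrise G.adTilde z x ∈ F (a - n) := by
  induction n generalizing z with
  | zero =>
    obtain ⟨c, rfl⟩ := G.minusSpace.mem_symDeg_zero hz
    simpa [SuperSpace.symmetrise_one] using Submodule.smul_mem _ c hx
  | succ n ih =>
    have hc : ((n + 1 : ℕ) : 𝕜) ≠ 0 := Nat.cast_ne_zero.mpr (Nat.succ_ne_zero _)
    have h := G.minusSpace.sum_mul_symmetrise_pd Y e hY G.adTilde hz
    rw [← (F _).smul_mem_iff hc, ← LinearMap.smul_apply, ← h, LinearMap.sum_apply]
    refine Submodule.sum_mem _ fun i _ => ?_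
    have := hF _ _ (ih (G.minusSpace.pd_mem_symDeg Y e i hz)) (Y i)
    push_cast
    rwa [sub_sub] at this

end ZGrading

end LieSuperalgebra

/-! ### Finiteness and sums over multi-indices -/

namespace MultiIndex

variable {r s : ℕ}

theorem one_le_size (K : MultiIndex r s) : 1 ≤ K.size := by
  by_contra h
  refine K.2.1 (funext fun i => ?_)
  have h0 : ∑ i, K.1 i = 0 := by simpa [MultiIndex.size] using h
  exact Finset.sum_eq_zero_iff.mp h0 i (Finset.mem_univ i)

theorem finite_size_lt (n : ℕ) : {K : MultiIndex r s | K.size < n}.Finite := by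
  refine Set.Finite.preimage (f := fun K : MultiIndex r s => K.1) Subtype.val_injective.injOn
    (s := {K | ∑ i, K i < n}) ?_
  refine (Set.finite_Icc (0 : Fin (r + s) → ℕ) (fun _ => n)).subset fun K hK => ⟨zero_le, fun i => ?_⟩
  exact (Finset.single_le_sum (fun _ _ => Nat.zero_le _) (Finset.mem_univ i)).trans (le_of_lt hK)

/-- Each multi-index has size at least one, so removing the head strictly lowers the total size. -/
theorem finite_sum_size_lt (n : ℕ) :
    {Ks : List (MultiIndex r s) | (Ks.map MultiIndex.size).sum < n}.Finite := by
  induction n with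
  | zero => simp
  | succ n ih =>
    refine (((finite_size_lt (n + 1)).image2 List.cons ih).union (Set.finite_singleton [])).subset ?_
    rintro (_ | ⟨K, Ks⟩) h
    · exact Or.inr rfl
    · have hK := K.one_le_size
      rw [Set.mem_ofPred_eq, List.map_cons, List.sum_cons] at h
      exact Or.inl ⟨K, by simp only [Set.mem_ofPred_eq]; omega, Ks,
        by simp only [Set.mem_ofPred_eq]; omega, rfl⟩

/-- Passes from restricted multi-indices to all exponents, grouped by total degree k + 1; the
excluded odd exponents contribute nothing. -/
theorem finsum_eq_sum {M : Type*} [AddCommMonoid M] (F : (Fin (r + s) → ℕ) → M) (B : ℕ)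
    (hodd : ∀ K, ∀ i : Fin (r + s), r ≤ (i : ℕ) → 2 ≤ K i → F K = 0)
    (hB : ∀ K, B < ∑ i, K i → F K = 0) :
    ∑ᶠ K : MultiIndex r s, F K.1 =
      ∑ k ∈ Finset.range B, ∑ K ∈ Finset.piAntidiag Finset.univ (k + 1), F K := by
  classical
  rw [← Finset.sum_biUnion]
  · refine (finsum_subtype_eq_finsum_cond (f := F) (fun K : Fin (r + s) → ℕ =>
      K ≠ 0 ∧ ∀ i : Fin (r + s), r ≤ (i : ℕ) → K i ≤ 1)).trans ?_
    refine finsum_mem_eq_sum_of_inter_support_eq (s := {K : Fin (r + s) → ℕ |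
      K ≠ 0 ∧ ∀ i : Fin (r + s), r ≤ (i : ℕ) → K i ≤ 1}) F ?_
    ext K
    simp only [Set.mem_inter_iff, Set.mem_ofPred_eq, Function.mem_support, and_congr_left_iff,
      Finset.coe_biUnion, Set.mem_iUnion, Finset.mem_coe, Finset.mem_range, Finset.mem_piAntidiag,
      Finset.mem_univ, implies_true, and_true, exists_prop]
    intro hF
    constructor
    · rintro ⟨h0, -⟩
      have h1 : ∑ i, K i ≠ 0 := fun h => h0 (funext fun i =>
        Finset.sum_eq_zero_iff.mp h i (Finset.mem_univ i))
      have h2 : ∑ i, K i ≤ B := not_lt.mp fun h => hF (hB K h)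
      exact ⟨(∑ i, K i) - 1, by omega, (Nat.sub_one_add_one h1).symm⟩
    · rintro ⟨k, -, hk⟩
      refine ⟨fun h => by simp [h] at hk, fun i hi => ?_⟩
      by_contra h
      exact hF (hodd K i hi (by omega))
  · intro k _ l _ hkl
    refine Finset.disjoint_left.mpr fun K hK hL => hkl ?_
    rw [Finset.mem_piAntidiag] at hK hL
    omega

end MultiIndex

/-! ### Finiteness of the coefficients and expansion of series in the shift operator -/

namespace LieSuperalgebra

variable {𝕜 : Type u} {g : Type v} [Field 𝕜] [AddCommGroup g] [Module 𝕜 g]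
variable {L : LieSuperalgebra 𝕜 g}

namespace ZGrading

variable (G : L.ZGrading) {r s : ℕ} (X : Module.Basis (Fin (r + s)) 𝕜 G.minus)

theorem basis_mem_par (hX0 : ∀ i : Fin (r + s), (i : ℕ) < r → (X i : g) ∈ L.par 0)
    (hX1 : ∀ i : Fin (r + s), r ≤ (i : ℕ) → (X i : g) ∈ L.par 1) (i : Fin (r + s)) :
    X i ∈ G.minusSpace.par (indexParity i) := by
  by_cases h : (i : ℕ) < r
  · rw [indexParity, if_pos h]; exact hX0 i h
  · rw [indexParity, if_neg h]; exact hX1 i (not_lt.mp h)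

variable [CharZero 𝕜] (hX : ∀ i, X i ∈ G.minusSpace.par (indexParity i))

include hX

theorem sOp_mem_minus (K : MultiIndex r s) {x : g} (hx : x ∈ G.minus) : G.sOp X K x ∈ G.minus :=
  -- The constant filtration with value g_- is stable under all `adTilde`.
  G.symmetrise_adTilde_mem X indexParity hX (F := fun _ => G.minus) (a := 0)
    (fun _ _ hx y => G.adTilde_mem_minus y hx) (G.minusSpace.xPow_mem_symDeg X K.1) hx

theorem symAd_mem_grLE (K : Fin (r + s) → ℕ) {a : ℤ} {x : g} (hx : x ∈ G.grLE a) :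
    G.symAd X K x ∈ G.grLE (a - (∑ i, K i : ℕ)) :=
  G.symmetrise_adTilde_mem X indexParity hX (fun _ _ hx y => G.adTilde_mem_grLE y hx)
    (G.minusSpace.xPow_mem_symDeg X K) hx

theorem whTerm_mem_grLE {a : ℤ} (ha : G.grLE a = ⊤) (Z : g) (i : Fin (r + s))
    (Ks : List (MultiIndex r s)) :
    G.whTerm X Z i Ks ∈ G.grLE (a - ((Ks.map MultiIndex.size).sum : ℕ)) := by
  induction Ks with
  | nil => simp [ha]
  | cons K Ks ih =>
    have h := G.symAd_mem_grLE X hX K.1 (G.projNonneg_mem_grLE ih)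
    rw [sub_sub] at h
    rw [List.map_cons, List.sum_cons, Nat.cast_add, add_comm]
    exact Submodule.smul_mem _ _ h

variable [FiniteDimensional 𝕜 g]

theorem exists_symAd_eq_zero : ∃ N : ℕ, ∀ K : Fin (r + s) → ℕ, N ≤ ∑ i, K i → G.symAd X K = 0 := by
  obtain ⟨a, N, ha, hN⟩ := G.exists_grLE
  refine ⟨N, fun K hK => LinearMap.ext fun x => ?_⟩
  have h := G.symAd_mem_grLE X hX K (a := a) (x := x) (by rw [ha]; trivial)
  rwa [hN _ (by omega), Submodule.mem_bot] at h

theorem finite_sOp_ne_zero (x : g) : {K : MultiIndex r s | G.sOp X K x ≠ 0}.Finite := by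
  obtain ⟨N, hN⟩ := G.exists_symAd_eq_zero X hX
  refine (MultiIndex.finite_size_lt N).subset fun K hK => ?_
  by_contra h
  exact hK (LinearMap.congr_fun (hN K.1 (not_lt.mp h)) x)

theorem exists_whTerm_eq_zero : ∃ N : ℕ, ∀ (Z : g) (i : Fin (r + s)) (Ks : List (MultiIndex r s)),
    N ≤ (Ks.map MultiIndex.size).sum → G.whTerm X Z i Ks = 0 := by
  obtain ⟨a, N, ha, hN⟩ := G.exists_grLE
  refine ⟨N, fun Z i Ks hK => ?_⟩
  have h := G.whTerm_mem_grLE X hX ha Z i Ks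
  rwa [hN _ (by omega), Submodule.mem_bot] at h

theorem finite_whTerm_ne_zero (Z : g) (i : Fin (r + s)) :
    {Ks : List (MultiIndex r s) | G.whTerm X Z i Ks ≠ 0}.Finite := by
  obtain ⟨N, hN⟩ := G.exists_whTerm_eq_zero X hX
  refine (MultiIndex.finite_sum_size_lt N).subset fun Ks hK => ?_
  by_contra h
  exact hK (hN Z i Ks (not_lt.mp h))

theorem exists_hTerm_eq_zero (Z : g) : ∃ l : ℕ, ∀ i, ∀ Ks : List (MultiIndex r s),
    Ks.length = l → G.hTerm X Z i Ks = 0 := by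
  obtain ⟨N, hN⟩ := G.exists_whTerm_eq_zero X hX
  refine ⟨N, fun i Ks hl => ?_⟩
  rw [hTerm, hN Z i Ks, map_zero]
  have := List.length_le_sum_of_one_le (Ks.map MultiIndex.size) (by
    simp only [List.mem_map, forall_exists_index, and_imp, forall_apply_eq_imp_iff₂]
    exact fun K _ => K.one_le_size)
  rwa [List.length_map, hl] at this

/-- The expansion of a power series in the shift operator in terms of multi-indices. -/
theorem curry_ev (Ψ : g ⊗[𝕜] G.minusSpace.Sym →ₗ[𝕜] G.minusSpace.Sym) (φ : PowerSeries 𝕜) (x : g) :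
    TensorProduct.curry (Ψ ∘ₗ G.ev X indexParity φ) x =
      PowerSeries.coeff 0 φ • TensorProduct.curry Ψ x + ∑ᶠ K : MultiIndex r s,
        (PowerSeries.coeff K.size φ * K.size.factorial * (K.fact : 𝕜)⁻¹) •
          ((TensorProduct.curry Ψ (G.sOp X K x) : Module.End 𝕜 G.minusSpace.Sym) *
            G.partialPow X K) := by
  obtain ⟨N, hN⟩ := G.exists_symAd_eq_zero X hX
  have hsum := MultiIndex.finsum_eq_sum (r := r) (s := s) (fun K =>
    (PowerSeries.coeff (∑ i, K i) φ * (∑ i, K i).factorial * ((∏ i, (K i).factorial : ℕ) : 𝕜)⁻¹) •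
      ((TensorProduct.curry Ψ (G.symAd X K x) : Module.End 𝕜 G.minusSpace.Sym) *
        G.minusSpace.pdPow X indexParity K)) (max N G.nilBound) ?_ ?_
  · refine Eq.trans ?_ (congrArg (_ + ·) hsum.symm)
    ext z
    have h0 : ∀ k ∉ Finset.range G.nilBound, (G.shift X indexParity ^ (k + 1)) (x ⊗ₜ z) = 0 := by
      intro k hk
      rw [pow_eq_zero_of_le (by simp at hk; omega) (G.shift_pow_nilBound X indexParity),
        LinearMap.zero_apply]
    rw [TensorProduct.curry_apply, LinearMap.comp_apply, ev_apply', LinearMap.add_apply, map_add,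
      map_smul, LinearMap.smul_apply, TensorProduct.curry_apply, LinearMap.sum_apply, map_sum]
    congr 1
    rw [← Finset.sum_subset (Finset.range_mono (le_max_right N G.nilBound))]
    · refine Finset.sum_congr rfl fun k _ => ?_
      rw [G.shift_pow_tmul X indexParity hX, LinearMap.sum_apply, Finset.smul_sum, map_sum]
      refine Finset.sum_congr rfl fun K hK => ?_
      rw [(Finset.mem_piAntidiag.mp hK).1, smul_smul, map_smul, mul_assoc]
      rfl
    -- Beyond `nilBound` the individual summands are not known to vanish, only their sum, which is a
    -- multiple of a power of the shift.
    · intro k _ hk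
      have h1 := G.shift_pow_tmul X indexParity hX (k + 1) x z
      rw [h0 k hk] at h1
      have h2 := congrArg (fun w => PowerSeries.coeff (k + 1) φ • Ψ w) h1
      simp only [map_zero, smul_zero, map_sum, Finset.smul_sum] at h2
      rw [LinearMap.sum_apply, h2]
      refine Finset.sum_congr rfl fun K hK => ?_
      rw [(Finset.mem_piAntidiag.mp hK).1, map_smul, smul_smul, mul_assoc]
      rfl
  · intro K i hi hK
    rw [G.minusSpace.pdPow_eq_zero X indexParity i (by simp [indexParity, hi]) K hK, mul_zero,
      smul_zero]
  · intro K hK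
    rw [hN K (le_of_lt ((le_max_left _ _).trans_lt hK)), LinearMap.zero_apply, map_zero, zero_mul,
      smul_zero]

end ZGrading

end LieSuperalgebra

/-! ### Bernoulli coefficients -/

theorem coeff_bernSeries' {𝕜 : Type u} [Field 𝕜] [CharZero 𝕜] {r s : ℕ} (K : MultiIndex r s) :
    PowerSeries.coeff K.size (bernSeries' 𝕜) * K.size.factorial * (K.fact : 𝕜)⁻¹ = coeffB 𝕜 K := by
  rw [bernSeries', PowerSeries.coeff_mk,
    div_mul_cancel₀ _ (Nat.cast_ne_zero.mpr (Nat.factorial_ne_zero _)), coeffB, div_eq_mul_inv]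

/-- B_n = -(-1)^n C_n: for n = 1 the two signs cancel, otherwise (-1)^n B_n = B_n. The minus sign
disappears when the terms are moved to the other side in `curry_symAct_nonneg`. -/
theorem coeff_bernSeries {𝕜 : Type u} [Field 𝕜] [CharZero 𝕜] {r s : ℕ} (K : MultiIndex r s) :
    PowerSeries.coeff K.size (bernSeries 𝕜) * K.size.factorial * (K.fact : 𝕜)⁻¹ =
      -coeffC 𝕜 K := by
  have h : bernoulli K.size = -((-1) ^ K.size * bernoulliC K.size) := by
    rw [bernoulliC]
    split_ifs with h
    · rw [h]; ring
    · have h1 := bernoulli_eq_bernoulli'_of_ne_one h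
      have h2 : bernoulli K.size = (-1) ^ K.size * bernoulli' K.size := rfl
      rw [← h1] at h2
      linear_combination h2
  rw [bernSeries, PowerSeries.coeff_mk,
    div_mul_cancel₀ _ (Nat.cast_ne_zero.mpr (Nat.factorial_ne_zero _)), coeffC, div_eq_mul_inv, h]
  push_cast
  ring

/-! ### The formulas on g_-, g_0 and g_+ -/

namespace LieSuperalgebra

variable {𝕜 : Type u} {g : Type v} [Field 𝕜] [AddCommGroup g] [Module 𝕜 g]
variable {L : LieSuperalgebra 𝕜 g} {G : L.ZGrading}

namespace ZGrading

variable [CharZero 𝕜] [FiniteDimensional 𝕜 g] {r s : ℕ} (X : Module.Basis (Fin (r + s)) 𝕜 G.minus)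
  (lam : G.Character)

variable (G) in
omit [CharZero 𝕜] [FiniteDimensional 𝕜 g] in
theorem bracket_zero_mem_minus {x y : g} (hx : x ∈ G.gr 0) (hy : y ∈ G.minus) :
    L.bracket x y ∈ G.minus := by
  induction hy using Submodule.iSup_induction' with
  | mem j y hy => exact G.gr_le_minus (by simpa using j.2) (G.bracket_mem hx hy)
  | zero => simp
  | add y z _ _ hy hz => rw [map_add]; exact Submodule.add_mem _ hy hz

omit [CharZero 𝕜] [FiniteDimensional 𝕜 g] in
theorem Character.ext_plus (lam : G.Character) {x : g} (hx : x ∈ G.plus) : lam.ext x = 0 := by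
  induction hx using Submodule.iSup_induction' with
  | mem i x hx => simp [Character.ext, G.toZero_of_mem_ne hx i.2.ne']
  | zero => simp
  | add x y _ _ hx hy => simp [hx, hy]

theorem curry_symAct_minus {x : g} (hx : x ∈ G.minus) :
    TensorProduct.curry (symAct X indexParity lam) x = G.mulOp (G.toMinus x) := by
  ext z
  rw [TensorProduct.curry_apply, symAct_minus X indexParity lam (tmul_mem_tp hx trivial),
    mulMap_tmul]
  rfl

/-- One shift already maps g_0 into g_-, where Q is multiplication. -/
theorem act_gr_zero (Z : G.gr 0) : act X indexParity lam Z =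
    lam.toFun Z • (1 : Module.End 𝕜 G.minusSpace.Sym) +
      ∑ i, G.mulOp (G.toMinus (L.bracket Z (X i))) * G.partialDeriv X i := by
  ext z
  have hb : ∀ i, L.bracket Z (X i) ∈ G.minus := fun i => G.bracket_zero_mem_minus Z.2 (X i).2
  have hm : G.shift X indexParity ((Z : g) ⊗ₜ z) ∈ G.tp G.minus ⊤ := by
    rw [shift_tmul]
    exact Submodule.sum_mem _ fun i _ => tmul_mem_tp (hb i) trivial
  rw [act_apply, actMap_nonneg X indexParity lam (tmul_mem_tp (G.gr_le_nonneg le_rfl Z.2) trivial),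
    symAct_minus X indexParity lam hm, lamMap_tmul, shift_tmul, map_sum, Character.ext,
    LinearMap.comp_apply, G.toZero_of_mem Z.2, LinearMap.add_apply, LinearMap.sum_apply]
  congr 1

variable (hX : ∀ i, X i ∈ G.minusSpace.par (indexParity i))

include hX

/-- The operators s^K preserve g_-, so after expanding the series t/(1 - e^{-t}) every application
of Q is a multiplication. -/
theorem act_minus (Z : G.minus) : act X indexParity lam Z = G.mulOp Z +
    ∑ᶠ K : MultiIndex r s,
      coeffB 𝕜 K • (G.mulOp (G.toMinus (G.sOp X K Z)) * G.partialPow X K) := by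
  rw [act, actMap, G.curry_ev X hX, coeff_zero_bernSeries', one_smul,
    curry_symAct_minus X lam Z.2, G.toMinus_of_mem]
  congr 1
  refine finsum_congr fun K => ?_
  rw [coeff_bernSeries', curry_symAct_minus X lam (G.sOp_mem_minus X hX K Z.2)]

/-- The equation Q ∘ D/(e^D - 1) = λ solved for the constant term of the series. It is the source of
the recursion for W and H. -/
theorem curry_symAct_nonneg {x : g} (hx : x ∈ G.nonneg) :
    TensorProduct.curry (symAct X indexParity lam) x =
      lam.ext x • (1 : Module.End 𝕜 G.minusSpace.Sym) + ∑ᶠ K : MultiIndex r s,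
        (TensorProduct.curry (symAct X indexParity lam) (coeffC 𝕜 K • G.sOp X K x) :
          Module.End 𝕜 G.minusSpace.Sym) * G.partialPow X K := by
  have h1 := G.curry_ev X hX (symAct X indexParity lam) (bernSeries 𝕜) x
  have h2 : TensorProduct.curry (symAct X indexParity lam ∘ₗ G.ev X indexParity (bernSeries 𝕜)) x =
      lam.ext x • (1 : Module.End 𝕜 G.minusSpace.Sym) := by
    ext z
    rw [TensorProduct.curry_apply, LinearMap.comp_apply,
      symAct_nonneg X indexParity lam (tmul_mem_tp hx trivial), lamMap_tmul]
    rfl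
  rw [← h2, h1, coeff_zero_bernSeries, one_smul, add_assoc, left_eq_add,
    ← eq_neg_iff_add_eq_zero, ← finsum_neg_distrib]
  refine finsum_congr fun K => ?_
  rw [coeff_bernSeries, map_smul, smul_mul_assoc]
  exact neg_smul (coeffC 𝕜 K) (_ : G.minusSpace.Sym →ₗ[𝕜] G.minusSpace.Sym)

/-- The sum of the terms with `j` multi-indices before the components in `k` are expanded. -/
def iterAct (Z : g) (i : Fin (r + s)) (j : ℕ) : Module.End 𝕜 G.minusSpace.Sym :=
  ∑ᶠ Ks : List.Vector (MultiIndex r s) j,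
    (TensorProduct.curry (symAct X indexParity lam) (G.whTerm X Z i Ks.toList) :
      Module.End 𝕜 G.minusSpace.Sym) * G.partialList X i Ks.toList

theorem finite_support_vector {M : Type*} [AddCommMonoid M] (Z : g) (i : Fin (r + s)) (j : ℕ)
    (f : g → List (MultiIndex r s) → M) (hf : ∀ Ks, f 0 Ks = 0) :
    (Function.support fun Ks : List.Vector (MultiIndex r s) j =>
      f (G.whTerm X Z i Ks.toList) Ks.toList).Finite := by
  refine ((G.finite_whTerm_ne_zero X hX Z i).preimage
    (f := fun Ks : List.Vector (MultiIndex r s) j => Ks.toList)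
    Subtype.val_injective.injOn).subset fun Ks h => ?_
  intro h0
  rw [Function.mem_support, h0, hf] at h
  exact h rfl

/-- Each element is split along g_- ⊕ k. On the first component Q is multiplication; on the second
it is expanded once more, the new multi-index becoming the head of the list. -/
theorem iterAct_eq (Z : g) (i : Fin (r + s)) (j : ℕ) :
    iterAct X lam Z i j =
      (∑ᶠ Ks : List.Vector (MultiIndex r s) j,
        G.mulOp (G.wTerm X Z i Ks.toList) * G.partialList X i Ks.toList) +
      (∑ᶠ Ks : List.Vector (MultiIndex r s) j,
        lam.ext (G.hTerm X Z i Ks.toList) • G.partialList X i Ks.toList) +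
      iterAct X lam Z i (j + 1) := by
  have hcons : iterAct X lam Z i (j + 1) = ∑ᶠ Ks : List.Vector (MultiIndex r s) j,
      ∑ᶠ K : MultiIndex r s, (TensorProduct.curry (symAct X indexParity lam)
        (coeffC 𝕜 K • G.sOp X K (G.hTerm X Z i Ks.toList)) : Module.End 𝕜 G.minusSpace.Sym) *
          G.partialPow X K * G.partialList X i Ks.toList := by
    have hb : Function.Bijective fun p : List.Vector (MultiIndex r s) j × MultiIndex r s =>
        p.2 ::ᵥ p.1 := by
      constructor
      · rintro ⟨Ks, K⟩ ⟨Ls, M⟩ h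
        have h1 := congrArg List.Vector.head h
        have h2 := congrArg List.Vector.tail h
        simp only [List.Vector.head_cons, List.Vector.tail_cons] at h1 h2
        rw [h1, h2]
      · intro Ks
        exact ⟨(Ks.tail, Ks.head), List.Vector.cons_head_tail Ks⟩
    have hfin := finite_support_vector X hX Z i (j + 1) (fun x Ks =>
      (TensorProduct.curry (symAct X indexParity lam) x :
        Module.End 𝕜 G.minusSpace.Sym) * G.partialList X i Ks) (fun Ks => by
          rw [map_zero, zero_mul])
    -- Lists of length j + 1 are pairs of a tail and a head; finite support allows the sum over
    -- pairs to be iterated.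
    rw [iterAct, ← finsum_eq_of_bijective _ hb (fun p => rfl), finsum_curry]
    · refine finsum_congr fun Ks => finsum_congr fun K => ?_
      rw [mul_assoc, List.Vector.toList_cons, partialList, partialList, List.map_cons,
        List.prod_cons, mul_assoc]
      rfl
    · exact hfin.preimage hb.injective.injOn
  rw [hcons, ← finsum_add_distrib, ← finsum_add_distrib]
  · refine finsum_congr fun Ks => ?_
    have hs := G.toMinus_add_projNonneg (G.whTerm X Z i Ks.toList)
    conv_lhs => rw [← hs, map_add, curry_symAct_minus X lam (G.toMinus _).2, G.toMinus_of_mem,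
      curry_symAct_nonneg X lam hX (G.projNonneg_mem _)]
    rw [add_mul, add_mul, smul_mul_assoc, one_mul, ← add_assoc]
    congr 1
    refine (AddMonoidHom.mulRight (G.partialList X i Ks.toList)).map_finsum ?_
    refine (G.finite_sOp_ne_zero X hX (G.hTerm X Z i Ks.toList)).subset fun K hK => ?_
    intro h
    refine hK ?_
    change (TensorProduct.curry (symAct X indexParity lam)
        (coeffC 𝕜 K • G.sOp X K (G.hTerm X Z i Ks.toList)) : Module.End 𝕜 G.minusSpace.Sym) * _ = 0
    rw [h, smul_zero, map_zero, zero_mul]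
  · refine Set.Finite.subset ((finite_support_vector X hX Z i j (fun x Ks =>
      G.mulOp (G.toMinus x) * G.partialList X i Ks) (fun Ks => by simp)).union
      (finite_support_vector X hX Z i j (fun x Ks =>
        lam.ext (G.projNonneg x) • G.partialList X i Ks) (fun Ks => by simp)))
      (Function.support_add _ _)
  · refine finite_support_vector X hX Z i j (fun x Ks => ∑ᶠ K : MultiIndex r s,
      (TensorProduct.curry (symAct X indexParity lam)
        (coeffC 𝕜 K • G.sOp X K (G.projNonneg x)) : Module.End 𝕜 G.minusSpace.Sym) *
          G.partialPow X K * G.partialList X i Ks) (fun Ks => by simp)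
  · exact finite_support_vector X hX Z i j (fun x Ks =>
      G.mulOp (G.toMinus x) * G.partialList X i Ks) (fun Ks => by simp)
  · exact finite_support_vector X hX Z i j (fun x Ks =>
      lam.ext (G.projNonneg x) • G.partialList X i Ks) (fun Ks => by simp)

theorem iterAct_zero_eq (Z : g) (i : Fin (r + s)) (l : ℕ) :
    iterAct X lam Z i 0 =
      (∑ j ∈ Finset.range l, ∑ᶠ Ks : List.Vector (MultiIndex r s) j,
        G.mulOp (G.wTerm X Z i Ks.toList) * G.partialList X i Ks.toList) +
      (∑ j ∈ Finset.range l, ∑ᶠ Ks : List.Vector (MultiIndex r s) j,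
        lam.ext (G.hTerm X Z i Ks.toList) • G.partialList X i Ks.toList) +
      iterAct X lam Z i l := by
  induction l with
  | zero => simp
  | succ l ih =>
    rw [ih, Finset.sum_range_succ, Finset.sum_range_succ, iterAct_eq X lam hX Z i l]
    abel

omit hX in
theorem iterAct_of_hTerm_eq_zero (Z : g) (i : Fin (r + s)) (l : ℕ)
    (hl : ∀ Ks : List (MultiIndex r s), Ks.length = l → G.hTerm X Z i Ks = 0) :
    iterAct X lam Z i l = ∑ᶠ Ks : List.Vector (MultiIndex r s) l,
      G.mulOp (G.wTerm X Z i Ks.toList) * G.partialList X i Ks.toList := by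
  refine finsum_congr fun Ks => ?_
  have hs := G.toMinus_add_projNonneg (G.whTerm X Z i Ks.toList)
  have h0 : G.projNonneg (G.whTerm X Z i Ks.toList) = 0 := hl _ Ks.toList_length
  rw [h0, add_zero] at hs
  conv_lhs => rw [← hs, curry_symAct_minus X lam (G.toMinus _).2, G.toMinus_of_mem]
  rfl

omit hX in
theorem act_plus_eq_iterAct {Z : g} (hZ : Z ∈ G.plus) :
    act X indexParity lam Z = ∑ i, iterAct X lam Z i 0 := by
  ext z
  rw [act_apply, actMap_nonneg X indexParity lam (tmul_mem_tp (G.plus_le_nonneg hZ) trivial),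
    lamMap_tmul, lam.ext_plus hZ, zero_smul, zero_add, shift_tmul, map_sum, LinearMap.sum_apply]
  refine Finset.sum_congr rfl fun i _ => ?_
  have h : iterAct X lam Z i 0 = (TensorProduct.curry (symAct X indexParity lam)
      (L.bracket Z (X i)) : Module.End 𝕜 G.minusSpace.Sym) * G.partialDeriv X i := by
    rw [iterAct, finsum_eq_single _ List.Vector.nil
      (fun Ks h => absurd (List.Vector.eq_nil Ks) h)]
    simp [partialList, whTerm]
  rw [h]
  rfl

/-- After `l` expansions no component in k is left, so the last stage contributes a W term but no λ
term. This explains the different ranges. -/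
theorem act_plus {Z : g} (hZ : Z ∈ G.plus) (l : ℕ) (hl : ∀ i, ∀ Ks : List (MultiIndex r s),
    Ks.length = l → G.hTerm X Z i Ks = 0) : act X indexParity lam Z =
      (∑ i, ∑ j ∈ Finset.range (l + 1), ∑ᶠ Ks : List.Vector (MultiIndex r s) j,
        G.mulOp (G.wTerm X Z i Ks.toList) * G.partialList X i Ks.toList) +
      (∑ i, ∑ j ∈ Finset.range l, ∑ᶠ Ks : List.Vector (MultiIndex r s) j,
        lam.ext (G.hTerm X Z i Ks.toList) • G.partialList X i Ks.toList) := by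
  rw [act_plus_eq_iterAct X lam hZ, ← Finset.sum_add_distrib]
  refine Finset.sum_congr rfl fun i _ => ?_
  rw [iterAct_zero_eq X lam hX Z i l, iterAct_of_hTerm_eq_zero X lam Z i l (hl i),
    Finset.sum_range_succ]
  abel

end ZGrading

end LieSuperalgebra

/-! ### The 3-graded case -/

namespace LieSuperalgebra

variable {𝕜 : Type u} {g : Type v} [Field 𝕜] [AddCommGroup g] [Module 𝕜 g]
variable {L : LieSuperalgebra 𝕜 g} {G : L.ZGrading}

namespace ZGrading

theorem eq_zero_of_mem_gr {i j : ℤ} (hij : i ≠ j) {x : g} (hi : x ∈ G.gr i) (hj : x ∈ G.gr j) :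
    x = 0 :=
  Submodule.disjoint_def.mp (G.isInternal.submodule_iSupIndep.pairwiseDisjoint hij) x hi hj

/-- The bracket has degree -2 but lies in g_-, which is concentrated in degree -1. -/
theorem bracket_minus_eq_zero (hm : G.minus = G.gr (-1)) {x y : g} (hx : x ∈ G.minus)
    (hy : y ∈ G.minus) : L.bracket x y = 0 := by
  have h := G.bracket_mem_minus hx hy
  rw [hm] at h hx hy
  exact eq_zero_of_mem_gr (by decide) (G.bracket_mem hx hy) h

theorem bracket_bracket_mem_minus {Z : g} (hZ : Z ∈ G.gr 1) (hm : G.minus = G.gr (-1)) {x y : g}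
    (hx : x ∈ G.minus) (hy : y ∈ G.minus) : L.bracket (L.bracket Z x) y ∈ G.minus := by
  rw [hm] at *
  exact G.bracket_mem (G.bracket_mem hZ hx) hy

variable [CharZero 𝕜] [FiniteDimensional 𝕜 g] {r s : ℕ} (X : Module.Basis (Fin (r + s)) 𝕜 G.minus)
  (lam : G.Character)

theorem act_minus_of_threeGraded (hm : G.minus = G.gr (-1)) (Z : G.minus) :
    act X indexParity lam Z = G.mulOp Z := by
  ext z
  have h : G.shift X indexParity ((Z : g) ⊗ₜ z) = 0 := by
    rw [shift_tmul]
    refine Finset.sum_eq_zero fun i _ => ?_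
    rw [bracket_minus_eq_zero hm Z.2 (X i).2, TensorProduct.zero_tmul]
  rw [act_apply, actMap, LinearMap.comp_apply, ev_of_shift_eq_zero _ _ _ _ h,
    coeff_zero_bernSeries', one_smul, symAct_minus_tmul]
  rfl

/-- The shift moves Z through g_0 to g_- and then to zero. On w = D(Z ⊗ z) the series t/(e^t - 1)
therefore stops after its linear term, and Q(w) = λ(w) + Q(D w)/2, where Q(D w) is a multiplication.
-/
theorem act_one_of_threeGraded (hm : G.minus = G.gr (-1)) {Z : g} (hZ : Z ∈ G.gr 1) :
    act X indexParity lam Z =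
      (∑ i, lam.ext (L.bracket Z (X i)) • G.partialDeriv X i) +
      (1 / 2 : 𝕜) • (∑ i, ∑ j,
        G.mulOp (G.toMinus (L.bracket (L.bracket Z (X i)) (X j))) *
          (G.partialDeriv X j * G.partialDeriv X i)) := by
  ext z
  set w := G.shift X indexParity (Z ⊗ₜ z) with hw
  have hZ0 : Z ∈ G.nonneg := G.gr_le_nonneg zero_le_one hZ
  have hwn : w ∈ G.tp G.nonneg ⊤ := by
    rw [hw, shift_tmul]
    refine Submodule.sum_mem _ fun i _ => tmul_mem_tp (G.gr_le_nonneg le_rfl ?_) trivial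
    exact G.bracket_mem hZ (hm.le (X i).2)
  have hsw : G.shift X indexParity w = ∑ i, ∑ j, L.bracket (L.bracket Z (X i)) (X j) ⊗ₜ[𝕜]
      G.minusSpace.pd X indexParity j (G.minusSpace.pd X indexParity i z) := by
    rw [hw, shift_tmul, map_sum]
    exact Finset.sum_congr rfl fun i _ => shift_tmul _ _ _ _ _
  have hmem : ∀ i j, L.bracket (L.bracket Z (X i)) (X j) ∈ G.minus := fun i j =>
    bracket_bracket_mem_minus hZ hm (X i).2 (X j).2
  have hswm : G.shift X indexParity w ∈ G.tp G.minus ⊤ := by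
    rw [hsw]
    exact Submodule.sum_mem _ fun i _ => Submodule.sum_mem _ fun j _ =>
      tmul_mem_tp (hmem i j) trivial
  have h2 : G.shift X indexParity (G.shift X indexParity w) = 0 := by
    refine G.mem_tp_eq (f' := 0) (fun x hx z _ => ?_) hswm
    rw [shift_tmul, LinearMap.zero_apply]
    refine Finset.sum_eq_zero fun i _ => ?_
    rw [bracket_minus_eq_zero hm hx (X i).2, TensorProduct.zero_tmul]
  -- The coefficient is B_1 = -1/2; it becomes the factor 1/2 when the term is moved to the other
  -- side.
  have h3 : G.ev X indexParity (bernSeries 𝕜) w = w - (1 / 2 : 𝕜) • G.shift X indexParity w := by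
    rw [ev_apply', coeff_zero_bernSeries, one_smul, Finset.sum_eq_single 0]
    · rw [bernSeries, PowerSeries.coeff_mk, zero_add, pow_one, bernoulli_one]
      norm_num [sub_eq_add_neg]
    · intro k _ hk
      obtain ⟨k, rfl⟩ := Nat.exists_eq_succ_of_ne_zero hk
      rw [pow_succ, pow_succ, Module.End.mul_apply, Module.End.mul_apply, h2, map_zero, smul_zero]
    · intro h; exact absurd (Finset.mem_range.mpr (Nat.succ_pos _)) h
  have h4 := symAct_nonneg X indexParity lam hwn
  rw [h3, map_sub, map_smul, sub_eq_iff_eq_add] at h4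
  rw [act_apply, actMap_nonneg X indexParity lam (tmul_mem_tp hZ0 trivial), ← hw, h4,
    symAct_minus X indexParity lam hswm, hsw, lamMap_tmul, Character.ext, LinearMap.comp_apply,
    G.toZero_of_mem_ne hZ one_ne_zero, map_zero, zero_smul, zero_add, hw, shift_tmul]
  simp only [map_sum, lamMap_tmul, mulMap_tmul, LinearMap.add_apply, LinearMap.sum_apply,
    LinearMap.smul_apply]
  rfl

end ZGrading

end LieSuperalgebra

end

theorem theorem3p4 {𝕜 : Type*} [RCLike 𝕜] {g : Type*} [AddCommGroup g] [Module 𝕜 g]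
    [FiniteDimensional 𝕜 g] (L : LieSuperalgebra 𝕜 g) (G : L.ZGrading) (lam : G.Character)
    {r s : ℕ} (X : Module.Basis (Fin (r + s)) 𝕜 G.minus)
    (hX0 : ∀ i : Fin (r + s), (i : ℕ) < r → (X i : g) ∈ L.par 0)
    (hX1 : ∀ i : Fin (r + s), r ≤ (i : ℕ) → (X i : g) ∈ L.par 1) :
    ∃ h : Function.Bijective lam.vermaMap,
      -- the elements of `g_-`
      (∀ Z : G.minus,
        (∀ K : MultiIndex r s, G.sOp X K Z ∈ G.minus) ∧
        {K : MultiIndex r s | G.sOp X K Z ≠ 0}.Finite ∧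
        lam.realisation h Z = G.mulOp Z +
          (∑ᶠ K : MultiIndex r s,
            coeffB 𝕜 K • (G.mulOp (G.toMinus (G.sOp X K Z)) * G.partialPow X K))) ∧
      -- the elements of `g_0`
      (∀ Z : G.gr 0,
        (∀ i, L.bracket Z (X i) ∈ G.minus) ∧
        lam.realisation h Z = lam.toFun Z • (1 : Module.End 𝕜 G.minusSpace.Sym) +
          (∑ i, G.mulOp (G.toMinus (L.bracket Z (X i))) * G.partialDeriv X i)) ∧
      -- the elements of `g_+`
      (∀ Z ∈ G.plus,
        (∀ i, {Ks : List (MultiIndex r s) | G.whTerm X Z i Ks ≠ 0}.Finite) ∧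
        (∃ l : ℕ, ∀ i, ∀ Ks : List (MultiIndex r s), Ks.length = l → G.hTerm X Z i Ks = 0) ∧
        ∀ l : ℕ, (∀ i, ∀ Ks : List (MultiIndex r s), Ks.length = l → G.hTerm X Z i Ks = 0) →
          lam.realisation h Z =
            (∑ i, ∑ j ∈ Finset.range (l + 1), ∑ᶠ Ks : List.Vector (MultiIndex r s) j,
              G.mulOp (G.wTerm X Z i Ks.toList) * G.partialList X i Ks.toList) +
            (∑ i, ∑ j ∈ Finset.range l, ∑ᶠ Ks : List.Vector (MultiIndex r s) j,
              lam.ext (G.hTerm X Z i Ks.toList) • G.partialList X i Ks.toList)) ∧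
      -- the case of a 3-grading
      (G.plus = G.gr 1 → G.minus = G.gr (-1) →
        (∀ Z : G.minus, lam.realisation h Z = G.mulOp Z) ∧
        (∀ Z : G.gr 0,
          lam.realisation h Z = lam.toFun Z • (1 : Module.End 𝕜 G.minusSpace.Sym) +
            (∑ i, G.mulOp (G.toMinus (L.bracket Z (X i))) * G.partialDeriv X i)) ∧
        (∀ Z ∈ G.gr 1,
          (∀ i j, L.bracket (L.bracket Z (X i)) (X j) ∈ G.minus) ∧
          lam.realisation h Z =
            (∑ i, lam.ext (L.bracket Z (X i)) • G.partialDeriv X i) +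
            (1 / 2 : 𝕜) • (∑ i, ∑ j,
              G.mulOp (G.toMinus (L.bracket (L.bracket Z (X i)) (X j))) *
                (G.partialDeriv X j * G.partialDeriv X i)))) := by
  have hX := G.basis_mem_par X hX0 hX1
  have h : Function.Bijective lam.vermaMap := LieSuperalgebra.ZGrading.vermaMap_bijective X indexParity lam hX
  have hact := LieSuperalgebra.ZGrading.realisation_eq X indexParity lam hX h
  refine ⟨h, fun Z => ⟨fun K => G.sOp_mem_minus X hX K Z.2, G.finite_sOp_ne_zero X hX Z, ?_⟩,
    fun Z => ⟨fun i => G.bracket_zero_mem_minus Z.2 (X i).2, ?_⟩,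
    fun Z hZ => ⟨G.finite_whTerm_ne_zero X hX Z, G.exists_hTerm_eq_zero X hX Z, fun l hl => ?_⟩,
    fun _ hm => ⟨fun Z => ?_, fun Z => ?_, fun Z hZ =>
      ⟨fun i j => LieSuperalgebra.ZGrading.bracket_bracket_mem_minus hZ hm (X i).2 (X j).2, ?_⟩⟩⟩
  · rw [hact, LieSuperalgebra.ZGrading.act_minus X lam hX]
  · rw [hact, LieSuperalgebra.ZGrading.act_gr_zero X lam]
  · rw [hact, LieSuperalgebra.ZGrading.act_plus X lam hX hZ l hl]
  · rw [hact, LieSuperalgebra.ZGrading.act_minus_of_threeGraded X lam hm]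
  · rw [hact, LieSuperalgebra.ZGrading.act_gr_zero X lam]
  · rw [hact, LieSuperalgebra.ZGrading.act_one_of_threeGraded X lam hm hZ]
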